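/- Conventions. Categories are identified with their nerves, so that an $n$-fold category, and more generally a simplicial object in $(n-1)$-fold simplicial sets, is an $n$-fold simplicial set $X$; $X_k$ denotes its levels in the first direction. $p$ (resp. $q$) is the functor $\mathrm{Cat}\to\mathrm{Set}$ of isomorphism classes of objects (resp. of connected components), $p^{(n)}$, $q^{(n)}$ denote their application in the last direction and $d^{(n)}$ the discrete inclusion in the last direction. Let $X^d=d^{(n)}\cdots d^{(1)}p^{(1)}\cdots p^{(n)}X$. For $X$ homotopically discrete (where $p$ and $q$ agree) $\gamma:X\to X^d$ is the discretization map. Definitions, by induction on $n$. - $\mathrm{Cat}_{hd}^1$: equivalence relations (categories with at most one arrow between two objects, all arrows invertible). $X\in\mathrm{Cat}_{hd}^n$ if $X$ is a simplicial object in $\mathrm{Cat}_{hd}^{n-1}$ whose Segal maps $X_k\to X_1\times_{X_0}\cdots\times_{X_0}X_1$, $k\ge2$, are isomorphisms and $p^{(n)}X\in\mathrm{Cat}_{hd}^{n-1}$. - $\mathrm{Cat}_{wg}^1=\mathrm{Ta}_{wg}^1=\mathrm{Cat}$. $X\in\mathrm{Ta}_{wg}^n$ if $X$ is a simplicial object in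 $\mathrm{Ta}_{wg}^{n-1}$, $X_0\in\mathrm{Cat}_{hd}^{n-1}$ and the induced Segal maps $X_k\to X_1\times_{X_0^d}\cdots\times_{X_0^d}X_1$, $k\ge2$, are $(n-1)$-equivalences. $X\in\mathrm{Cat}_{wg}^n$ if $X$ is a simplicial object in $\mathrm{Cat}_{wg}^{n-1}$, $X_0\in\mathrm{Cat}_{hd}^{n-1}$, the Segal maps are isomorphisms, the induced Segal maps are $(n-1)$-equivalences, and $p^{(n)}X$ is (the multinerve of) an object of $\mathrm{Cat}_{wg}^{n-1}$. Then $\mathrm{Cat}_{wg}^n\subset\mathrm{Ta}_{wg}^n$; both are full subcategories of $n$-fold simplicial sets. - A $1$-equivalence is an equivalence of categories. A map $f:X\to Y$ is an $n$-equivalence if $p^{(n)}f$ is an $(n-1)$-equivalence and, for all $a,b\in X_0^d$, so is $f(a,b):X(a,b)\to Y(fa,fb)$, where $X(a,b)$ is the fibre of $X_1\to X_0\times X_0\to X_0^d\times X_0^d$ at $(a,b)$. - $\mathrm{FTa}_{wg}^n$, $n\ge2$: objects are $X\in\mathrm{Ta}_{wg}^n$ with a choice of sections $\gamma'(X_{\underline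 k0}):X_{\underline k0}^d\to X_{\underline k0}$ of the discretization maps for all $\underline k=(k_1,\dots,k_s)$, $0\le s\le n-2$, natural in $\underline k\in(\Delta^{op})^s$; morphisms are the maps $f:X\to Y$ with $f_{\underline k0}\gamma'(X_{\underline k0})=\gamma'(Y_{\underline k0})f^d_{\underline k0}$ for all $\underline k$. - For a simplicial object $X$ and $f_0:Y_0\to X_0$ let $X(f_0)_k=X_k\times_{X_0^{k+1}}Y_0^{k+1}$. Define functors $V_n$ with natural maps $f_X:V_nX\to X$: $V_1X=\mathrm{Dec}\,X$ is the décalage $(\mathrm{Dec}\,X)_k=X_{k+1}$ (adding a new initial vertex), with $f_X$ forgetting the new vertex; for $n\ge2$, $V_nX$ is the pullback of $X(f_{X_0})\to d^{(n)}\cdots d^{(2)}E$ along $d^{(n)}\cdots d^{(2)}\mathrm{Dec}\,E\to d^{(n)}\cdots d^{(2)}E$, where $f_{X_0}:V_{n-1}X_0\to X_0$ and $E=q^{(2)}\cdots q^{(n)}X(f_{X_0})$. Let $F_nX=X(f_{X_0})$ with $f_{X_0}:V_{n-1}X_0\to X_0$. Put $G_2=F_2$ and $G_n=\overline{G}_{n-1}\circ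 F_n$, that is $(G_nX)_k=G_{n-1}((F_nX)_k)$. Proposition. For every $n\ge2$: a) $G_n$ is a functor $G_n:\mathrm{Cat}_{wg}^n\to\mathrm{FTa}_{wg}^n$ (that is, its restriction to $\mathrm{Cat}_{wg}^n$ lifts to $\mathrm{FTa}_{wg}^n$ for suitable choices of sections), and $(G_nX)_k\in\mathrm{Cat}_{wg}^{n-1}$ for all $X\in\mathrm{Cat}_{wg}^n$ and $k\ge0$. b) There is an $n$-equivalence $G_nX\to X$ in $\mathrm{Ta}_{wg}^n$, natural in $X\in\mathrm{Cat}_{wg}^n$. c) $G_n$ preserves $n$-equivalences. d) $G_n$ is the identity on discrete objects, in the sense that the map in b) is an isomorphism if $X$ is discrete (a constant multi-simplicial set), and $G_n$ preserves pullbacks over discrete objects, both as a functor to $\mathrm{FTa}_{wg}^n$ and as a functor to $n$-fold simplicial sets. -/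

import Mathlib

open CategoryTheory CategoryTheory.Limits Opposite

universe v u

noncomputable section

namespace WG

/-! ## Generalities on simplicial objects -/

section Generalities

variable {C : Type v} [Category.{u} C]

/-- `X_k` for a simplicial object `X`. -/
abbrev lev (X : SimplicialObject C) (k : ℕ) : C := X.obj (op (SimplexCategory.mk k))

/-- Evaluation at `[0]`. -/
abbrev evZero : SimplicialObject C ⥤ C :=
  (evaluation SimplexCategoryᵒᵖ C).obj (op (SimplexCategory.mk 0))

/-- The source map `d_1 : X_1 ⟶ X_0`. -/
abbrev src (X : SimplicialObject C) : lev X 1 ⟶ lev X 0 := X.δ (1 : Fin 2)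

/-- The target map `d_0 : X_1 ⟶ X_0`. -/
abbrev tgt (X : SimplicialObject C) : lev X 1 ⟶ lev X 0 := X.δ (0 : Fin 2)

/-- The map `X_m ⟶ X_1` induced by `[1] ⟶ [m]`, `0 ↦ j`, `1 ↦ j + 1`. -/
abbrev nu (X : SimplicialObject C) {m : ℕ} (j : Fin m) : lev X m ⟶ lev X 1 :=
  X.map (SimplexCategory.mkOfSucc j).op

/-- The iterated fibre product `A ×_B A ×_B ⋯ ×_B A` with `m + 1` factors, for a "source"
`s : A ⟶ B` and a "target" `t : A ⟶ B`: families `(a_0, …, a_m)` with `t a_i = s a_{i+1}`. -/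
abbrev chain [HasLimits C] {A B : C} (s t : A ⟶ B) (m : ℕ) : C :=
  equalizer
    (Pi.lift fun i : Fin m => Pi.π (fun _ : Fin (m + 1) => A) i.castSucc ≫ t)
    (Pi.lift fun i : Fin m => Pi.π (fun _ : Fin (m + 1) => A) i.succ ≫ s)

lemma nu_tgt (X : SimplicialObject C) {m : ℕ} (i : Fin m) :
    nu X i.castSucc ≫ tgt X = nu X i.succ ≫ src X := by
  simp only [nu, tgt, src, SimplicialObject.δ_def, ← X.map_comp, ← op_comp]
  erw [SimplexCategory.δ_zero_mkOfSucc, SimplexCategory.δ_one_mkOfSucc]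
  rfl

/-- For a simplicial object `X` and a map `g : X_0 ⟶ B`, the map
`X_{m+1} ⟶ X_1 ×_B ⋯ ×_B X_1` (`m + 1` factors) whose components are the maps `nu`.
For `g = 𝟙` it is the Segal map, and for `g` the discretization map `X_0 ⟶ X_0^d` it is the
induced Segal map. -/
def segalMap [HasLimits C] (X : SimplicialObject C) {B : C} (g : lev X 0 ⟶ B) (m : ℕ) :
    lev X (m + 1) ⟶ chain (src X ≫ g) (tgt X ≫ g) m :=
  equalizer.lift (Pi.lift fun j : Fin (m + 1) => nu X j) (by
    refine Pi.hom_ext _ _ fun i => ?_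
    have := nu_tgt X i
    simp only [Category.assoc, Pi.lift_π, Pi.lift_π_assoc]
    rw [← Category.assoc, this, Category.assoc])

/-- The Segal condition: the Segal maps `X_k ⟶ X_1 ×_{X_0} ⋯ ×_{X_0} X_1` are isomorphisms
for all `k ≥ 2`. Equivalently, `X` is the nerve of an internal category. -/
def IsSegal [HasLimits C] (X : SimplicialObject C) : Prop :=
  ∀ m : ℕ, IsIso (segalMap X (𝟙 (lev X 0)) (m + 1))

/-- The simplicial object `[k] ↦ B × ⋯ × B` (`k + 1` factors), as a functor of `B`. -/
@[simps]
def codisc [HasLimits C] : C ⥤ SimplicialObject C where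
  obj B :=
    { obj := fun k => ∏ᶜ fun _ : Fin (k.unop.len + 1) => B
      map := fun θ => Pi.lift fun i => Pi.π _ (θ.unop.toOrderHom i) }
  map f := { app := fun _ => Pi.lift fun i => Pi.π _ i ≫ f }

/-- The map `X_k ⟶ X_0 × ⋯ × X_0` taking all the vertices. -/
@[simps]
def vertices [HasLimits C] : 𝟭 (SimplicialObject C) ⟶ evZero ⋙ codisc where
  app X :=
    { app := fun k => Pi.lift fun i =>
        X.map (SimplexCategory.const (SimplexCategory.mk 0) k.unop i).op
      naturality := fun k l θ => by
        refine Pi.hom_ext _ _ fun i => ?_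
        have h : SimplexCategory.const (SimplexCategory.mk 0) k.unop (θ.unop.toOrderHom i) =
            SimplexCategory.const (SimplexCategory.mk 0) l.unop i ≫ θ.unop := rfl
        change (X.map θ ≫ Pi.lift _) ≫ Pi.π _ i = (Pi.lift _ ≫ Pi.lift _) ≫ Pi.π _ i
        rw [Category.assoc, Category.assoc, Pi.lift_π, Pi.lift_π, Pi.lift_π, h, op_comp,
          X.map_comp]
        rfl }
  naturality X Y f := by
    ext k
    refine Pi.hom_ext _ _ fun i => ?_
    change (f.app k ≫ Pi.lift _) ≫ Pi.π _ i = (Pi.lift _ ≫ Pi.lift _) ≫ Pi.π _ i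
    rw [Category.assoc, Category.assoc, Pi.lift_π, Pi.lift_π, Pi.lift_π_assoc]
    exact (f.naturality _).symm

/-- The pointwise pullback of natural transformations `F ⟶ H ⟵ G`. -/
@[simps]
def pullbackFunctor [HasLimits C] {D : Type*} [Category* D] {F G H : D ⥤ C}
    (α : F ⟶ H) (β : G ⟶ H) : D ⥤ C where
  obj X := pullback (α.app X) (β.app X)
  map f := pullback.map _ _ _ _ (F.map f) (G.map f) (H.map f)
    (α.naturality f).symm (β.naturality f).symm
  map_id X := by
    apply pullback.hom_ext <;> simp [pullback.map]
  map_comp f g := by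
    apply pullback.hom_ext
    · rw [Category.assoc]
      erw [pullback.lift_fst, pullback.lift_fst, pullback.lift_fst_assoc]
      simp
    · rw [Category.assoc]
      erw [pullback.lift_snd, pullback.lift_snd, pullback.lift_snd_assoc]
      simp

/-- The first projection of a pointwise pullback. -/
@[simps]
def pullbackFunctorFst [HasLimits C] {D : Type*} [Category* D] {F G H : D ⥤ C}
    (α : F ⟶ H) (β : G ⟶ H) : pullbackFunctor α β ⟶ F where
  app X := pullback.fst (α.app X) (β.app X)
  naturality _ _ _ := pullback.lift_fst _ _ _

variable (C) in
/-- An endofunctor together with a natural map to the identity. -/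
structure Augmented where
  /-- the endofunctor -/
  functor : C ⥤ C
  /-- the natural map to the identity -/
  map : functor ⟶ 𝟭 C

/-- For a map `f_0 : Y_0 ⟶ X_0` let `X(f_0)` be the simplicial object
`X(f_0)_k = X_k ×_{X_0 × ⋯ × X_0} (Y_0 × ⋯ × Y_0)` (`k + 1` factors). If `X` is an internal
category then so is `X(f_0)`, with object of objects `Y_0` and object of arrows
`X_1 ×_{X_0 × X_0} (Y_0 × Y_0)`. Given an endofunctor `V` with a natural map `f : V ⟶ 𝟭`, this
is the functor `X ↦ X(f_{X_0})`, with the projection `X(f_{X_0}) ⟶ X`. -/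
def restrict [HasLimits C] (V : Augmented C) : Augmented (SimplicialObject C) where
  functor := pullbackFunctor vertices
    (Functor.whiskerLeft evZero (Functor.whiskerRight V.map codisc))
  map := pullbackFunctorFst _ _

end Generalities

/-! ## Multi-simplicial sets -/

/-- The category of `n`-fold simplicial sets, as iterated simplicial objects. The first simplicial
direction is the outermost one. Categories are identified with their nerves, and `n`-fold
categories with their multinerves. -/
def MSSetCat : ℕ → Cat.{u, u + 1}
  | 0 => Cat.of (Type u)
  | n + 1 => Cat.of (SimplicialObject (MSSetCat n))

/-- `n`-fold simplicial sets. -/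
abbrev MSSet (n : ℕ) : Type (u + 1) := MSSetCat.{u} n

instance hasLimits_MSSet : ∀ n : ℕ, HasLimits (MSSet.{u} n)
  | 0 => inferInstanceAs (HasLimits (Type u))
  | n + 1 =>
    have := hasLimits_MSSet n
    inferInstanceAs (HasLimits (SimplexCategoryᵒᵖ ⥤ MSSet.{u} n))

/-- An `(n+1)`-fold simplicial set is a simplicial object in `n`-fold simplicial sets. -/
abbrev simp {n : ℕ} (X : MSSet.{u} (n + 1)) : SimplicialObject (MSSet.{u} n) := X

/-- The same for morphisms. -/
abbrev simpMap {n : ℕ} {X Y : MSSet.{u} (n + 1)} (f : X ⟶ Y) : simp X ⟶ simp Y := f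

/-- Apply a functor levelwise in the first simplicial direction. -/
abbrev levelwise {m n : ℕ} (F : MSSet.{u} m ⥤ MSSet.{u} n) :
    MSSet.{u} (m + 1) ⥤ MSSet.{u} (n + 1) :=
  (Functor.whiskeringRight SimplexCategoryᵒᵖ (MSSet.{u} m) (MSSet.{u} n)).obj F

/-- Apply a natural transformation levelwise in the first simplicial direction. -/
abbrev levelwiseMap {m n : ℕ} {F G : MSSet.{u} m ⥤ MSSet.{u} n} (α : F ⟶ G) :
    levelwise F ⟶ levelwise G :=
  (Functor.whiskeringRight SimplexCategoryᵒᵖ (MSSet.{u} m) (MSSet.{u} n)).map α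

/-! ## Truncation and discretization -/

/-- Two objects of a category (two vertices of its nerve) are isomorphic. -/
def IsoRel (X : SSet.{u}) (x y : lev X 0) : Prop :=
  ∃ e : SSet.Edge x y, Nonempty e.InvStruct

/-- The isomorphism classes of objects functor `p : Cat ⥤ Set`. -/
def isoClasses : SSet.{u} ⥤ Type u where
  obj X := Quot (IsoRel X)
  map {X Y} f := TypeCat.ofHom (Quot.map (f.app (op (SimplexCategory.mk 0)))
    (fun _ _ ⟨e, ⟨h⟩⟩ => ⟨e.map f, ⟨h.map f⟩⟩))
  map_id X := by ext x; induction x using Quot.ind; rfl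
  map_comp f g := by ext x; induction x using Quot.ind; rfl

/-- The truncation functor `p^{(n+1)}`: apply `p` in the last simplicial direction. -/
def p : ∀ n : ℕ, MSSet.{u} (n + 1) ⥤ MSSet.{u} n
  | 0 => isoClasses
  | n + 1 => levelwise (p n)

/-- The functor `q^{(n+1)}`: apply the connected components functor `q` in the last simplicial
direction. -/
def q : ∀ n : ℕ, MSSet.{u} (n + 1) ⥤ MSSet.{u} n
  | 0 => SSet.π₀Functor
  | n + 1 => levelwise (q n)

/-- The discrete inclusion `d^{(n+1)}` in the last simplicial direction. -/
def d : ∀ n : ℕ, MSSet.{u} n ⥤ MSSet.{u} (n + 1)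
  | 0 => Functor.const SimplexCategoryᵒᵖ
  | n + 1 => levelwise (d n)

/-- The map `X ⟶ d q X` from a category to its discrete category of connected components. -/
def gammaZero : 𝟭 SSet.{u} ⟶ SSet.π₀Functor ⋙ Functor.const SimplexCategoryᵒᵖ where
  app X :=
    { app := fun k => TypeCat.ofHom fun x =>
        SSet.π₀.mk (X.map (SimplexCategory.const (SimplexCategory.mk 0) k.unop 0).op x)
      naturality := fun k l θ => by
        ext x
        change SSet.π₀.mk (X.map _ (X.map θ x)) = SSet.π₀.mk (X.map _ x)
        let e : lev X 1 := X.map (SimplexCategory.mkOfLe (n := k.unop.len) 0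
          (θ.unop.toOrderHom 0) (Fin.zero_le _)).op x
        have h := SSet.π₀.sound (SSet.Edge.mk' (X := X) e)
        have h1 : X.δ (1 : Fin 2) e =
            X.map (SimplexCategory.const (SimplexCategory.mk 0) k.unop 0).op x := by
          simp only [e, SimplicialObject.δ_def, ← Functor.map_comp_apply, ← op_comp]
          refine congrArg (fun t => X.map (Quiver.Hom.op t) x) ?_
          ext i
          fin_cases i
          rfl
        have h0 : X.δ (0 : Fin 2) e =
            X.map (SimplexCategory.const (SimplexCategory.mk 0) l.unop 0).op (X.map θ x) := by
          simp only [e, SimplicialObject.δ_def, ← Functor.map_comp_apply]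
          rw [← Quiver.Hom.op_unop θ]
          simp only [← op_comp]
          refine congrArg (fun t => X.map (Quiver.Hom.op t) x) ?_
          ext i
          fin_cases i
          rfl
        rw [h1, h0] at h
        exact h.symm }
  naturality X Y f := by
    ext k x
    change SSet.π₀.mk (Y.map _ (f.app k x)) = SSet.π₀.mk (f.app _ (X.map _ x))
    rw [NatTrans.naturality_apply]

/-- The map `γ^{(n+1)} : X ⟶ d^{(n+1)} q^{(n+1)} X`, given levelwise in the last direction. -/
def gammaStep : ∀ n : ℕ, 𝟭 (MSSet.{u} (n + 1)) ⟶ q n ⋙ d n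
  | 0 => gammaZero
  | n + 1 => levelwiseMap (gammaStep n)

/-- The functor `d^{(n)} ⋯ d^{(1)}` sending a set to the discrete (constant) object on it. -/
def discr : ∀ n : ℕ, Type u ⥤ MSSet.{u} n
  | 0 => 𝟭 _
  | n + 1 => discr n ⋙ d n

/-- The functor `q^{(1)} ⋯ q^{(n)}` to sets. On homotopically discrete objects all the categories
involved are groupoids, so that it agrees with `p^{(1)} ⋯ p^{(n)}`. -/
def comps : ∀ n : ℕ, MSSet.{u} n ⥤ Type u
  | 0 => 𝟭 _
  | n + 1 => q n ⋙ comps n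

/-- The discretization map `γ_{(n)} : X ⟶ X^d`, where `X^d = discr (comps X)`. -/
def gamma : ∀ n : ℕ, 𝟭 (MSSet.{u} n) ⟶ comps n ⋙ discr n
  | 0 => 𝟙 _
  | n + 1 =>
    (gammaStep n ≫ Functor.whiskerRight (Functor.whiskerLeft (q n) (gamma n)) (d n) :
      𝟭 (MSSet.{u} (n + 1)) ⟶ q n ⋙ (comps n ⋙ discr n) ⋙ d n)

/-- The discretization map `X ⟶ X^d`. -/
abbrev discMap {n : ℕ} (X : MSSet.{u} n) : X ⟶ (discr n).obj ((comps n).obj X) :=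
  (gamma n).app X

/-- An object is discrete if it is a constant multi-simplicial set. -/
def IsDiscrete {n : ℕ} (X : MSSet.{u} n) : Prop :=
  ∃ S : Type u, Nonempty (X ≅ (discr n).obj S)

/-! ## `n`-equivalences -/

/-- A functor is an equivalence of categories: it is fully faithful and essentially surjective. -/
def IsCatEquiv {X Y : SSet.{u}} (f : X ⟶ Y) : Prop :=
  (∀ x y : lev X 0, Function.Bijective (fun e : SSet.Edge x y => e.map f)) ∧
  ∀ y : lev Y 0, ∃ x : lev X 0, IsoRel Y (f.app (op (SimplexCategory.mk 0)) x) y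

/-- The map `(d_1, d_0) : X_1 ⟶ X_0 × X_0 ⟶ X_0^d × X_0^d`. -/
def endpoints {n : ℕ} (X : MSSet.{u} (n + 1)) :
    lev (simp X) 1 ⟶ (discr n).obj ((comps n).obj (lev (simp X) 0)) ⨯
      (discr n).obj ((comps n).obj (lev (simp X) 0)) :=
  prod.lift (src (simp X) ≫ discMap _) (tgt (simp X) ≫ discMap _)

/-- The point of a discrete object given by an element of its underlying set. -/
def point (n : ℕ) {S : Type u} (a : S) : (discr n).obj PUnit.{u + 1} ⟶ (discr n).obj S :=
  (discr n).map (TypeCat.ofHom fun _ => a)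

/-- For `a, b ∈ X_0^d`, the fibre `X(a,b)` of `X_1 ⟶ X_0^d × X_0^d` at `(a,b)`. -/
def homObj {n : ℕ} (X : MSSet.{u} (n + 1)) (a b : (comps n).obj (lev (simp X) 0)) :
    MSSet.{u} n :=
  pullback (endpoints X) (prod.lift (point n a) (point n b))

/-- The action of `f : X ⟶ Y` on `X_0^d`. -/
abbrev mapObj {n : ℕ} {X Y : MSSet.{u} (n + 1)} (f : X ⟶ Y) (a : (comps n).obj (lev (simp X) 0)) :
    (comps n).obj (lev (simp Y) 0) :=
  (comps n).map ((simpMap f).app (op (SimplexCategory.mk 0))) a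

lemma endpoints_naturality {n : ℕ} {X Y : MSSet.{u} (n + 1)} (f : X ⟶ Y) :
    endpoints X ≫ prod.map
      ((discr n).map ((comps n).map ((simpMap f).app (op (SimplexCategory.mk 0)))))
      ((discr n).map ((comps n).map ((simpMap f).app (op (SimplexCategory.mk 0))))) =
    (simpMap f).app (op (SimplexCategory.mk 1)) ≫ endpoints Y := by
  have h := (gamma n).naturality ((simpMap f).app (op (SimplexCategory.mk 0)))
  change (simpMap f).app (op (SimplexCategory.mk 0)) ≫ _ =
    _ ≫ (discr n).map ((comps n).map ((simpMap f).app (op (SimplexCategory.mk 0)))) at h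
  have h0 := (simpMap f).naturality (SimplexCategory.δ (n := 0) 0).op
  have h1 := (simpMap f).naturality (SimplexCategory.δ (n := 0) 1).op
  have h0' := h0 =≫ discMap (lev (simp Y) 0)
  have h1' := h1 =≫ discMap (lev (simp Y) 0)
  rw [Category.assoc, Category.assoc] at h0' h1'
  erw [h] at h0' h1'
  unfold endpoints
  rw [prod.lift_map, prod.comp_lift, Category.assoc, Category.assoc]
  exact congrArg₂ prod.lift h1' h0'

lemma point_naturality {n : ℕ} {S T : Type u} (g : S ⟶ T) (a b : S) :
    prod.lift (point n a) (point n b) ≫ prod.map ((discr n).map g) ((discr n).map g) =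
      𝟙 _ ≫ prod.lift (point n (g a)) (point n (g b)) := by
  rw [prod.lift_map, Category.id_comp]
  simp only [point, ← Functor.map_comp]
  rfl

/-- The map `f(a,b) : X(a,b) ⟶ Y(fa,fb)`. -/
def homMap {n : ℕ} {X Y : MSSet.{u} (n + 1)} (f : X ⟶ Y)
    (a b : (comps n).obj (lev (simp X) 0)) :
    homObj X a b ⟶ homObj Y (mapObj f a) (mapObj f b) :=
  pullback.map _ _ _ _ ((simpMap f).app (op (SimplexCategory.mk 1))) (𝟙 _)
    (prod.map ((discr n).map ((comps n).map ((simpMap f).app (op (SimplexCategory.mk 0)))))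
      ((discr n).map ((comps n).map ((simpMap f).app (op (SimplexCategory.mk 0))))))
    (endpoints_naturality f) (point_naturality _ a b)

/-- `n`-equivalences. For `n = 1` they are the equivalences of categories; in higher dimension
`f` is an equivalence if all the maps `f(a,b)`, as well as the truncation of `f`, are equivalences
one dimension down. (For `n = 0` they are the bijections.) -/
def IsEquivalence : ∀ (n : ℕ) {X Y : MSSet.{u} n}, (X ⟶ Y) → Prop
  | 0, _, _, f => IsIso f
  | 1, _, _, f => IsCatEquiv f
  | n + 2, X, _, f =>
    (∀ a b : (comps (n + 1)).obj (lev (simp X) 0), IsEquivalence (n + 1) (homMap f a b)) ∧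
      IsEquivalence (n + 1) ((p (n + 1)).map f)

/-! ## The Segal-type models -/

/-- Homotopically discrete `n`-fold categories. For `n = 1` these are the equivalence relations:
categories with at most one arrow between any two objects and in which every arrow can be
reversed. In higher dimension they are the simplicial objects in homotopically discrete
`(n-1)`-fold categories satisfying the Segal condition and whose truncation is a homotopically
discrete `(n-1)`-fold category. (For `n = 0` they are the sets.) -/
def IsHd : ∀ n : ℕ, MSSet.{u} n → Prop
  | 0, _ => True
  | 1, X => IsSegal (simp X) ∧
      ∀ x y : lev (simp X) 0, Subsingleton (SSet.Edge (X := X) x y) ∧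
        (Nonempty (SSet.Edge (X := X) x y) → Nonempty (SSet.Edge (X := X) y x))
  | n + 2, X => (∀ k : ℕ, IsHd (n + 1) (lev (simp X) k)) ∧ IsSegal (simp X) ∧
      IsHd (n + 1) ((p (n + 1)).obj X)

/-- The induced Segal condition: for all `k ≥ 2` the induced Segal map
`X_k ⟶ X_1 ×_{X_0^d} ⋯ ×_{X_0^d} X_1` is an equivalence. -/
def IsInducedSegal {n : ℕ} (X : MSSet.{u} (n + 1)) : Prop :=
  ∀ m : ℕ, IsEquivalence n (segalMap (simp X) (discMap (lev (simp X) 0)) (m + 1))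

/-- Weakly globular `n`-fold categories. For `n = 1` these are the categories. In higher dimension
they are the simplicial objects `X` in weakly globular `(n-1)`-fold categories such that
`X_0` is homotopically discrete, the Segal condition and the induced Segal condition hold, and
the truncation of `X` is (the multinerve of) a weakly globular `(n-1)`-fold category.
(For `n = 0` they are the sets.) -/
def IsWg : ∀ n : ℕ, MSSet.{u} n → Prop
  | 0, _ => True
  | 1, X => IsSegal (simp X)
  | n + 2, X => (∀ k : ℕ, IsWg (n + 1) (lev (simp X) k)) ∧ IsHd (n + 1) (lev (simp X) 0) ∧
      IsSegal (simp X) ∧ IsInducedSegal X ∧ IsWg (n + 1) ((p (n + 1)).obj X)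

/-- Weakly globular Tamsamani `n`-categories. For `n = 1` these are the categories. In higher
dimension they are the simplicial objects `X` in weakly globular Tamsamani `(n-1)`-categories such
that `X_0` is homotopically discrete and the induced Segal condition holds.
(For `n = 0` they are the sets.) -/
def IsTa : ∀ n : ℕ, MSSet.{u} n → Prop
  | 0, _ => True
  | 1, X => IsSegal (simp X)
  | n + 2, X => (∀ k : ℕ, IsTa (n + 1) (lev (simp X) k)) ∧ IsHd (n + 1) (lev (simp X) 0) ∧
      IsInducedSegal X

lemma IsWg.isTa : ∀ (n : ℕ) (X : MSSet.{u} n), IsWg n X → IsTa n X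
  | 0, _, h => h
  | 1, _, h => h
  | n + 2, _, h => ⟨fun k => IsWg.isTa (n + 1) _ (h.1 k), h.2.1, h.2.2.2.1⟩

/-- The category of weakly globular `n`-fold categories. -/
abbrev CatWg (n : ℕ) : Type (u + 1) :=
  ObjectProperty.FullSubcategory (C := MSSet.{u} n) (IsWg n)

/-- The category of weakly globular Tamsamani `n`-categories. -/
abbrev TaWg (n : ℕ) : Type (u + 1) :=
  ObjectProperty.FullSubcategory (C := MSSet.{u} n) (IsTa n)

/-- The inclusion of weakly globular `n`-fold categories in `n`-fold simplicial sets. -/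
abbrev CatWg.incl (n : ℕ) : CatWg.{u} n ⥤ MSSet.{u} n :=
  ObjectProperty.ι (C := MSSet.{u} n) (IsWg n)

/-- The inclusion of weakly globular Tamsamani `n`-categories in `n`-fold simplicial sets. -/
abbrev TaWg.incl (n : ℕ) : TaWg.{u} n ⥤ MSSet.{u} n :=
  ObjectProperty.ι (C := MSSet.{u} n) (IsTa n)

/-- Every weakly globular `n`-fold category is a weakly globular Tamsamani `n`-category. -/
abbrev CatWg.toTa (n : ℕ) : CatWg.{u} n ⥤ TaWg.{u} n :=
  ObjectProperty.ιOfLE (C := MSSet.{u} n) (P := IsWg n) (P' := IsTa n) (IsWg.isTa n)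

/-! ## Functorial choices of sections to the discretization maps -/

/-- A choice of a section `ζ(X_{k0}) : X_{k0}^d ⟶ X_{k0}` to the discretization map
`X_{k0} ⟶ X_{k0}^d`, for every multi-index `k = (k_1, …, k_s)` with `0 ≤ s ≤ n - 2`: a section
for `X_0` (this is `s = 0`), together with such choices for all the `X_{k_1}`. -/
def Sections : ∀ n : ℕ, MSSet.{u} n → Type u
  | 0, _ => PUnit
  | 1, _ => PUnit
  | n + 2, X => SplitEpi (discMap (lev (simp X) 0)) ×
      ∀ k : SimplexCategoryᵒᵖ, Sections (n + 1) ((simp X).obj k)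

/-- A map `f : X ⟶ Y` is compatible with choices of sections for `X` and `Y`: for every multi-index
`k = (k_1, …, k_s)`, `0 ≤ s ≤ n - 2`, the square formed by `f_{k0} : X_{k0} ⟶ Y_{k0}`,
`f_{k0}^d : X_{k0}^d ⟶ Y_{k0}^d` and the sections commutes. -/
def Compatible : ∀ (n : ℕ) {X Y : MSSet.{u} n}, (X ⟶ Y) → Sections n X → Sections n Y → Prop
  | 0, _, _, _, _, _ => True
  | 1, _, _, _, _, _ => True
  | n + 2, _, _, f, σ, τ =>
    (σ.1.section_ ≫ (simpMap f).app (op (SimplexCategory.mk 0)) =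
      (discr (n + 1)).map ((comps (n + 1)).map ((simpMap f).app (op (SimplexCategory.mk 0)))) ≫
        τ.1.section_) ∧
    ∀ k : SimplexCategoryᵒᵖ, Compatible (n + 1) ((simpMap f).app k) (σ.2 k) (τ.2 k)

/-- A choice of sections is natural: for all `s` and every morphism `k ⟶ r` of multi-indices of
length `s`, the square formed by `X_{k0} ⟶ X_{r0}`, `X_{k0}^d ⟶ X_{r0}^d` and the sections
commutes. (It is enough to ask this for the morphisms of multi-indices which are the identity in
all but one direction; here `θ` is the component in the first direction.) -/
def IsNatural : ∀ (n : ℕ) {X : MSSet.{u} n}, Sections n X → Prop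
  | 0, _, _ => True
  | 1, _, _ => True
  | n + 2, X, σ => (∀ k : SimplexCategoryᵒᵖ, IsNatural (n + 1) (σ.2 k)) ∧
      ∀ (k r : SimplexCategoryᵒᵖ) (θ : k ⟶ r),
        Compatible (n + 1) ((simp X).map θ) (σ.2 k) (σ.2 r)

lemma Compatible.id : ∀ (n : ℕ) {X : MSSet.{u} n} (σ : Sections n X), Compatible n (𝟙 X) σ σ
  | 0, _, _ => trivial
  | 1, _, _ => trivial
  | n + 2, X, σ => by
    refine ⟨?_, fun k => Compatible.id (n + 1) (σ.2 k)⟩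
    change σ.1.section_ ≫ 𝟙 _ = (discr (n + 1)).map ((comps (n + 1)).map (𝟙 _)) ≫ _
    rw [Category.comp_id, (comps (n + 1)).map_id, (discr (n + 1)).map_id]
    exact (Category.id_comp _).symm

lemma Compatible.comp : ∀ (n : ℕ) {X Y Z : MSSet.{u} n} {f : X ⟶ Y} {g : Y ⟶ Z}
    {σ : Sections n X} {τ : Sections n Y} {υ : Sections n Z},
    Compatible n f σ τ → Compatible n g τ υ → Compatible n (f ≫ g) σ υ
  | 0, _, _, _, _, _, _, _, _, _, _ => trivial
  | 1, _, _, _, _, _, _, _, _, _, _ => trivial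
  | n + 2, X, Y, Z, f, g, σ, τ, υ, h, h' => by
    refine ⟨?_, fun k => Compatible.comp (n + 1) (h.2 k) (h'.2 k)⟩
    change σ.1.section_ ≫ (simpMap f).app _ ≫ (simpMap g).app _ =
      (discr (n + 1)).map ((comps (n + 1)).map ((simpMap f).app _ ≫ (simpMap g).app _)) ≫ _
    rw [reassoc_of% h.1, h'.1, Functor.map_comp, Functor.map_comp, Category.assoc]

/-- Objects of `FTa_wg^n`: weakly globular Tamsamani `n`-categories with a natural choice of
sections to the discretization maps of the homotopically discrete objects `X_{k0}`. -/
structure FTaWg (n : ℕ) where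
  /-- the underlying weakly globular Tamsamani `n`-category -/
  obj : MSSet.{u} n
  isTa : IsTa n obj
  /-- the sections -/
  sections : Sections n obj
  natural : IsNatural n sections

/-- Morphisms of `FTa_wg^n`: morphisms compatible with the sections. -/
@[ext]
structure FTaWg.Hom {n : ℕ} (X Y : FTaWg.{u} n) where
  /-- the underlying morphism -/
  hom : X.obj ⟶ Y.obj
  compatible : Compatible n hom X.sections Y.sections

instance FTaWg.category (n : ℕ) : Category.{u} (FTaWg.{u} n) where
  Hom X Y := FTaWg.Hom X Y
  id X := ⟨𝟙 X.obj, Compatible.id n X.sections⟩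
  comp f g := ⟨f.hom ≫ g.hom, Compatible.comp n f.compatible g.compatible⟩
  id_comp f := FTaWg.Hom.ext (Category.id_comp f.hom)
  comp_id f := FTaWg.Hom.ext (Category.comp_id f.hom)
  assoc f g h := FTaWg.Hom.ext (Category.assoc f.hom g.hom h.hom)

/-- The functor `FTa_wg^n ⟶ Ta_wg^n` forgetting the sections. -/
def FTaWg.forget (n : ℕ) : FTaWg.{u} n ⥤ TaWg.{u} n where
  obj X := ⟨X.obj, X.isTa⟩
  map f := ObjectProperty.homMk f.hom

/-! ## The functors `V_n`, `F_n` and `G_n` -/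

/-- The functor `q^{(2)} ⋯ q^{(n+1)}`, with values in categories. -/
def qTwo : ∀ n : ℕ, MSSet.{u} (n + 1) ⥤ MSSet.{u} 1
  | 0 => 𝟭 _
  | n + 1 => q (n + 1) ⋙ qTwo n

/-- The functor `d^{(n+1)} ⋯ d^{(2)}`. -/
def dTwo : ∀ n : ℕ, MSSet.{u} 1 ⥤ MSSet.{u} (n + 1)
  | 0 => 𝟭 _
  | n + 1 => dTwo n ⋙ d (n + 1)

/-- The map `X ⟶ d^{(n+1)} ⋯ d^{(2)} q^{(2)} ⋯ q^{(n+1)} X`. -/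
def gammaTwo : ∀ n : ℕ, 𝟭 (MSSet.{u} (n + 1)) ⟶ qTwo n ⋙ dTwo n
  | 0 => 𝟙 _
  | n + 1 =>
    (gammaStep (n + 1) ≫
        Functor.whiskerRight (Functor.whiskerLeft (q (n + 1)) (gammaTwo n)) (d (n + 1)) :
      𝟭 (MSSet.{u} (n + 2)) ⟶ q (n + 1) ⋙ (qTwo n ⋙ dTwo n) ⋙ d (n + 1))

/-- The functor `[k] ↦ [k+1]` on the simplex category adding a new initial vertex. -/
def shift : SimplexCategory ⥤ SimplexCategory where
  obj k := SimplexCategory.mk (k.len + 1)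
  map {k l} θ := SimplexCategory.mkHom
    { toFun := Fin.cases 0 fun i => (θ.toOrderHom i).succ
      monotone' := by
        intro i j h
        induction i using Fin.cases with
        | zero => exact Fin.zero_le _
        | succ i =>
          induction j using Fin.cases with
          | zero => exact absurd h (by simp)
          | succ j =>
            exact Fin.succ_le_succ_iff.mpr (θ.toOrderHom.monotone (Fin.succ_le_succ_iff.mp h)) }
  map_id k := by
    ext i
    induction i using Fin.cases with
    | zero => rfl
    | succ i => rfl
  map_comp θ η := by
    ext i
    induction i using Fin.cases with
    | zero => rfl
    | succ i => rfl

/-- The inclusion `[k] ⟶ [k+1]` avoiding the new vertex. -/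
def shiftIncl : 𝟭 SimplexCategory ⟶ shift where
  app k := SimplexCategory.δ (n := k.len) 0
  naturality k l θ := by
    ext i
    rfl

/-- The décalage `(Dec X)_k = X_{k+1}`, with the map `Dec X ⟶ X` forgetting the extra vertex. If
`X` is the equivalence relation on `A` with quotient `A ⟶ B`, then `Dec X` is the equivalence
relation on `A ×_B A` with quotient the first projection `A ×_B A ⟶ A`, and `Dec X ⟶ X` is
the second projection `A ×_B A ⟶ A` on objects. -/
def dec : Augmented (MSSet.{u} 1) where
  functor := (Functor.whiskeringLeft _ _ (Type u)).obj shift.op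
  map := (Functor.whiskeringLeft _ _ (Type u)).map (NatTrans.op shiftIncl)

/-- The functor `V_n` with its natural map `V_n X ⟶ X`. For `n = 1` it is the décalage. In higher
dimension let `F X = X(f_{X_0})`, where `f_{X_0} : V_{n-1} X_0 ⟶ X_0`; then `V_n X` is the
pullback of `F X ⟶ d^{(n)} ⋯ d^{(2)} q^{(2)} ⋯ q^{(n)} F X` along the map obtained from
`Dec (q^{(2)} ⋯ q^{(n)} F X) ⟶ q^{(2)} ⋯ q^{(n)} F X`. (For `n = 0` it is the identity.) -/
def V : ∀ n : ℕ, Augmented (MSSet.{u} n)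
  | 0 => ⟨𝟭 _, 𝟙 _⟩
  | 1 => dec
  | n + 2 =>
    let F : Augmented (MSSet.{u} (n + 2)) := restrict (V (n + 1))
    let α : F.functor ⟶ F.functor ⋙ qTwo (n + 1) ⋙ dTwo (n + 1) :=
      Functor.whiskerLeft F.functor (gammaTwo (n + 1))
    let β : F.functor ⋙ qTwo (n + 1) ⋙ dec.functor ⋙ dTwo (n + 1) ⟶
        F.functor ⋙ qTwo (n + 1) ⋙ dTwo (n + 1) :=
      Functor.whiskerLeft (F.functor ⋙ qTwo (n + 1)) (Functor.whiskerRight dec.map (dTwo (n + 1)))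
    ⟨pullbackFunctor α β, pullbackFunctorFst α β ≫ F.map⟩

/-- The functor `F_{n+1} X = X(f_{X_0})`, where `f_{X_0} : V_n X_0 ⟶ X_0`. -/
def F (n : ℕ) : MSSet.{u} (n + 1) ⥤ MSSet.{u} (n + 1) :=
  (restrict (V n)).functor

/-- The functor `G_n`: the identity for `n = 1`, and `G_n` is `F_n` followed by levelwise
application of `G_{n-1}`, that is `(G_n X)_k = G_{n-1} ((F_n X)_k)`. In particular `G_2 = F_2`. -/
def G : ∀ n : ℕ, MSSet.{u} n ⥤ MSSet.{u} n
  | 0 => 𝟭 _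
  | 1 => 𝟭 _
  | n + 2 => F (n + 1) ⋙ levelwise (G (n + 1))

end WG
end

/-!
The proof replaces the equivalences and the induced Segal conditions of the definitions by strict
notions which are better behaved under limits.

* `HPB` (hereditary pullback): a pullback square of `n`-fold simplicial sets which stays a pullback
  under the iterated truncations `p`. A pullback over a homotopically discrete object is hereditary
  if one of the two maps is a fibration `Fib`, meaning that it is an isofibration in the last
  direction and that so are its truncations (`HPB.of_fib`); every map to a discrete object is a
  fibration (`Fib.of_isLC`).
* `IsWgp`: the definition of a weakly globular `n`-fold category without the induced Segal
  condition. It amounts to the Segal squares `X_{m+1} = X_m ×_{X_0} X_1` being hereditary pullbacks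
  over a homotopically discrete object. Hereditary pullbacks over homotopically discrete objects
  preserve equivalences (`IsEquivalence.pullback`); as `X_0 ⟶ X_0^d` is an equivalence, comparing
  the Segal squares with the pullbacks over `X_0^d` shows that the induced Segal condition is
  automatic: `isWg_iff`.

With these notions each of the functors involved is easy to control. Restricting an object `X` along
a fibration `X'_0 ⟶ X_0` of homotopically discrete objects which is surjective on components keeps
`X` weakly globular, and `X' ⟶ X` is a fibration and an equivalence (`IsCart.isWgp`, `IsCart.fib`,
`IsCart.isEquivalence`). Hence, by induction, `V_n X ⟶ X` is a fibration which is surjective on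
components for `X` homotopically discrete, and `V_n` preserves hereditary pullbacks
(`isResolving_V`). Restriction along `V` and levelwise application preserve the properties collected
in `IsReplacement`; therefore `G_n` preserves weakly globular objects and hereditary pullbacks, and
`G_n X ⟶ X` is an equivalence (`isReplacement_G`). In particular `G_n` preserves equivalences, by
cancellation, and pullbacks over discrete objects, which are hereditary.

The sections come from the décalage: its degeneracies give a natural map from the discrete object on
the set `X_{0⋯0}` to `V_n X` which is bijective on components (`pointsToV`,
`isIso_comps_pointsToV`). The objects of `G_n X` are `G_{n-1} V_{n-1} X_0` up to isomorphism, so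
applying `G_{n-1}`, which does not change discrete objects, gives a natural map from a discrete
object to `(G_n X)_0` which is bijective on components, that is, a natural section of the
discretization map (`discSplitEpi`, `sectionsG`). Maps into a pullback are compatible with sections
as soon as their two components are, so that the pullbacks are also pullbacks in the category of
objects with sections (`compatible_of_isPullback`).
-/

noncomputable section

namespace WG

/-! ### Pullback squares and internal categories -/

section Internal

variable {C : Type v} [Category.{u} C]

/-- Limits commute with limits: if the rows `X`, `Y`, `Z` of pullback squares are pullbacks and the
three vertical faces over the corners `D`, `A`, `B` are pullbacks, then so is the row `P`. -/
lemma isPullback_cube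
    {DP AP BP CP DX AX BX CX DY AY BY CY DZ AZ BZ CZ : C}
    {fstP : DP ⟶ AP} {sndP : DP ⟶ BP} {fP : AP ⟶ CP} {gP : BP ⟶ CP}
    {fstX : DX ⟶ AX} {sndX : DX ⟶ BX} {fX : AX ⟶ CX} {gX : BX ⟶ CX}
    {fstY : DY ⟶ AY} {sndY : DY ⟶ BY} {fY : AY ⟶ CY} {gY : BY ⟶ CY}
    {fstZ : DZ ⟶ AZ} {sndZ : DZ ⟶ BZ} {fZ : AZ ⟶ CZ} {gZ : BZ ⟶ CZ}
    {dF : DP ⟶ DX} {dS : DP ⟶ DY} {df : DX ⟶ DZ} {dg : DY ⟶ DZ}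
    {aF : AP ⟶ AX} {aS : AP ⟶ AY} {af : AX ⟶ AZ} {ag : AY ⟶ AZ}
    {bF : BP ⟶ BX} {bS : BP ⟶ BY} {bf : BX ⟶ BZ} {bg : BY ⟶ BZ}
    {cF : CP ⟶ CX} {cS : CP ⟶ CY}
    (hX : IsPullback fstX sndX fX gX) (hY : IsPullback fstY sndY fY gY)
    (hZ : IsPullback fstZ sndZ fZ gZ)
    (hD : IsPullback dF dS df dg) (hA : IsPullback aF aS af ag) (hB : IsPullback bF bS bf bg)
    (w : fstP ≫ fP = sndP ≫ gP)
    (w1 : dF ≫ fstX = fstP ≫ aF) (w2 : dF ≫ sndX = sndP ≫ bF)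
    (w3 : dS ≫ fstY = fstP ≫ aS) (w4 : dS ≫ sndY = sndP ≫ bS)
    (w5 : df ≫ fstZ = fstX ≫ af) (w6 : df ≫ sndZ = sndX ≫ bf)
    (w7 : dg ≫ fstZ = fstY ≫ ag) (w8 : dg ≫ sndZ = sndY ≫ bg)
    (w9 : fP ≫ cF = aF ≫ fX) (w10 : gP ≫ cF = bF ≫ gX)
    (w11 : fP ≫ cS = aS ≫ fY) (w12 : gP ≫ cS = bS ≫ gY) :
    IsPullback fstP sndP fP gP := by
  refine IsPullback.mk' w ?_ ?_
  · intro T φ φ' h1 h2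
    apply hD.hom_ext
    · apply hX.hom_ext
      · simp only [Category.assoc, w1, reassoc_of% h1]
      · simp only [Category.assoc, w2, reassoc_of% h2]
    · apply hY.hom_ext
      · simp only [Category.assoc, w3, reassoc_of% h1]
      · simp only [Category.assoc, w4, reassoc_of% h2]
  · intro T a b hab
    have e1 : (a ≫ aF) ≫ fX = (b ≫ bF) ≫ gX := by
      rw [Category.assoc, Category.assoc, ← w9, ← w10, reassoc_of% hab]
    have e2 : (a ≫ aS) ≫ fY = (b ≫ bS) ≫ gY := by
      rw [Category.assoc, Category.assoc, ← w11, ← w12, reassoc_of% hab]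
    have e3 : hX.lift _ _ e1 ≫ df = hY.lift _ _ e2 ≫ dg := by
      apply hZ.hom_ext
      · rw [Category.assoc, Category.assoc, w5, w7, hX.lift_fst_assoc, hY.lift_fst_assoc,
          Category.assoc, Category.assoc, hA.w]
      · rw [Category.assoc, Category.assoc, w6, w8, hX.lift_snd_assoc, hY.lift_snd_assoc,
          Category.assoc, Category.assoc, hB.w]
    refine ⟨hD.lift _ _ e3, ?_, ?_⟩
    · apply hA.hom_ext
      · rw [Category.assoc, ← w1, hD.lift_fst_assoc, hX.lift_fst]
      · rw [Category.assoc, ← w3, hD.lift_snd_assoc, hY.lift_fst]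
    · apply hB.hom_ext
      · rw [Category.assoc, ← w2, hD.lift_fst_assoc, hX.lift_snd]
      · rw [Category.assoc, ← w4, hD.lift_snd_assoc, hY.lift_snd]

section Chain

variable [HasLimits C] {A B : C} (s t : A ⟶ B)

/-- The components of a chain. -/
def chainPi (m : ℕ) (i : Fin (m + 1)) : chain s t m ⟶ A :=
  equalizer.ι _ _ ≫ Pi.π (fun _ : Fin (m + 1) => A) i

lemma chainPi_condition (m : ℕ) (i : Fin m) :
    chainPi s t m i.castSucc ≫ t = chainPi s t m i.succ ≫ s := by
  have h := equalizer.condition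
    (Pi.lift fun i : Fin m => Pi.π (fun _ : Fin (m + 1) => A) i.castSucc ≫ t)
    (Pi.lift fun i : Fin m => Pi.π (fun _ : Fin (m + 1) => A) i.succ ≫ s)
  have h' := h =≫ Pi.π _ i
  simpa [chainPi] using h'

variable {s t} in
lemma chain_hom_ext {m : ℕ} {W : C} {a b : W ⟶ chain s t m}
    (h : ∀ i, a ≫ chainPi s t m i = b ≫ chainPi s t m i) : a = b := by
  apply equalizer.hom_ext
  refine Pi.hom_ext _ _ fun i => ?_
  simpa [chainPi] using h i

variable {s t} in
/-- A family of composable maps gives a map to the chains. -/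
def chainLift {m : ℕ} {W : C} (a : Fin (m + 1) → (W ⟶ A))
    (h : ∀ i : Fin m, a i.castSucc ≫ t = a i.succ ≫ s) : W ⟶ chain s t m :=
  equalizer.lift (Pi.lift a) (by
    refine Pi.hom_ext _ _ fun i => ?_
    simpa using h i)

variable {s t} in
@[simp]
lemma chainLift_pi {m : ℕ} {W : C} (a : Fin (m + 1) → (W ⟶ A))
    (h : ∀ i : Fin m, a i.castSucc ≫ t = a i.succ ≫ s) (i : Fin (m + 1)) :
    chainLift a h ≫ chainPi s t m i = a i := by
  simp [chainLift, chainPi]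

/-- Forgetting the last component of a chain. -/
def chainInit (m : ℕ) : chain s t (m + 1) ⟶ chain s t m :=
  chainLift (fun i => chainPi s t (m + 1) i.castSucc) fun i =>
    chainPi_condition s t (m + 1) i.castSucc

@[simp]
lemma chainInit_pi (m : ℕ) (i : Fin (m + 1)) :
    chainInit s t m ≫ chainPi s t m i = chainPi s t (m + 1) i.castSucc :=
  chainLift_pi _ _ i

/-- A chain is obtained from a shorter one by adjoining one more arrow. -/
lemma isPullback_chain (m : ℕ) :
    IsPullback (chainInit s t m) (chainPi s t (m + 1) (Fin.last (m + 1)))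
      (chainPi s t m (Fin.last m) ≫ t) s := by
  refine IsPullback.mk' ?_ ?_ ?_
  · rw [reassoc_of% chainInit_pi]
    exact chainPi_condition s t (m + 1) (Fin.last m)
  · intro T φ φ' h1 h2
    refine chain_hom_ext fun i => ?_
    induction i using Fin.lastCases with
    | last => exact h2
    | cast i =>
      have := h1 =≫ chainPi s t m i
      simpa using this
  · intro T a b hab
    refine ⟨chainLift (Fin.lastCases b fun i => a ≫ chainPi s t m i) ?_, ?_, ?_⟩
    · intro i
      induction i using Fin.lastCases with
      | last =>
        rw [Fin.lastCases_castSucc, Fin.succ_last, Fin.lastCases_last, Category.assoc]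
        exact hab
      | cast i =>
        rw [Fin.lastCases_castSucc, Fin.succ_castSucc, Fin.lastCases_castSucc, Category.assoc,
          Category.assoc, chainPi_condition]
    · refine chain_hom_ext fun i => ?_
      rw [Category.assoc, chainInit_pi, chainLift_pi, Fin.lastCases_castSucc]
    · rw [chainLift_pi, Fin.lastCases_last]

lemma isIso_chainPi_zero : IsIso (chainPi s t 0 0) :=
  ⟨chainLift (fun _ => 𝟙 A) fun i => i.elim0,
    chain_hom_ext fun i => by
      obtain rfl : i = 0 := Fin.fin_one_eq_zero i
      rw [Category.assoc, chainLift_pi, Category.comp_id, Category.id_comp],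
    chainLift_pi _ _ 0⟩

end Chain

/-- The last vertex `X_m ⟶ X_0`. -/
abbrev lastVertex (X : SimplicialObject C) (m : ℕ) : lev X m ⟶ lev X 0 :=
  X.map (SimplexCategory.const (SimplexCategory.mk 0) (SimplexCategory.mk m) (Fin.last m)).op

/-- The face `X_{m+1} ⟶ X_m` forgetting the last vertex. -/
abbrev initFace (X : SimplicialObject C) (m : ℕ) : lev X (m + 1) ⟶ lev X m :=
  X.map (SimplexCategory.δ (Fin.last (m + 1))).op

/-- The last edge `X_{m+1} ⟶ X_1`. -/
abbrev lastEdge (X : SimplicialObject C) (m : ℕ) : lev X (m + 1) ⟶ lev X 1 :=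
  nu X (Fin.last m)

lemma initFace_nu (X : SimplicialObject C) (m : ℕ) (i : Fin m) :
    initFace X m ≫ nu X i = nu X i.castSucc := by
  simp only [initFace, nu, ← X.map_comp, ← op_comp]
  congr 2
  ext j
  fin_cases j
  · change ((Fin.last (m + 1)).succAbove i.castSucc).val = i.castSucc.castSucc.val
    simp
  · change ((Fin.last (m + 1)).succAbove i.succ).val = i.castSucc.succ.val
    simp

lemma nu_last_tgt (X : SimplicialObject C) (m : ℕ) :
    nu X (Fin.last m) ≫ tgt X = lastVertex X (m + 1) := by
  simp only [nu, tgt, lastVertex, SimplicialObject.δ_def, ← X.map_comp, ← op_comp]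
  congr 2
  ext j
  fin_cases j
  rfl

lemma segal_square_comm (X : SimplicialObject C) (m : ℕ) :
    initFace X m ≫ lastVertex X m = lastEdge X m ≫ src X := by
  simp only [nu, src, lastVertex, initFace, lastEdge, SimplicialObject.δ_def, ← X.map_comp,
    ← op_comp]
  congr 2
  ext j
  fin_cases j
  change ((Fin.last (m + 1)).succAbove (Fin.last m)).val = (Fin.last m).castSucc.val
  simp

lemma segalMap_pi [HasLimits C] (X : SimplicialObject C) {B : C} (g : lev X 0 ⟶ B) (m : ℕ)
    (i : Fin (m + 1)) : segalMap X g m ≫ chainPi _ _ m i = nu X i := by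
  simp [segalMap, chainPi]

/-- The Segal square: `X_{m+1} = X_m ×_{X_0} X_1`. -/
def SegalSquare (X : SimplicialObject C) (m : ℕ) : Prop :=
  IsPullback (initFace X m) (lastEdge X m) (lastVertex X m) (src X)

lemma segalMap_init [HasLimits C] (X : SimplicialObject C) {B : C} (g : lev X 0 ⟶ B) (m : ℕ) :
    segalMap X g (m + 1) ≫ chainInit _ _ m = initFace X (m + 1) ≫ segalMap X g m := by
  refine chain_hom_ext fun i => ?_
  rw [Category.assoc, chainInit_pi, segalMap_pi, Category.assoc, segalMap_pi, initFace_nu]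

lemma isIso_segalMap_zero [HasLimits C] (X : SimplicialObject C) {B : C} (g : lev X 0 ⟶ B) :
    IsIso (segalMap X g 0) := by
  have := isIso_chainPi_zero (src X ≫ g) (tgt X ≫ g)
  have h : segalMap X g 0 ≫ chainPi _ _ 0 0 = 𝟙 (lev X 1) := by
    rw [segalMap_pi]
    have : SimplexCategory.mkOfSucc (0 : Fin 1) = 𝟙 _ := by
      ext j
      fin_cases j <;> rfl
    change X.map (SimplexCategory.mkOfSucc (0 : Fin 1)).op = _
    rw [this]
    exact X.map_id _
  have h2 : IsIso (segalMap X g 0 ≫ chainPi _ _ 0 0) := by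
    rw [h]
    infer_instance
  exact IsIso.of_isIso_comp_right _ (chainPi _ _ 0 0)

lemma segalSquare_zero (X : SimplicialObject C) : SegalSquare X 0 := by
  have h1 : lastEdge X 0 = 𝟙 _ := by
    have : SimplexCategory.mkOfSucc (0 : Fin 1) = 𝟙 _ := by
      ext j
      fin_cases j <;> rfl
    change X.map (SimplexCategory.mkOfSucc (0 : Fin 1)).op = _
    rw [this]
    exact X.map_id _
  have h2 : lastVertex X 0 = 𝟙 _ := by
    have : SimplexCategory.const (SimplexCategory.mk 0) (SimplexCategory.mk 0)
        (Fin.last 0) = 𝟙 _ := by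
      ext j
      fin_cases j
      rfl
    change X.map (SimplexCategory.const _ _ _).op = _
    rw [this]
    exact X.map_id _
  have i1 : IsIso (lastEdge X 0) := by rw [h1]; infer_instance
  have i2 : IsIso (lastVertex X 0) := by rw [h2]; infer_instance
  exact IsPullback.of_vert_isIso ⟨segal_square_comm X 0⟩

lemma segalMap_lastVertex [HasLimits C] (X : SimplicialObject C) (m : ℕ) :
    segalMap X (𝟙 (lev X 0)) m ≫ chainPi _ _ m (Fin.last m) ≫ tgt X ≫ 𝟙 _ =
      lastVertex X (m + 1) := by
  rw [reassoc_of% segalMap_pi, Category.comp_id, nu_last_tgt]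

/-- The Segal maps can be tested one edge at a time, which turns the Segal condition into a family
of pullback squares. -/
lemma isSegal_iff [HasLimits C] (X : SimplicialObject C) :
    IsSegal X ↔ ∀ m, SegalSquare X m := by
  have key (m : ℕ) (hm : IsIso (segalMap X (𝟙 (lev X 0)) m)) :
      SegalSquare X (m + 1) ↔ IsIso (segalMap X (𝟙 (lev X 0)) (m + 1)) := by
    have hc := isPullback_chain (src X ≫ 𝟙 (lev X 0)) (tgt X ≫ 𝟙 (lev X 0)) m
    constructor
    · intro h
      have h' : IsPullback (segalMap X (𝟙 (lev X 0)) (m + 1) ≫ chainInit _ _ m)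
          (segalMap X (𝟙 (lev X 0)) (m + 1) ≫ chainPi _ _ _ (Fin.last (m + 1)))
          (chainPi (src X ≫ 𝟙 (lev X 0)) (tgt X ≫ 𝟙 (lev X 0)) m (Fin.last m) ≫
            tgt X ≫ 𝟙 (lev X 0)) (src X ≫ 𝟙 (lev X 0)) := by
        refine h.of_iso (Iso.refl _) (asIso (segalMap X (𝟙 (lev X 0)) m)) (Iso.refl _)
          (Iso.refl _) ?_ ?_ ?_ ?_
        · simp [segalMap_init]
        · simp [segalMap_pi]
        · exact (Category.comp_id _).trans (segalMap_lastVertex X m).symm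
        · simp
      have e : segalMap X (𝟙 (lev X 0)) (m + 1) = (h'.isoIsPullback _ _ hc).hom := by
        apply hc.hom_ext
        · rw [IsPullback.isoIsPullback_hom_fst]
        · rw [IsPullback.isoIsPullback_hom_snd]
      rw [e]
      infer_instance
    · intro h
      refine hc.of_iso' (asIso (segalMap X (𝟙 (lev X 0)) (m + 1)))
        (asIso (segalMap X (𝟙 (lev X 0)) m)) (Iso.refl _) (Iso.refl _) ?_ ?_ ?_ ?_
      · rw [asIso_hom, asIso_hom, segalMap_init]
      · simp [segalMap_pi]
      · exact (segalMap_lastVertex X m).trans (Category.comp_id _).symm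
      · simp
  constructor
  · intro h m
    match m with
    | 0 => exact segalSquare_zero X
    | 1 => exact (key 0 (isIso_segalMap_zero X _)).2 (h 0)
    | m + 2 => exact (key (m + 1) (h m)).2 (h (m + 1))
  · intro h m
    have : ∀ m, IsIso (segalMap X (𝟙 (lev X 0)) m) := by
      intro m
      induction m with
      | zero => exact isIso_segalMap_zero X _
      | succ m ih => exact (key m ih).1 (h (m + 1))
    exact this (m + 1)

/-- Internal categories are closed under pullbacks. -/
lemma SegalSquare.pullback [HasLimits C] {D A B E : SimplicialObject C} {fst : D ⟶ A}
    {snd : D ⟶ B} {f : A ⟶ E} {g : B ⟶ E} (h : IsPullback fst snd f g) {m : ℕ}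
    (hA : SegalSquare A m) (hB : SegalSquare B m) (hE : SegalSquare E m) : SegalSquare D m :=
  isPullback_cube hA hB hE (h.app _) (h.app _) (h.app _) (segal_square_comm D m)
    (fst.naturality _).symm (fst.naturality _).symm (snd.naturality _).symm
    (snd.naturality _).symm (f.naturality _).symm (f.naturality _).symm (g.naturality _).symm
    (g.naturality _).symm (fst.naturality _) (fst.naturality _) (snd.naturality _)
    (snd.naturality _)

lemma SegalSquare.of_iso {X Y : SimplicialObject C} (e : X ≅ Y) {m : ℕ} (h : SegalSquare X m) :
    SegalSquare Y m :=
  IsPullback.of_iso h (e.app _) (e.app _) (e.app _) (e.app _) (e.hom.naturality _)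
    (e.hom.naturality _) (e.hom.naturality _) (e.hom.naturality _)

lemma IsSegal.pullback [HasLimits C] {D A B E : SimplicialObject C} {fst : D ⟶ A}
    {snd : D ⟶ B} {f : A ⟶ E} {g : B ⟶ E} (h : IsPullback fst snd f g)
    (hA : IsSegal A) (hB : IsSegal B) (hE : IsSegal E) : IsSegal D := by
  rw [isSegal_iff] at *
  exact fun m => SegalSquare.pullback h (hA m) (hB m) (hE m)

lemma IsSegal.of_iso [HasLimits C] {X Y : SimplicialObject C} (e : X ≅ Y) (h : IsSegal X) :
    IsSegal Y := by
  rw [isSegal_iff] at *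
  exact fun m => SegalSquare.of_iso e (h m)

/-- The coordinates of `B × ⋯ × B`. -/
def coord [HasLimits C] (B : C) (k : SimplexCategoryᵒᵖ) (i : Fin (k.unop.len + 1)) :
    (codisc.obj B).obj k ⟶ B :=
  Pi.π (fun _ : Fin (k.unop.len + 1) => B) i

lemma codisc_hom_ext [HasLimits C] {B : C} {k : SimplexCategoryᵒᵖ} {W : C}
    {a b : W ⟶ (codisc.obj B).obj k} (h : ∀ i, a ≫ coord B k i = b ≫ coord B k i) : a = b :=
  Pi.hom_ext _ _ h

/-- Maps to `B × ⋯ × B` are given by their coordinates. -/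
def codiscLift [HasLimits C] {B : C} (k : SimplexCategoryᵒᵖ) {W : C}
    (a : Fin (k.unop.len + 1) → (W ⟶ B)) : W ⟶ (codisc.obj B).obj k :=
  Pi.lift a

@[simp]
lemma codiscLift_coord [HasLimits C] {B : C} (k : SimplexCategoryᵒᵖ) {W : C}
    (a : Fin (k.unop.len + 1) → (W ⟶ B)) (i : Fin (k.unop.len + 1)) :
    codiscLift k a ≫ coord B k i = a i :=
  Pi.lift_π _ _

@[simp]
lemma codisc_map_coord [HasLimits C] (B : C) {k l : SimplexCategoryᵒᵖ} (θ : k ⟶ l)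
    (i : Fin (l.unop.len + 1)) :
    (codisc.obj B).map θ ≫ coord B l i = coord B k (θ.unop.toOrderHom i) :=
  Pi.lift_π _ _

@[simp]
lemma codisc_map_app_coord [HasLimits C] {B B' : C} (f : B ⟶ B') (k : SimplexCategoryᵒᵖ)
    (i : Fin (k.unop.len + 1)) :
    (codisc.map f).app k ≫ coord B' k i = coord B k i ≫ f :=
  Pi.lift_π _ _

/-- The map taking all the vertices, with its type unfolded. -/
abbrev verts [HasLimits C] (X : SimplicialObject C) : X ⟶ codisc.obj (lev X 0) := vertices.app X

@[simp]
lemma verts_app_coord [HasLimits C] (X : SimplicialObject C) (k : SimplexCategoryᵒᵖ)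
    (i : Fin (k.unop.len + 1)) :
    (verts X).app k ≫ coord (lev X 0) k i =
      X.map (SimplexCategory.const (SimplexCategory.mk 0) k.unop i).op :=
  Pi.lift_π _ _

lemma verts_zero_coord [HasLimits C] (X : SimplicialObject C) :
    (verts X).app (op (SimplexCategory.mk 0)) ≫
      coord (lev X 0) (op (SimplexCategory.mk 0)) (0 : Fin 1) = 𝟙 (lev X 0) := by
  have : SimplexCategory.const (SimplexCategory.mk 0) (SimplexCategory.mk 0) (0 : Fin 1) = 𝟙 _ := by
    ext j
    fin_cases j
    rfl
  rw [verts_app_coord]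
  change X.map (SimplexCategory.const _ _ _).op = _
  rw [this]
  exact X.map_id _

lemma isSegal_codisc [HasLimits C] (B : C) : IsSegal (codisc.obj B) := by
  rw [isSegal_iff]
  intro m
  have e (i : Fin (m + 1)) :
      (SimplexCategory.δ (Fin.last (m + 1))).toOrderHom i = i.castSucc := by
    change (Fin.last (m + 1)).succAbove i = _
    simp
  have π1 (i : Fin (m + 1)) : initFace (codisc.obj B) m ≫ coord B (op (SimplexCategory.mk m)) i =
      coord B (op (SimplexCategory.mk (m + 1))) i.castSucc := by
    rw [← e i]
    exact codisc_map_coord _ _ _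
  have π2 (i : Fin 2) : lastEdge (codisc.obj B) m ≫ coord B (op (SimplexCategory.mk 1)) i =
      coord B (op (SimplexCategory.mk (m + 1)))
        ((SimplexCategory.mkOfSucc (Fin.last m)).toOrderHom i) := codisc_map_coord _ _ _
  have π3 : lastVertex (codisc.obj B) m ≫ coord B (op (SimplexCategory.mk 0)) (0 : Fin 1) =
      coord B (op (SimplexCategory.mk m)) (Fin.last m) := codisc_map_coord _ _ _
  have π4 : src (codisc.obj B) ≫ coord B (op (SimplexCategory.mk 0)) (0 : Fin 1) =
      coord B (op (SimplexCategory.mk 1)) (0 : Fin 2) := codisc_map_coord _ _ _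
  refine IsPullback.mk' (segal_square_comm _ m) ?_ ?_
  · intro T φ φ' h1 h2
    refine codisc_hom_ext fun i => ?_
    induction i using Fin.lastCases with
    | last =>
      have := h2 =≫ coord B (op (SimplexCategory.mk 1)) (1 : Fin 2)
      rw [Category.assoc, Category.assoc, π2] at this
      exact this
    | cast i =>
      have := h1 =≫ coord B (op (SimplexCategory.mk m)) i
      rw [Category.assoc, Category.assoc, π1] at this
      exact this
  · intro T a b hab
    let c : Fin (m + 1 + 1) → (T ⟶ B) := Fin.lastCases
        (b ≫ coord B (op (SimplexCategory.mk 1)) (1 : Fin 2))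
        (fun i => a ≫ coord B (op (SimplexCategory.mk m)) i)
    have c1 : c (Fin.last (m + 1)) = b ≫ coord B (op (SimplexCategory.mk 1)) (1 : Fin 2) :=
      Fin.lastCases_last
    have c2 (i : Fin (m + 1)) : c i.castSucc = a ≫ coord B (op (SimplexCategory.mk m)) i :=
      Fin.lastCases_castSucc i
    have hab' := hab =≫ coord B (op (SimplexCategory.mk 0)) (0 : Fin 1)
    refine ⟨codiscLift (op (SimplexCategory.mk (m + 1))) c, ?_, ?_⟩
    · refine codisc_hom_ext fun i => ?_
      rw [Category.assoc, π1, codiscLift_coord, c2]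
    · refine codisc_hom_ext fun i => ?_
      rw [Category.assoc, π2, codiscLift_coord]
      fin_cases i
      · refine (c2 (Fin.last m)).trans ?_
        rw [Category.assoc, Category.assoc, π3, π4] at hab'
        exact hab'
      · exact c1

/-- A map `π : X' ⟶ X` is fully faithful if `X'` is the restriction of `X` along the map of
objects `X'_0 ⟶ X_0`. -/
def IsCart [HasLimits C] {X' X : SimplicialObject C} (π : X' ⟶ X) : Prop :=
  IsPullback π (verts X') (verts X) (codisc.map (π.app (op (SimplexCategory.mk 0))))

lemma IsCart.isSegal [HasLimits C] {X' X : SimplicialObject C} {π : X' ⟶ X} (h : IsCart π)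
    (hX : IsSegal X) : IsSegal X' :=
  IsSegal.pullback h hX (isSegal_codisc _) (isSegal_codisc _)

lemma isIso_coord_zero [HasLimits C] (B : C) :
    IsIso (coord B (op (SimplexCategory.mk 0)) (0 : Fin 1)) :=
  ⟨codiscLift (op (SimplexCategory.mk 0)) fun _ => 𝟙 B, codisc_hom_ext fun i => by
    obtain rfl : i = (0 : Fin 1) := Fin.fin_one_eq_zero i
    rw [Category.assoc, codiscLift_coord, Category.comp_id, Category.id_comp],
    codiscLift_coord _ _ _⟩

lemma isIso_verts_zero [HasLimits C] (X : SimplicialObject C) :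
    IsIso ((verts X).app (op (SimplexCategory.mk 0))) := by
  have := isIso_coord_zero (lev X 0)
  have h : IsIso ((verts X).app (op (SimplexCategory.mk 0)) ≫
      coord (lev X 0) (op (SimplexCategory.mk 0)) (0 : Fin 1)) := by
    rw [verts_zero_coord]
    infer_instance
  exact IsIso.of_isIso_comp_right _ (coord (lev X 0) (op (SimplexCategory.mk 0)) (0 : Fin 1))

section Restrict

variable [HasLimits C] (V : Augmented C) (X : SimplicialObject C)

/-- The projection `X(f_0) ⟶ X`. -/
abbrev restrictFst : (restrict V).functor.obj X ⟶ X := (restrict V).map.app X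

/-- The projection `X(f_0)_k ⟶ Y_0 × ⋯ × Y_0`. -/
def restrictSnd : (restrict V).functor.obj X ⟶ codisc.obj (V.functor.obj (lev X 0)) :=
  pullback.snd (vertices.app X) (codisc.map (V.map.app (lev X 0)))

/-- The map `f_0 : Y_0 ⟶ X_0`. -/
abbrev augZero : V.functor.obj (lev X 0) ⟶ lev X 0 := V.map.app (lev X 0)

lemma isPullback_restrict :
    IsPullback (restrictFst V X) (restrictSnd V X) (verts X) (codisc.map (augZero V X)) :=
  IsPullback.of_hasPullback _ _

/-- The object of objects of `X(f_0)`, for `f_0 : Y_0 ⟶ X_0`, is `Y_0`. -/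
def restrictZero : lev ((restrict V).functor.obj X) 0 ⟶ V.functor.obj (lev X 0) :=
  (restrictSnd V X).app (op (SimplexCategory.mk 0)) ≫
    coord (V.functor.obj (lev X 0)) (op (SimplexCategory.mk 0)) (0 : Fin 1)

instance isIso_restrictZero : IsIso (restrictZero V X) := by
  have h := (isPullback_restrict V X).app (op (SimplexCategory.mk 0))
  have := h.isIso_snd_of_isIso (isIso_verts_zero X)
  have := isIso_coord_zero (V.functor.obj (lev X 0))
  exact IsIso.comp_isIso

lemma restrictZero_map :
    restrictZero V X ≫ augZero V X = (restrictFst V X).app (op (SimplexCategory.mk 0)) := by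
  have h := (isPullback_restrict V X).app (op (SimplexCategory.mk 0))
  have hw := h.w =≫ coord (lev X 0) (op (SimplexCategory.mk 0)) (0 : Fin 1)
  rw [Category.assoc, Category.assoc, codisc_map_app_coord, verts_zero_coord] at hw
  rw [restrictZero, Category.assoc, ← hw]
  exact Category.comp_id _

lemma restrictSnd_eq : verts _ ≫ codisc.map (restrictZero V X) = restrictSnd V X := by
  ext k
  refine codisc_hom_ext fun i => ?_
  rw [NatTrans.comp_app, Category.assoc, codisc_map_app_coord, reassoc_of% verts_app_coord,
    restrictZero,
    NatTrans.naturality_assoc, codisc_map_coord]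
  rfl

lemma restrict_isCart : IsCart (restrictFst V X) := by
  let e : lev ((restrict V).functor.obj X) 0 ≅ V.functor.obj (lev X 0) :=
    asIso (restrictZero V X)
  refine (isPullback_restrict V X).of_iso' (Iso.refl _) (Iso.refl _) (codisc.mapIso e)
    (Iso.refl _) ?_ ?_ ?_ ?_
  · simp
  · rw [Functor.mapIso_hom, asIso_hom, restrictSnd_eq, Iso.refl_hom, Category.id_comp]
  · simp
  · rw [Functor.mapIso_hom, asIso_hom, ← codisc.map_comp, restrictZero_map, Iso.refl_hom,
      Category.comp_id]

lemma restrictSnd_naturality {X Y : SimplicialObject C} (f : X ⟶ Y) :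
    (restrict V).functor.map f ≫ restrictSnd V Y =
      restrictSnd V X ≫ codisc.map (V.functor.map (f.app (op (SimplexCategory.mk 0)))) :=
  pullback.lift_snd _ _ _

lemma restrictZero_naturality {X Y : SimplicialObject C} (f : X ⟶ Y) :
    ((restrict V).functor.map f).app (op (SimplexCategory.mk 0)) ≫ restrictZero V Y =
      restrictZero V X ≫ V.functor.map (f.app (op (SimplexCategory.mk 0))) := by
  have h := NatTrans.congr_app (restrictSnd_naturality V f) (op (SimplexCategory.mk 0))
  rw [NatTrans.comp_app, NatTrans.comp_app] at h
  rw [restrictZero, reassoc_of% h, codisc_map_app_coord, restrictZero, Category.assoc]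

end Restrict

end Internal

/-! ### Categories as simplicial sets -/

section Segal

variable {X Y Z : SSet.{u}}

/-- The action of a simplicial map on vertices. -/
abbrev onVert (f : X ⟶ Y) (x : lev X 0) : lev Y 0 := f.app (op (SimplexCategory.mk 0)) x

lemma lastEdge_one : lastEdge X 1 = X.δ (0 : Fin 3) := by
  have : SimplexCategory.mkOfSucc (Fin.last 1) = SimplexCategory.δ (0 : Fin 3) := by
    ext j
    fin_cases j <;> rfl
  change X.map (SimplexCategory.mkOfSucc (Fin.last 1)).op = _
  rw [this]
  rfl

lemma δ_δ_zero : X.δ (0 : Fin 4) ≫ X.δ (0 : Fin 3) = lastEdge X 2 := by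
  have : SimplexCategory.mkOfSucc (Fin.last 2) =
      SimplexCategory.δ (0 : Fin 3) ≫ SimplexCategory.δ (0 : Fin 4) := by
    ext j
    fin_cases j <;> rfl
  change X.map (SimplexCategory.δ (0 : Fin 4)).op ≫ X.map (SimplexCategory.δ (0 : Fin 3)).op =
    X.map (SimplexCategory.mkOfSucc (Fin.last 2)).op
  rw [this, op_comp, X.map_comp]

lemma lastVertex_one : lastVertex X 1 = tgt X := by
  have : SimplexCategory.const (SimplexCategory.mk 0) (SimplexCategory.mk 1) (Fin.last 1) =
      SimplexCategory.δ (0 : Fin 2) := by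
    ext j
    fin_cases j
    rfl
  change X.map (SimplexCategory.const _ _ _).op = _
  rw [this]
  rfl

lemma IsSegal.ext_two (hX : IsSegal X) {σ τ : lev X 2} (h2 : X.δ (2 : Fin 3) σ = X.δ (2 : Fin 3) τ)
    (h0 : X.δ (0 : Fin 3) σ = X.δ (0 : Fin 3) τ) : σ = τ := by
  have h := (isSegal_iff X).1 hX 1
  have := ((Types.isPullback_iff _ _ _ _).1 h).2.1 σ τ
  rw [lastEdge_one] at this
  exact this ⟨h2, h0⟩

lemma IsSegal.exists_two (hX : IsSegal X) {a b : lev X 1} (h : tgt X a = src X b) :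
    ∃ σ : lev X 2, X.δ (2 : Fin 3) σ = a ∧ X.δ (0 : Fin 3) σ = b := by
  have hs := (isSegal_iff X).1 hX 1
  have := ((Types.isPullback_iff _ _ _ _).1 hs).2.2 a b
  rw [lastEdge_one, lastVertex_one] at this
  exact this h

lemma IsSegal.exists_three (hX : IsSegal X) {σ : lev X 2} {b : lev X 1}
    (h : lastVertex X 2 σ = src X b) :
    ∃ ω : lev X 3, X.δ (3 : Fin 4) ω = σ ∧ lastEdge X 2 ω = b :=
  ((Types.isPullback_iff _ _ _ _).1 ((isSegal_iff X).1 hX 2)).2.2 σ b h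

open SSet.Edge in
lemma IsSegal.exists_comp (hX : IsSegal X) {x y z : lev X 0} (e : SSet.Edge x y)
    (f : SSet.Edge y z) : ∃ g : SSet.Edge x z, Nonempty (CompStruct e f g) := by
  obtain ⟨σ, h2, h0⟩ := hX.exists_two (a := e.edge) (b := f.edge)
    (e.tgt_eq.trans f.src_eq.symm)
  have i1 : X.δ (1 : Fin 2) (X.δ (1 : Fin 3) σ) = x := by
    have := ConcreteCategory.congr_hom (X.δ_comp_δ (n := 0) (i := 1) (j := 1) le_rfl) σ
    rw [← e.src_eq, ← h2]
    exact this.symm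
  have i0 : X.δ (0 : Fin 2) (X.δ (1 : Fin 3) σ) = z := by
    have := ConcreteCategory.congr_hom (X.δ_comp_δ (n := 0) (i := 0) (j := 0) le_rfl) σ
    rw [← f.tgt_eq, ← h0]
    exact this
  exact ⟨SSet.Edge.mk (X.δ (1 : Fin 3) σ) i1 i0, ⟨CompStruct.mk σ h2 h0 rfl⟩⟩

lemma IsSegal.comp_unique (hX : IsSegal X) {x y z : lev X 0} {e : SSet.Edge x y}
    {f : SSet.Edge y z} {g g' : SSet.Edge x z} (c : e.CompStruct f g) (c' : e.CompStruct f g') :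
    g = g' := by
  have : c.simplex = c'.simplex :=
    hX.ext_two (c.d₂.trans c'.d₂.symm) (c.d₀.trans c'.d₀.symm)
  apply SSet.Edge.ext
  rw [← c.d₁, ← c'.d₁, this]

lemma IsSegal.assoc (hX : IsSegal X) {x y z w : lev X 0} {e : SSet.Edge x y}
    {f : SSet.Edge y z} {g : SSet.Edge z w} {ef : SSet.Edge x z} {fg : SSet.Edge y w}
    {efg : SSet.Edge x w}
    (c : e.CompStruct f ef) (c' : f.CompStruct g fg) (c'' : ef.CompStruct g efg) :
    Nonempty (e.CompStruct fg efg) := by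
  have hv : lastVertex X 2 c.simplex = src X g.edge := by
    have h1 : lastVertex X 2 = X.δ (0 : Fin 3) ≫ tgt X := by
      rw [← lastEdge_one, nu_last_tgt]
    rw [h1]
    refine (congrArg (tgt X) c.d₀).trans ?_
    exact f.tgt_eq.trans g.src_eq.symm
  obtain ⟨ω, h3, hl⟩ := hX.exists_three hv
  rw [← δ_δ_zero] at hl
  have id1 (i j : Fin 3) (H : i ≤ j) :
      X.δ i (X.δ j.succ ω) = X.δ j (X.δ (Fin.castSucc i) ω) :=
    ConcreteCategory.congr_hom (X.δ_comp_δ (n := 1) H) ω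
  have e0 : X.δ (0 : Fin 4) ω = c'.simplex := by
    apply hX.ext_two
    · refine (id1 0 2 (by decide)).symm.trans ?_
      exact (congrArg (X.δ (0 : Fin 3)) h3).trans (c.d₀.trans c'.d₂.symm)
    · exact hl.trans c'.d₀.symm
  have e1 : X.δ (1 : Fin 4) ω = c''.simplex := by
    apply hX.ext_two
    · refine (id1 1 2 (by decide)).symm.trans ?_
      exact (congrArg (X.δ (1 : Fin 3)) h3).trans (c.d₁.trans c''.d₂.symm)
    · refine (id1 0 0 le_rfl).trans ?_
      exact hl.trans c''.d₀.symm
  refine ⟨SSet.Edge.CompStruct.mk (X.δ (2 : Fin 4) ω) ?_ ?_ ?_⟩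
  · refine (id1 2 2 le_rfl).symm.trans ?_
    exact (congrArg (X.δ (2 : Fin 3)) h3).trans c.d₂
  · refine (id1 0 1 (by decide)).trans ?_
    exact (congrArg (X.δ (1 : Fin 3)) e0).trans c'.d₁
  · refine (id1 1 1 le_rfl).trans ?_
    exact (congrArg (X.δ (1 : Fin 3)) e1).trans c''.d₁

/-- The objects of the category whose nerve is `X`. -/
def Cell (_ : IsSegal X) : Type u := lev X 0

/-- A simplicial set satisfying the Segal condition is a category: its arrows are the edges and
composites are given by the `2`-simplices. -/
instance Cell.category (hX : IsSegal X) : Category.{u} (Cell hX) where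
  Hom x y := SSet.Edge (X := X) x y
  id x := SSet.Edge.id (X := X) x
  comp e f := (hX.exists_comp e f).choose
  id_comp e := hX.comp_unique (hX.exists_comp _ e).choose_spec.some (SSet.Edge.CompStruct.idComp e)
  comp_id e := hX.comp_unique (hX.exists_comp e _).choose_spec.some (SSet.Edge.CompStruct.compId e)
  assoc e f g := hX.comp_unique (hX.assoc (hX.exists_comp e f).choose_spec.some
    (hX.exists_comp f g).choose_spec.some (hX.exists_comp _ g).choose_spec.some).some
    (hX.exists_comp e _).choose_spec.some

/-- A vertex as an object. -/
def toCell (hX : IsSegal X) (x : lev X 0) : Cell hX := x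

/-- An edge as an arrow. -/
def toHom (hX : IsSegal X) {x y : lev X 0} (e : SSet.Edge x y) :
    toCell hX x ⟶ toCell hX y := e

/-- An arrow as an edge. -/
def ofHom (hX : IsSegal X) {x y : lev X 0} (e : toCell hX x ⟶ toCell hX y) : SSet.Edge x y := e

lemma comp_eq_iff (hX : IsSegal X) {x y z : lev X 0} {e : SSet.Edge x y}
    {f : SSet.Edge y z} {g : SSet.Edge x z} :
    toHom hX e ≫ toHom hX f = toHom hX g ↔ Nonempty (e.CompStruct f g) := by
  constructor
  · intro h
    have := (hX.exists_comp e f).choose_spec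
    rw [show (hX.exists_comp e f).choose = g from h] at this
    exact this
  · rintro ⟨c⟩
    exact hX.comp_unique (hX.exists_comp e f).choose_spec.some c

lemma isoRel_iff (hX : IsSegal X) (x y : lev X 0) :
    IsoRel X x y ↔ Nonempty (toCell hX x ≅ toCell hX y) := by
  constructor
  · rintro ⟨e, ⟨i⟩⟩
    exact ⟨⟨toHom hX e, toHom hX i.inv, (comp_eq_iff hX).2 ⟨i.homInvId⟩,
      (comp_eq_iff hX).2 ⟨i.invHomId⟩⟩⟩
  · rintro ⟨i⟩
    exact ⟨ofHom hX i.hom, ⟨⟨ofHom hX i.inv, ((comp_eq_iff hX).1 i.hom_inv_id).some,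
      ((comp_eq_iff hX).1 i.inv_hom_id).some⟩⟩⟩

lemma isoRel_refl (x : lev X 0) : IsoRel X x x :=
  ⟨SSet.Edge.id x, ⟨SSet.Edge.InvStruct.invStructId x⟩⟩

lemma isoRel_symm {x y : lev X 0} (h : IsoRel X x y) : IsoRel X y x :=
  let ⟨_, ⟨i⟩⟩ := h
  ⟨i.inv, ⟨i.invStructInv⟩⟩

lemma isoRel_trans (hX : IsSegal X) {x y z : lev X 0} (h : IsoRel X x y) (h' : IsoRel X y z) :
    IsoRel X x z := by
  rw [isoRel_iff hX] at *
  exact ⟨h.some ≪≫ h'.some⟩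

lemma isoRel_map (f : X ⟶ Y) {x y : lev X 0} (h : IsoRel X x y) :
    IsoRel Y (onVert f x) (onVert f y) :=
  let ⟨e, ⟨i⟩⟩ := h
  ⟨e.map f, ⟨i.map f⟩⟩

/-- The isomorphism class of an object. -/
def isoMk (X : SSet.{u}) (x : lev X 0) : isoClasses.obj X := Quot.mk _ x

lemma isoMk_surjective (x : isoClasses.obj X) : ∃ y, isoMk X y = x := Quot.exists_rep x

lemma isoMk_eq_iff (hX : IsSegal X) {x y : lev X 0} : isoMk X x = isoMk X y ↔ IsoRel X x y := by
  have he : Equivalence (IsoRel X) := ⟨isoRel_refl, isoRel_symm, isoRel_trans hX⟩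
  constructor
  · intro h
    exact he.eqvGen_iff.1 (Quot.eqvGen_exact h)
  · exact fun h => Quot.sound h

lemma isoClasses_map_mk (f : X ⟶ Y) (x : lev X 0) :
    isoClasses.map f (isoMk X x) = isoMk Y (onVert f x) := rfl

/-- A category which is an equivalence relation on its objects. -/
def IsEqRel (X : SSet.{u}) : Prop :=
  IsSegal X ∧ ∀ x y : lev X 0, Subsingleton (SSet.Edge x y) ∧
    (Nonempty (SSet.Edge x y) → Nonempty (SSet.Edge y x))

lemma IsEqRel.edge_ext (hX : IsEqRel X) {a b : lev X 1} (h1 : src X a = src X b)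
    (h0 : tgt X a = tgt X b) : a = b := by
  have := (hX.2 (src X b) (tgt X b)).1
  have := congrArg SSet.Edge.edge
    (Subsingleton.elim (SSet.Edge.mk a h1 h0) (SSet.Edge.mk' b))
  exact this

lemma IsEqRel.isoRel_iff (hX : IsEqRel X) {x y : lev X 0} :
    IsoRel X x y ↔ Nonempty (SSet.Edge x y) := by
  constructor
  · rintro ⟨e, -⟩
    exact ⟨e⟩
  · rintro ⟨e⟩
    obtain ⟨e'⟩ := (hX.2 x y).2 ⟨e⟩
    obtain ⟨g, ⟨c⟩⟩ := hX.1.exists_comp e e'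
    obtain ⟨g', ⟨c'⟩⟩ := hX.1.exists_comp e' e
    have := (hX.2 x x).1
    have := (hX.2 y y).1
    obtain rfl := Subsingleton.elim g (SSet.Edge.id x)
    obtain rfl := Subsingleton.elim g' (SSet.Edge.id y)
    exact ⟨e, ⟨⟨e', c, c'⟩⟩⟩

section Pullback

variable {D A B E : SSet.{u}} {fst : D ⟶ A} {snd : D ⟶ B} {f : A ⟶ E} {g : B ⟶ E}

lemma pullback_app_ext (h : IsPullback fst snd f g) {k : SimplexCategoryᵒᵖ} {x y : D.obj k}
    (h1 : fst.app k x = fst.app k y) (h2 : snd.app k x = snd.app k y) : x = y :=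
  ((Types.isPullback_iff _ _ _ _).1 (h.app k)).2.1 x y ⟨h1, h2⟩

lemma pullback_app_exists (h : IsPullback fst snd f g) {k : SimplexCategoryᵒᵖ} {a : A.obj k}
    {b : B.obj k} (hab : f.app k a = g.app k b) : ∃ x, fst.app k x = a ∧ snd.app k x = b :=
  ((Types.isPullback_iff _ _ _ _).1 (h.app k)).2.2 a b hab

lemma pullback_w (h : IsPullback fst snd f g) (k : SimplexCategoryᵒᵖ) (x : D.obj k) :
    f.app k (fst.app k x) = g.app k (snd.app k x) :=
  ConcreteCategory.congr_hom (NatTrans.congr_app h.w k) x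

lemma onVert_src (φ : X ⟶ Y) (e : lev X 1) :
    onVert φ (src X e) = src Y (φ.app (op (SimplexCategory.mk 1)) e) :=
  NatTrans.naturality_apply φ _ e

lemma onVert_tgt (φ : X ⟶ Y) (e : lev X 1) :
    onVert φ (tgt X e) = tgt Y (φ.app (op (SimplexCategory.mk 1)) e) :=
  NatTrans.naturality_apply φ _ e

/-- Edges of a pullback over an equivalence relation are pairs of edges. -/
lemma exists_edge_pullback (h : IsPullback fst snd f g) (hE : IsEqRel E) {x y : lev D 0}
    (a : SSet.Edge (onVert fst x) (onVert fst y)) (b : SSet.Edge (onVert snd x) (onVert snd y)) :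
    ∃ e : SSet.Edge x y, e.map fst = a ∧ e.map snd = b := by
  obtain ⟨e, h1, h2⟩ := pullback_app_exists h (k := op (SimplexCategory.mk 1)) (a := a.edge)
    (b := b.edge) (hE.edge_ext
      (by
        refine (onVert_src f _).symm.trans (Eq.trans ?_ (onVert_src g _))
        refine (congrArg (onVert f) a.src_eq).trans
          (Eq.trans ?_ (congrArg (onVert g) b.src_eq).symm)
        exact pullback_w h _ x)
      (by
        refine (onVert_tgt f _).symm.trans (Eq.trans ?_ (onVert_tgt g _))
        refine (congrArg (onVert f) a.tgt_eq).trans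
          (Eq.trans ?_ (congrArg (onVert g) b.tgt_eq).symm)
        exact pullback_w h _ y))
  have s1 : src D e = x := by
    apply pullback_app_ext h
    · refine (onVert_src fst e).trans ?_
      rw [h1]
      exact a.src_eq
    · refine (onVert_src snd e).trans ?_
      rw [h2]
      exact b.src_eq
  have t1 : tgt D e = y := by
    apply pullback_app_ext h
    · refine (onVert_tgt fst e).trans ?_
      rw [h1]
      exact a.tgt_eq
    · refine (onVert_tgt snd e).trans ?_
      rw [h2]
      exact b.tgt_eq
  exact ⟨SSet.Edge.mk e s1 t1, SSet.Edge.ext h1, SSet.Edge.ext h2⟩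

lemma edge_pullback_ext (h : IsPullback fst snd f g) {x y : lev D 0} {e e' : SSet.Edge x y}
    (h1 : e.map fst = e'.map fst) (h2 : e.map snd = e'.map snd) : e = e' :=
  SSet.Edge.ext (pullback_app_ext h (congrArg SSet.Edge.edge h1) (congrArg SSet.Edge.edge h2))

lemma compStruct_pullback (h : IsPullback fst snd f g) (hA : IsSegal A) (hB : IsSegal B)
    (hE : IsSegal E) {x y z : lev D 0} {a : SSet.Edge x y} {b : SSet.Edge y z} {c : SSet.Edge x z}
    (h1 : (a.map fst).CompStruct (b.map fst) (c.map fst))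
    (h2 : (a.map snd).CompStruct (b.map snd) (c.map snd)) : Nonempty (a.CompStruct b c) := by
  obtain ⟨c', ⟨i⟩⟩ := (hA.pullback h hB hE).exists_comp a b
  have : c' = c :=
    edge_pullback_ext h (hA.comp_unique (i.map fst) h1) (hB.comp_unique (i.map snd) h2)
  exact this ▸ ⟨i⟩

lemma IsoRel.pullback (h : IsPullback fst snd f g) (hA : IsSegal A) (hB : IsSegal B)
    (hE : IsEqRel E) {x y : lev D 0} (h1 : IsoRel A (onVert fst x) (onVert fst y))
    (h2 : IsoRel B (onVert snd x) (onVert snd y)) : IsoRel D x y := by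
  obtain ⟨a, ⟨i⟩⟩ := h1
  obtain ⟨b, ⟨j⟩⟩ := h2
  obtain ⟨e, rfl, rfl⟩ := exists_edge_pullback h hE a b
  obtain ⟨e', e1, e2⟩ := exists_edge_pullback h hE i.inv j.inv
  have k1 := i.homInvId
  have k2 := i.invHomId
  have l1 := j.homInvId
  have l2 := j.invHomId
  rw [← e1, ← SSet.Edge.map_id] at k1 k2
  rw [← e2, ← SSet.Edge.map_id] at l1 l2
  exact ⟨e, ⟨⟨e', (compStruct_pullback h hA hB hE.1 k1 l1).some,
    (compStruct_pullback h hA hB hE.1 k2 l2).some⟩⟩⟩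

lemma IsEqRel.pullback (h : IsPullback fst snd f g) (hA : IsEqRel A) (hB : IsEqRel B)
    (hE : IsEqRel E) : IsEqRel D := by
  refine ⟨hA.1.pullback h hB.1 hE.1, fun x y => ⟨⟨fun e e' => ?_⟩, ?_⟩⟩
  · have := (hA.2 (onVert fst x) (onVert fst y)).1
    have := (hB.2 (onVert snd x) (onVert snd y)).1
    exact edge_pullback_ext h (Subsingleton.elim _ _) (Subsingleton.elim _ _)
  · rintro ⟨e⟩
    obtain ⟨a⟩ := (hA.2 _ _).2 ⟨e.map fst⟩
    obtain ⟨b⟩ := (hB.2 _ _).2 ⟨e.map snd⟩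
    obtain ⟨e', -⟩ := exists_edge_pullback h hE a b
    exact ⟨e'⟩

/-- Isomorphisms whose source is in the image of `f` can be lifted, on objects. -/
def IsIsofib (f : X ⟶ Y) : Prop :=
  ∀ (x : lev X 0) (y : lev Y 0), IsoRel Y (onVert f x) y → ∃ x', IsoRel X x x' ∧ onVert f x' = y

lemma IsIsofib.comp {f : X ⟶ Y} {g : Y ⟶ Z} (hf : IsIsofib f) (hg : IsIsofib g) :
    IsIsofib (f ≫ g) := by
  intro x z h
  obtain ⟨y, hy, rfl⟩ := hg (onVert f x) z h
  obtain ⟨x', hx, rfl⟩ := hf x y hy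
  exact ⟨x', hx, rfl⟩

lemma IsIsofib.baseChange (h : IsPullback fst snd f g) (hA : IsSegal A) (hB : IsSegal B)
    (hE : IsEqRel E) (hg : IsIsofib g) : IsIsofib fst := by
  intro x a ha
  have h1 : IsoRel E (onVert g (onVert snd x)) (onVert f a) := by
    have := isoRel_map f ha
    rwa [show onVert f (onVert fst x) = onVert g (onVert snd x) from pullback_w h _ x] at this
  obtain ⟨b, hb, hb'⟩ := hg _ _ h1
  obtain ⟨x', rfl, rfl⟩ := pullback_app_exists h hb'.symm
  exact ⟨x', IsoRel.pullback h hA hB hE ha hb, rfl⟩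

/-- The isomorphism classes of objects of a pullback over an equivalence relation along an
isofibration. -/
lemma isoClasses_isPullback (h : IsPullback fst snd f g) (hA : IsSegal A) (hB : IsSegal B)
    (hE : IsEqRel E) (hg : IsIsofib g) :
    IsPullback (isoClasses.map fst) (isoClasses.map snd) (isoClasses.map f)
      (isoClasses.map g) := by
  rw [Types.isPullback_iff]
  refine ⟨?_, ?_, ?_⟩
  · rw [← Functor.map_comp, ← Functor.map_comp, h.w]
  · rintro x y ⟨h1, h2⟩
    obtain ⟨x, rfl⟩ := isoMk_surjective x
    obtain ⟨y, rfl⟩ := isoMk_surjective y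
    rw [isoClasses_map_mk, isoClasses_map_mk, isoMk_eq_iff hA] at h1
    rw [isoClasses_map_mk, isoClasses_map_mk, isoMk_eq_iff hB] at h2
    exact Quot.sound (IsoRel.pullback h hA hB hE h1 h2)
  · intro a b hab
    obtain ⟨a, rfl⟩ := isoMk_surjective a
    obtain ⟨b, rfl⟩ := isoMk_surjective b
    rw [isoClasses_map_mk, isoClasses_map_mk, isoMk_eq_iff hE.1] at hab
    obtain ⟨b', hb, hb'⟩ := hg b _ (isoRel_symm hab)
    obtain ⟨x, rfl, rfl⟩ := pullback_app_exists h hb'.symm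
    exact ⟨isoMk D x, rfl, Quot.sound (isoRel_symm hb)⟩

end Pullback

end Segal

/-! ### Equivalences of categories -/

section CatEquiv

variable {X Y Z : SSet.{u}}

lemma isoRel_of_map {f : X ⟶ Y} (hX : IsSegal X) (hY : IsSegal Y)
    (hf : ∀ x y : lev X 0, Function.Bijective (fun e : SSet.Edge x y => e.map f))
    {x y : lev X 0} (h : IsoRel Y (onVert f x) (onVert f y)) : IsoRel X x y := by
  obtain ⟨a, ⟨i⟩⟩ := h
  obtain ⟨e, rfl⟩ := (hf x y).2 a
  obtain ⟨e', he'⟩ := (hf y x).2 i.inv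
  have key {z w : lev X 0} (a : SSet.Edge z w) (b : SSet.Edge w z)
      (h : (a.map f).CompStruct (b.map f) (SSet.Edge.id (onVert f z))) :
      Nonempty (a.CompStruct b (SSet.Edge.id z)) := by
    obtain ⟨c, ⟨hc⟩⟩ := hX.exists_comp a b
    have : c = SSet.Edge.id z := by
      apply (hf z z).1
      rw [← SSet.Edge.map_id] at h
      exact hY.comp_unique (hc.map f) h
    exact this ▸ ⟨hc⟩
  have k1 := i.homInvId
  have k2 := i.invHomId
  dsimp only at k1 k2 he'
  rw [← he'] at k1 k2
  exact ⟨e, ⟨⟨e', (key e e' k1).some, (key e' e k2).some⟩⟩⟩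

lemma isCatEquiv_of_isIso (f : X ⟶ Y) [IsIso f] : IsCatEquiv f := by
  have hfg (k : SimplexCategoryᵒᵖ) (x : X.obj k) : (inv f).app k (f.app k x) = x :=
    ConcreteCategory.congr_hom (NatTrans.congr_app (IsIso.hom_inv_id f) k) x
  have hgf (k : SimplexCategoryᵒᵖ) (x : Y.obj k) : f.app k ((inv f).app k x) = x :=
    ConcreteCategory.congr_hom (NatTrans.congr_app (IsIso.inv_hom_id f) k) x
  refine ⟨fun x y => ⟨fun e e' h => ?_, fun e => ?_⟩, fun y => ?_⟩
  · apply SSet.Edge.ext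
    have := congrArg ((inv f).app _) (congrArg SSet.Edge.edge h)
    rw [SSet.Edge.map_edge, SSet.Edge.map_edge, hfg, hfg] at this
    exact this
  · have s : src X ((inv f).app _ e.edge) = x := by
      refine (onVert_src (inv f) e.edge).symm.trans ?_
      exact (congrArg _ e.src_eq).trans (hfg _ x)
    have t : tgt X ((inv f).app _ e.edge) = y := by
      refine (onVert_tgt (inv f) e.edge).symm.trans ?_
      exact (congrArg _ e.tgt_eq).trans (hfg _ y)
    exact ⟨SSet.Edge.mk _ s t, SSet.Edge.ext (hgf _ e.edge)⟩
  · refine ⟨(inv f).app _ y, ?_⟩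
    rw [hgf]
    exact isoRel_refl y

lemma IsCatEquiv.comp {f : X ⟶ Y} {g : Y ⟶ Z} (hZ : IsSegal Z) (hf : IsCatEquiv f)
    (hg : IsCatEquiv g) : IsCatEquiv (f ≫ g) := by
  refine ⟨fun x y => (hg.1 _ _).comp (hf.1 x y), fun z => ?_⟩
  obtain ⟨y, hy⟩ := hg.2 z
  obtain ⟨x, hx⟩ := hf.2 y
  exact ⟨x, isoRel_trans hZ (isoRel_map g hx) hy⟩

lemma IsCatEquiv.of_comp {f : X ⟶ Y} {g : Y ⟶ Z} (hY : IsSegal Y) (hZ : IsSegal Z)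
    (hg : IsCatEquiv g) (hfg : IsCatEquiv (f ≫ g)) : IsCatEquiv f := by
  refine ⟨fun x y => ?_, fun y => ?_⟩
  · have := hfg.1 x y
    exact (Function.Bijective.of_comp_iff' (hg.1 _ _) _).1 this
  · obtain ⟨x, hx⟩ := hfg.2 (onVert g y)
    exact ⟨x, isoRel_of_map hY hZ hg.1 hx⟩

lemma IsCatEquiv.isIso_isoClasses {f : X ⟶ Y} (hX : IsSegal X) (hY : IsSegal Y)
    (hf : IsCatEquiv f) : IsIso (isoClasses.map f) := by
  rw [isIso_iff_bijective]
  constructor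
  · intro x y h
    obtain ⟨x, rfl⟩ := isoMk_surjective x
    obtain ⟨y, rfl⟩ := isoMk_surjective y
    rw [isoClasses_map_mk, isoClasses_map_mk, isoMk_eq_iff hY] at h
    exact Quot.sound (isoRel_of_map hX hY hf.1 h)
  · intro y
    obtain ⟨y, rfl⟩ := isoMk_surjective y
    obtain ⟨x, hx⟩ := hf.2 y
    exact ⟨isoMk X x, Quot.sound hx⟩

lemma isCatEquiv_of_isEqRel {f : X ⟶ Y} (hX : IsEqRel X) (hY : IsEqRel Y)
    (hf : IsIso (isoClasses.map f)) : IsCatEquiv f := by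
  rw [isIso_iff_bijective] at hf
  refine ⟨fun x y => ⟨fun e e' _ => ?_, fun e => ?_⟩, fun y => ?_⟩
  · have := (hX.2 x y).1
    exact Subsingleton.elim _ _
  · have h : isoMk X x = isoMk X y := by
      apply hf.1
      rw [isoClasses_map_mk, isoClasses_map_mk, isoMk_eq_iff hY.1, hY.isoRel_iff]
      exact ⟨e⟩
    rw [isoMk_eq_iff hX.1, hX.isoRel_iff] at h
    have := (hY.2 (onVert f x) (onVert f y)).1
    exact ⟨h.some, Subsingleton.elim _ _⟩
  · obtain ⟨x, hx⟩ := hf.2 (isoMk Y y)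
    obtain ⟨x, rfl⟩ := isoMk_surjective x
    rw [isoClasses_map_mk, isoMk_eq_iff hY.1] at hx
    exact ⟨x, hx⟩

/-- A map of pullbacks over equivalence relations is an equivalence if its three components are and
if the pullbacks are preserved by passing to isomorphism classes of objects. -/
lemma isCatEquiv_pullback {D A B E D' A' B' E' : SSet.{u}} {fst : D ⟶ A} {snd : D ⟶ B}
    {f : A ⟶ E} {g : B ⟶ E} {fst' : D' ⟶ A'} {snd' : D' ⟶ B'} {f' : A' ⟶ E'} {g' : B' ⟶ E'}
    (h : IsPullback fst snd f g) (h' : IsPullback fst' snd' f' g')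
    (hp : IsPullback (isoClasses.map fst) (isoClasses.map snd) (isoClasses.map f)
      (isoClasses.map g))
    (hp' : IsPullback (isoClasses.map fst') (isoClasses.map snd') (isoClasses.map f')
      (isoClasses.map g'))
    (hA' : IsSegal A') (hB' : IsSegal B')
    (hE : IsEqRel E) (hE' : IsEqRel E') {δ : D ⟶ D'} {α : A ⟶ A'} {β : B ⟶ B'} {ε : E ⟶ E'}
    (w1 : δ ≫ fst' = fst ≫ α) (w2 : δ ≫ snd' = snd ≫ β) (w3 : f ≫ ε = α ≫ f')
    (w4 : g ≫ ε = β ≫ g') (hα : IsCatEquiv α) (hβ : IsCatEquiv β) (hε : IsCatEquiv ε) :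
    IsCatEquiv δ := by
  have v1 (x : lev D 0) : onVert fst' (onVert δ x) = onVert α (onVert fst x) :=
    ConcreteCategory.congr_hom (NatTrans.congr_app w1 _) x
  have v2 (x : lev D 0) : onVert snd' (onVert δ x) = onVert β (onVert snd x) :=
    ConcreteCategory.congr_hom (NatTrans.congr_app w2 _) x
  have l1 (x : lev D 1) : fst'.app (op (SimplexCategory.mk 1)) (δ.app _ x) =
      α.app _ (fst.app _ x) := ConcreteCategory.congr_hom (NatTrans.congr_app w1 _) x
  have l2 (x : lev D 1) : snd'.app (op (SimplexCategory.mk 1)) (δ.app _ x) =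
      β.app _ (snd.app _ x) := ConcreteCategory.congr_hom (NatTrans.congr_app w2 _) x
  refine ⟨fun x y => ⟨fun e e' he => ?_, fun e => ?_⟩, fun y => ?_⟩
  · refine edge_pullback_ext h ((hα.1 _ _).1 ?_) ((hβ.1 _ _).1 ?_)
    · apply SSet.Edge.ext
      have := congrArg (fst'.app _) (congrArg SSet.Edge.edge he)
      exact (l1 _).symm.trans (this.trans (l1 _))
    · apply SSet.Edge.ext
      have := congrArg (snd'.app _) (congrArg SSet.Edge.edge he)
      exact (l2 _).symm.trans (this.trans (l2 _))
  · obtain ⟨a, ha⟩ := (hα.1 (onVert fst x) (onVert fst y)).2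
      ((e.map fst').ofEq (v1 x) (v1 y))
    obtain ⟨b, hb⟩ := (hβ.1 (onVert snd x) (onVert snd y)).2
      ((e.map snd').ofEq (v2 x) (v2 y))
    obtain ⟨c, rfl, rfl⟩ := exists_edge_pullback h hE a b
    refine ⟨c, edge_pullback_ext h' (SSet.Edge.ext ?_) (SSet.Edge.ext ?_)⟩
    · exact (l1 _).trans (congrArg SSet.Edge.edge ha)
    · exact (l2 _).trans (congrArg SSet.Edge.edge hb)
  · obtain ⟨a, ha⟩ := hα.2 (onVert fst' y)
    obtain ⟨b, hb⟩ := hβ.2 (onVert snd' y)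
    have hab : IsoRel E (onVert f a) (onVert g b) := by
      refine isoRel_of_map hE.1 hE'.1 hε.1 ?_
      have e1 : onVert ε (onVert f a) = onVert f' (onVert α a) :=
        ConcreteCategory.congr_hom (NatTrans.congr_app w3 _) a
      have e2 : onVert ε (onVert g b) = onVert g' (onVert β b) :=
        ConcreteCategory.congr_hom (NatTrans.congr_app w4 _) b
      rw [e1, e2]
      refine isoRel_trans hE'.1 (isoRel_map f' ha) (isoRel_symm ?_)
      rw [show onVert f' (onVert fst' y) = onVert g' (onVert snd' y) from pullback_w h' _ y]
      exact isoRel_map g' hb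
    obtain ⟨x, hx1, hx2⟩ := ((Types.isPullback_iff _ _ _ _).1 hp).2.2 (isoMk A a) (isoMk B b)
      (Quot.sound hab)
    obtain ⟨x, rfl⟩ := isoMk_surjective x
    refine ⟨x, ?_⟩
    have hD' : IsSegal D' := hA'.pullback h' hB' hE'.1
    rw [← isoMk_eq_iff hD']
    refine ((Types.isPullback_iff _ _ _ _).1 hp').2.1 _ _ ⟨?_, ?_⟩
    · change isoMk A' (onVert fst' (onVert δ x)) = isoMk A' (onVert fst' y)
      rw [v1]
      refine Eq.trans ?_ (Quot.sound ha)
      exact congrArg (isoClasses.map α) hx1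
    · change isoMk B' (onVert snd' (onVert δ x)) = isoMk B' (onVert snd' y)
      rw [v2]
      refine Eq.trans ?_ (Quot.sound hb)
      exact congrArg (isoClasses.map β) hx2

/-- A category with only identity arrows. -/
def IsConst (X : SSet.{u}) : Prop := IsEqRel X ∧ ∀ x y : lev X 0, IsoRel X x y → x = y

lemma IsConst.isIsofib (hY : IsConst Y) (f : X ⟶ Y) : IsIsofib f :=
  fun x _ h => ⟨x, isoRel_refl x, hY.2 _ _ h⟩

/-- The base `E` is constant, so lifts of the two components of an isomorphism automatically agree
in it. -/
lemma isIsofib_pullback {D A B E D' A' B' E' : SSet.{u}} {fst : D ⟶ A} {snd : D ⟶ B}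
    {f : A ⟶ E} {g : B ⟶ E} {fst' : D' ⟶ A'} {snd' : D' ⟶ B'} {f' : A' ⟶ E'} {g' : B' ⟶ E'}
    (h : IsPullback fst snd f g) (h' : IsPullback fst' snd' f' g')
    (hA : IsSegal A) (hB : IsSegal B) (hE : IsConst E)
    {δ : D ⟶ D'} {α : A ⟶ A'} {β : B ⟶ B'}
    (w1 : δ ≫ fst' = fst ≫ α) (w2 : δ ≫ snd' = snd ≫ β)
    (hα : IsIsofib α) (hβ : IsIsofib β) : IsIsofib δ := by
  have v1 (x : lev D 0) : onVert fst' (onVert δ x) = onVert α (onVert fst x) :=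
    ConcreteCategory.congr_hom (NatTrans.congr_app w1 _) x
  have v2 (x : lev D 0) : onVert snd' (onVert δ x) = onVert β (onVert snd x) :=
    ConcreteCategory.congr_hom (NatTrans.congr_app w2 _) x
  intro x y hxy
  have r1 := isoRel_map fst' hxy
  have r2 := isoRel_map snd' hxy
  rw [v1] at r1
  rw [v2] at r2
  obtain ⟨a, ha, ha'⟩ := hα _ _ r1
  obtain ⟨b, hb, hb'⟩ := hβ _ _ r2
  have hab : onVert f a = onVert g b := by
    rw [← hE.2 _ _ (isoRel_map f ha), ← hE.2 _ _ (isoRel_map g hb)]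
    exact pullback_w h _ x
  obtain ⟨z, rfl, rfl⟩ := pullback_app_exists h hab
  refine ⟨z, IsoRel.pullback h hA hB hE.1 ha hb, pullback_app_ext h' ?_ ?_⟩
  · exact (v1 z).trans ha'
  · exact (v2 z).trans hb'

lemma isSegal_const (S : Type u) : IsSegal ((Functor.const SimplexCategoryᵒᵖ).obj S) := by
  rw [isSegal_iff]
  intro m
  have i1 : IsIso (lastEdge ((Functor.const SimplexCategoryᵒᵖ).obj S) m) :=
    inferInstanceAs (IsIso (𝟙 S))
  have i2 : IsIso (lastVertex ((Functor.const SimplexCategoryᵒᵖ).obj S) m) :=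
    inferInstanceAs (IsIso (𝟙 S))
  exact IsPullback.of_vert_isIso ⟨segal_square_comm _ m⟩

lemma isConst_const (S : Type u) : IsConst ((Functor.const SimplexCategoryᵒᵖ).obj S) := by
  have key {x y : S} (e : SSet.Edge (X := (Functor.const SimplexCategoryᵒᵖ).obj S) x y) :
      e.edge = x ∧ e.edge = y := ⟨e.src_eq, e.tgt_eq⟩
  refine ⟨⟨isSegal_const S, fun x y => ⟨⟨fun e e' => ?_⟩, fun ⟨e⟩ => ?_⟩⟩, fun x y ⟨e, _⟩ => ?_⟩
  · exact SSet.Edge.ext ((key e).1.trans (key e').1.symm)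
  · exact ⟨SSet.Edge.mk e.edge (key e).2 (key e).1⟩
  · exact (key e).1.symm.trans (key e).2

lemma IsConst.of_iso (e : X ≅ Y) (h : IsConst X) : IsConst Y := by
  have hpb : IsPullback e.inv e.inv (𝟙 X) (𝟙 X) := IsPullback.of_vert_isIso ⟨by simp⟩
  refine ⟨IsEqRel.pullback hpb h.1 h.1 h.1, fun x y hxy => ?_⟩
  have := h.2 _ _ (isoRel_map e.inv hxy)
  exact pullback_app_ext hpb this this

/-! ### Isomorphism classes and connected components -/

/-- The comparison from isomorphism classes of objects to connected components. -/
def isoToComp : isoClasses.{u} ⟶ SSet.π₀Functor where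
  app X := TypeCat.ofHom (Quot.lift (fun x => SSet.π₀.mk x) fun _ _ ⟨e, _⟩ => SSet.π₀.sound e)
  naturality X Y f := by
    ext x
    obtain ⟨x, rfl⟩ := isoMk_surjective x
    rfl

lemma isIso_isoToComp (hX : IsEqRel X) : IsIso (isoToComp.app X) := by
  rw [isIso_iff_bijective]
  constructor
  · intro x y h
    obtain ⟨x, rfl⟩ := isoMk_surjective x
    obtain ⟨y, rfl⟩ := isoMk_surjective y
    replace h : SSet.π₀.mk x = SSet.π₀.mk y := h
    rw [SSet.π₀.mk_eq_mk_iff] at h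
    refine Quot.sound ?_
    induction h with
    | rel x y h => exact hX.isoRel_iff.2 h
    | refl x => exact isoRel_refl x
    | symm x y _ ih => exact isoRel_symm ih
    | trans x y z _ _ ih ih' => exact isoRel_trans hX.1 ih ih'
  · intro c
    obtain ⟨x, rfl⟩ := SSet.π₀.mk_surjective c
    exact ⟨isoMk X x, rfl⟩

/-! ### Fully faithful maps -/

section Cart

variable {π : X ⟶ Y}

lemma codisc_ext {B : Type u} {k : SimplexCategoryᵒᵖ} {a b : (codisc.obj B).obj k}
    (h : ∀ i, coord B k i a = coord B k i b) : a = b := by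
  have : TypeCat.ofHom (fun _ : PUnit => a) = TypeCat.ofHom (fun _ : PUnit => b) :=
    codisc_hom_ext fun i => by
      ext
      exact h i
  exact ConcreteCategory.congr_hom this PUnit.unit

lemma codisc_exists {B : Type u} (k : SimplexCategoryᵒᵖ) (b : Fin (k.unop.len + 1) → B) :
    ∃ a : (codisc.obj B).obj k, ∀ i, coord B k i a = b i :=
  ⟨codiscLift (W := PUnit) k (fun i => TypeCat.ofHom fun _ => b i) PUnit.unit, fun i =>
    ConcreteCategory.congr_hom (codiscLift_coord k (fun i => TypeCat.ofHom fun _ => b i) i)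
      PUnit.unit⟩

lemma verts_coord_zero (X : SSet.{u}) (e : lev X 1) :
    coord (lev X 0) (op (SimplexCategory.mk 1)) (0 : Fin 2) ((verts X).app _ e) = src X e := by
  refine (ConcreteCategory.congr_hom
    (verts_app_coord (C := Type u) X (op (SimplexCategory.mk 1)) (0 : Fin 2)) e).trans ?_
  have : SimplexCategory.const (SimplexCategory.mk 0) (SimplexCategory.mk 1) (0 : Fin 2) =
      SimplexCategory.δ (1 : Fin 2) := by
    ext j
    fin_cases j
    rfl
  change X.map (SimplexCategory.const _ _ _).op e = _
  rw [this]
  rfl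

lemma verts_coord_one (X : SSet.{u}) (e : lev X 1) :
    coord (lev X 0) (op (SimplexCategory.mk 1)) (1 : Fin 2) ((verts X).app _ e) = tgt X e := by
  refine (ConcreteCategory.congr_hom
    (verts_app_coord (C := Type u) X (op (SimplexCategory.mk 1)) (1 : Fin 2)) e).trans ?_
  have : SimplexCategory.const (SimplexCategory.mk 0) (SimplexCategory.mk 1) (1 : Fin 2) =
      SimplexCategory.δ (0 : Fin 2) := by
    ext j
    fin_cases j
    rfl
  change X.map (SimplexCategory.const _ _ _).op e = _
  rw [this]
  rfl

lemma IsCart.edge_bijective (h : IsCart π) (x y : lev X 0) :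
    Function.Bijective (fun e : SSet.Edge x y => e.map π) := by
  have h1 := (Types.isPullback_iff _ _ _ _).1 (IsPullback.app h (op (SimplexCategory.mk 1)))
  constructor
  · intro e e' hee
    refine SSet.Edge.ext (h1.2.1 _ _ ⟨congrArg SSet.Edge.edge hee, codisc_ext fun i => ?_⟩)
    fin_cases i
    · refine (verts_coord_zero X e.edge).trans (Eq.trans ?_ (verts_coord_zero X e'.edge).symm)
      exact e.src_eq.trans e'.src_eq.symm
    · refine (verts_coord_one X e.edge).trans (Eq.trans ?_ (verts_coord_one X e'.edge).symm)
      exact e.tgt_eq.trans e'.tgt_eq.symm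
  · intro a
    obtain ⟨c, hc⟩ := codisc_exists (op (SimplexCategory.mk 1))
      (fun i : Fin 2 => if i = 0 then x else y)
    have hc0 := hc (0 : Fin 2)
    have hc1 := hc (1 : Fin 2)
    simp only [if_true, one_ne_zero, if_false] at hc0 hc1
    have hm (i : Fin 2) : coord (lev Y 0) (op (SimplexCategory.mk 1)) i
        ((codisc.map (π.app (op (SimplexCategory.mk 0)))).app (op (SimplexCategory.mk 1)) c) =
          onVert π (coord (lev X 0) (op (SimplexCategory.mk 1)) i c) :=
      ConcreteCategory.congr_hom (codisc_map_app_coord (π.app (op (SimplexCategory.mk 0)))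
        (op (SimplexCategory.mk 1)) i) c
    obtain ⟨e, he1, he2⟩ := h1.2.2 a.edge c (codisc_ext fun i => by
      fin_cases i
      · refine (verts_coord_zero Y a.edge).trans (a.src_eq.trans ?_)
        refine Eq.trans ?_ (hm 0).symm
        rw [hc0]
      · refine (verts_coord_one Y a.edge).trans (a.tgt_eq.trans ?_)
        refine Eq.trans ?_ (hm 1).symm
        rw [hc1])
    have s : src X e = x := by rw [← verts_coord_zero, he2, hc0]
    have t : tgt X e = y := by rw [← verts_coord_one, he2, hc1]
    exact ⟨SSet.Edge.mk e s t, SSet.Edge.ext he1⟩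

lemma IsCart.isCatEquiv (h : IsCart π) (hs : Function.Surjective (onVert π)) : IsCatEquiv π :=
  ⟨h.edge_bijective, fun y => by
    obtain ⟨x, rfl⟩ := hs y
    exact ⟨x, isoRel_refl _⟩⟩

lemma IsCart.isIsofib (h : IsCart π) (hY : IsSegal Y) (hs : Function.Surjective (onVert π)) :
    IsIsofib π := by
  intro x y hxy
  obtain ⟨x', rfl⟩ := hs y
  exact ⟨x', isoRel_of_map (h.isSegal hY) hY h.edge_bijective hxy, rfl⟩

lemma IsCart.isEqRel (h : IsCart π) (hY : IsEqRel Y) : IsEqRel X := by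
  refine ⟨h.isSegal hY.1, fun x y => ⟨⟨fun e e' => ?_⟩, fun ⟨e⟩ => ?_⟩⟩
  · have := (hY.2 (onVert π x) (onVert π y)).1
    exact (h.edge_bijective x y).1 (Subsingleton.elim _ _)
  · obtain ⟨a⟩ := (hY.2 _ _).2 ⟨e.map π⟩
    obtain ⟨e', -⟩ := (h.edge_bijective y x).2 a
    exact ⟨e'⟩

end Cart

end CatEquiv

/-! ### The décalage of a category -/

section Dec

variable (X : SSet.{u})

/-- The décalage of `X`. -/
abbrev Dec : SSet.{u} := dec.functor.obj X

/-- The map forgetting the extra vertex. -/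
abbrev decFst : Dec X ⟶ X := dec.map.app X

lemma src_Dec : src (Dec X) = X.δ (2 : Fin 3) := by
  have : shift.map (SimplexCategory.δ (1 : Fin 2)) = SimplexCategory.δ (2 : Fin 3) := by
    ext j
    fin_cases j <;> rfl
  change X.map (shift.map (SimplexCategory.δ (1 : Fin 2))).op = _
  rw [this]
  rfl

lemma tgt_Dec : tgt (Dec X) = X.δ (1 : Fin 3) := by
  have : shift.map (SimplexCategory.δ (0 : Fin 2)) = SimplexCategory.δ (1 : Fin 3) := by
    ext j
    fin_cases j <;> rfl
  change X.map (shift.map (SimplexCategory.δ (0 : Fin 2))).op = _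
  rw [this]
  rfl

lemma isSegal_Dec {X : SSet.{u}} (hX : IsSegal X) : IsSegal (Dec X) := by
  rw [isSegal_iff] at *
  intro m
  -- the Segal square of `Dec X`, pasted with the second Segal square of `X`, is a Segal square
  -- of `X`
  have h1 := hX 1
  have h2 := hX (m + 1)
  have e1 : initFace (Dec X) m = initFace X (m + 1) := by
    have : shift.map (SimplexCategory.δ (Fin.last (m + 1))) =
        SimplexCategory.δ (Fin.last (m + 2)) := by
      ext j
      induction j using Fin.cases with
      | zero => rfl
      | succ j =>
        change ((Fin.last (m + 1)).succAbove j).succ.val = ((Fin.last (m + 2)).succAbove j.succ).val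
        simp only [Fin.succAbove_last, Fin.val_succ]
        rfl
    change X.map (shift.map (SimplexCategory.δ (Fin.last (m + 1)))).op = _
    rw [this]
    rfl
  have e2 : src (Dec X) = initFace X 1 := src_Dec X
  have e3 : lastEdge (Dec X) m ≫ lastEdge X 1 = lastEdge X (m + 1) := by
    have : SimplexCategory.mkOfSucc (Fin.last 1) ≫
        shift.map (SimplexCategory.mkOfSucc (Fin.last m)) =
        SimplexCategory.mkOfSucc (Fin.last (m + 1)) := by
      ext j
      fin_cases j <;> rfl
    change X.map (shift.map (SimplexCategory.mkOfSucc (Fin.last m))).op ≫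
      X.map (SimplexCategory.mkOfSucc (Fin.last 1)).op = X.map _
    exact (X.map_comp _ _).symm.trans (congrArg (fun t => X.map (Quiver.Hom.op t)) this)
  have e4 : lastVertex (Dec X) m ≫ lastVertex X 1 = lastVertex X (m + 1) := by
    have : SimplexCategory.const (SimplexCategory.mk 0) (SimplexCategory.mk 1) (Fin.last 1) ≫
        shift.map (SimplexCategory.const (SimplexCategory.mk 0) (SimplexCategory.mk m)
          (Fin.last m)) =
        SimplexCategory.const (SimplexCategory.mk 0) (SimplexCategory.mk (m + 1))
          (Fin.last (m + 1)) := by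
      ext j
      fin_cases j
      rfl
    change X.map (shift.map (SimplexCategory.const (SimplexCategory.mk 0) (SimplexCategory.mk m)
      (Fin.last m))).op ≫ X.map (SimplexCategory.const _ _ _).op = X.map _
    exact (X.map_comp _ _).symm.trans (congrArg (fun t => X.map (Quiver.Hom.op t)) this)
  have h3 : IsPullback (initFace (Dec X) m) (lastEdge (Dec X) m ≫ lastEdge X 1)
      (lastVertex (Dec X) m ≫ lastVertex X 1) (src X) := by
    rw [e1, e3, e4]
    exact h2
  have h4 : IsPullback (src (Dec X)) (lastEdge X 1) (lastVertex X 1) (src X) := by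
    rw [e2]
    exact h1
  exact IsPullback.of_bot h3 (segal_square_comm (Dec X) m) h4

lemma isEqRel_Dec {X : SSet.{u}} (hX : IsEqRel X) : IsEqRel (Dec X) := by
  refine ⟨isSegal_Dec hX.1, fun x y => ⟨⟨fun e e' => ?_⟩, fun ⟨e⟩ => ?_⟩⟩
  · have h2 : X.δ (2 : Fin 3) e.edge = X.δ (2 : Fin 3) e'.edge := by
      rw [← src_Dec]
      exact e.src_eq.trans e'.src_eq.symm
    have h1 : X.δ (1 : Fin 3) e.edge = X.δ (1 : Fin 3) e'.edge := by
      rw [← tgt_Dec]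
      exact e.tgt_eq.trans e'.tgt_eq.symm
    refine SSet.Edge.ext (hX.1.ext_two h2 (hX.edge_ext ?_ ?_))
    · have key (σ : lev X 2) : src X (X.δ (0 : Fin 3) σ) = tgt X (X.δ (2 : Fin 3) σ) :=
        (ConcreteCategory.congr_hom (X.δ_comp_δ (n := 0) (i := 0) (j := 1) (by decide)) σ).symm
      exact (key _).trans ((congrArg _ h2).trans (key _).symm)
    · have key (σ : lev X 2) : tgt X (X.δ (0 : Fin 3) σ) = tgt X (X.δ (1 : Fin 3) σ) :=
        (ConcreteCategory.congr_hom (X.δ_comp_δ (n := 0) (i := 0) (j := 0) le_rfl) σ).symm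
      exact (key _).trans ((congrArg _ h1).trans (key _).symm)
  · have e2 : X.δ (2 : Fin 3) e.edge = x := by
      rw [← src_Dec]
      exact e.src_eq
    have e1 : X.δ (1 : Fin 3) e.edge = y := by
      rw [← tgt_Dec]
      exact e.tgt_eq
    have s (σ : lev X 2) : src X (X.δ (0 : Fin 3) σ) = tgt X (X.δ (2 : Fin 3) σ) :=
      (ConcreteCategory.congr_hom (X.δ_comp_δ (n := 0) (i := 0) (j := 1) (by decide)) σ).symm
    have t (σ : lev X 2) : tgt X (X.δ (0 : Fin 3) σ) = tgt X (X.δ (1 : Fin 3) σ) :=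
      (ConcreteCategory.congr_hom (X.δ_comp_δ (n := 0) (i := 0) (j := 0) le_rfl) σ).symm
    have r (σ : lev X 2) : src X (X.δ (2 : Fin 3) σ) = src X (X.δ (1 : Fin 3) σ) :=
      (ConcreteCategory.congr_hom (X.δ_comp_δ (n := 0) (i := 1) (j := 1) le_rfl) σ)
    obtain ⟨b⟩ := (hX.2 _ _).2 ⟨SSet.Edge.mk' (X.δ (0 : Fin 3) e.edge)⟩
    have hb0 : src X b.edge = tgt X y := b.src_eq.trans ((t _).trans (congrArg _ e1))
    have hb1 : tgt X b.edge = tgt X x := b.tgt_eq.trans ((s _).trans (congrArg _ e2))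
    obtain ⟨τ, h2, h0⟩ := hX.1.exists_two (a := y) (b := b.edge) hb0.symm
    have h1 : X.δ (1 : Fin 3) τ = x := by
      apply hX.edge_ext
      · exact (r τ).symm.trans ((congrArg _ h2).trans ((congrArg (src X) e1).symm.trans
          ((r _).symm.trans (congrArg _ e2))))
      · exact (t τ).symm.trans ((congrArg _ h0).trans hb1)
    refine ⟨SSet.Edge.mk τ ?_ ?_⟩
    · exact (ConcreteCategory.congr_hom (src_Dec X) τ).trans h2
    · exact (ConcreteCategory.congr_hom (tgt_Dec X) τ).trans h1

/-- Two arrows with the same source are isomorphic in the décalage of an equivalence relation. -/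
lemma isoRel_Dec {X : SSet.{u}} (hX : IsEqRel X) {a b : lev X 1} (h : src X a = src X b) :
    IsoRel (Dec X) a b := by
  refine (isEqRel_Dec hX).isoRel_iff.2 ?_
  obtain ⟨a'⟩ := (hX.2 _ _).2 ⟨SSet.Edge.mk' a⟩
  obtain ⟨c, -⟩ := hX.1.exists_comp a' (SSet.Edge.mk (x₁ := tgt X b) b h.symm rfl)
  obtain ⟨τ, h2, h0⟩ := hX.1.exists_two (a := a) (b := c.edge) c.src_eq.symm
  have h1 : X.δ (1 : Fin 3) τ = b := by
    apply hX.edge_ext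
    · refine (ConcreteCategory.congr_hom
        (X.δ_comp_δ (n := 0) (i := 1) (j := 1) le_rfl) τ).symm.trans ?_
      exact (congrArg _ h2).trans h
    · refine ((ConcreteCategory.congr_hom
        (X.δ_comp_δ (n := 0) (i := 0) (j := 0) le_rfl) τ)).trans ?_
      exact (congrArg _ h0).trans c.tgt_eq
  refine ⟨SSet.Edge.mk τ ?_ ?_⟩
  · exact (ConcreteCategory.congr_hom (src_Dec X) τ).trans h2
  · exact (ConcreteCategory.congr_hom (tgt_Dec X) τ).trans h1

lemma isIsofib_decFst {X : SSet.{u}} (hX : IsEqRel X) : IsIsofib (decFst X) := by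
  intro a y hy
  rw [hX.isoRel_iff] at hy
  obtain ⟨e⟩ := hy
  obtain ⟨c, -⟩ := hX.1.exists_comp (SSet.Edge.mk' (X := X) a) e
  exact ⟨c.edge, isoRel_Dec hX c.src_eq.symm, c.tgt_eq⟩

lemma decFst_surjective (k : SimplexCategoryᵒᵖ) : Function.Surjective ((decFst X).app k) := by
  intro x
  have h : SimplexCategory.δ (n := k.unop.len) 0 ≫ SimplexCategory.σ 0 = 𝟙 _ :=
    SimplexCategory.δ_comp_σ_self' rfl
  refine ⟨X.map (SimplexCategory.σ (n := k.unop.len) 0).op x, ?_⟩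
  change X.map (SimplexCategory.δ (n := k.unop.len) 0).op
    (X.map (SimplexCategory.σ (n := k.unop.len) 0).op x) = x
  rw [← Functor.map_comp_apply, ← op_comp, h]
  exact ConcreteCategory.congr_hom (X.map_id k) x

/-- The source of the arrows of `X`, as a function on isomorphism classes of objects of the
décalage. -/
def decSrc : isoClasses.obj (Dec X) → lev X 0 :=
  Quot.lift (fun a : lev X 1 => src X a) fun a b ⟨e, _⟩ => by
    have e2 : X.δ (2 : Fin 3) e.edge = a :=
      (ConcreteCategory.congr_hom (src_Dec X) e.edge).symm.trans e.src_eq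
    have e1 : X.δ (1 : Fin 3) e.edge = b :=
      (ConcreteCategory.congr_hom (tgt_Dec X) e.edge).symm.trans e.tgt_eq
    refine (congrArg _ e2).symm.trans (Eq.trans ?_ (congrArg _ e1))
    exact ConcreteCategory.congr_hom (X.δ_comp_δ (n := 0) (i := 1) (j := 1) le_rfl) e.edge

lemma decSrc_naturality {Y : SSet.{u}} (f : X ⟶ Y) (x : isoClasses.obj (Dec X)) :
    decSrc Y (isoClasses.map (dec.functor.map f) x) = onVert f (decSrc X x) := by
  obtain ⟨x, rfl⟩ := isoMk_surjective x
  exact (onVert_src f x).symm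

/-- The isomorphism classes of objects of the décalage of an equivalence relation are the
objects. -/
lemma decSrc_bijective {X : SSet.{u}} (hX : IsEqRel X) : Function.Bijective (decSrc X) := by
  constructor
  · intro x y h
    obtain ⟨x, rfl⟩ := isoMk_surjective x
    obtain ⟨y, rfl⟩ := isoMk_surjective y
    exact Quot.sound (isoRel_Dec hX h)
  · intro x
    refine ⟨isoMk (Dec X) (X.σ (0 : Fin 1) x), ?_⟩
    exact ConcreteCategory.congr_hom (X.δ_comp_σ_succ (i := (0 : Fin 1))) x

/-- The degenerate simplices, as a map from the discrete category on the objects to the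
décalage. -/
def decSection : (Functor.const SimplexCategoryᵒᵖ).obj (lev X 0) ⟶ Dec X where
  app k := X.map (SimplexCategory.const (SimplexCategory.mk (k.unop.len + 1))
    (SimplexCategory.mk 0) 0).op
  naturality k l θ := by
    refine (Category.id_comp _).trans ?_
    exact X.map_comp (SimplexCategory.const (SimplexCategory.mk (k.unop.len + 1))
      (SimplexCategory.mk 0) 0).op (shift.map θ.unop).op

lemma decSection_naturality {Y : SSet.{u}} (f : X ⟶ Y) :
    decSection X ≫ dec.functor.map f =
      (Functor.const SimplexCategoryᵒᵖ).map (f.app (op (SimplexCategory.mk 0))) ≫ decSection Y := by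
  ext k x
  exact NatTrans.naturality_apply f (SimplexCategory.const
    (SimplexCategory.mk (k.unop.len + 1)) (SimplexCategory.mk 0) 0).op x

lemma isIso_isoClasses_decSection {X : SSet.{u}} (hX : IsEqRel X) :
    IsIso (isoClasses.map (decSection X)) := by
  have hs (x : lev X 0) : decSrc X (isoClasses.map (decSection X)
      (isoMk ((Functor.const SimplexCategoryᵒᵖ).obj (lev X 0)) x)) = x := by
    have h : SimplexCategory.δ (1 : Fin 2) ≫ SimplexCategory.const (SimplexCategory.mk 1)
        (SimplexCategory.mk 0) 0 = 𝟙 _ := by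
      ext j
      fin_cases j
      rfl
    change X.map (SimplexCategory.δ (1 : Fin 2)).op (X.map (SimplexCategory.const
      (SimplexCategory.mk 1) (SimplexCategory.mk 0) 0).op x) = x
    rw [← Functor.map_comp_apply, ← op_comp, h]
    exact ConcreteCategory.congr_hom (X.map_id _) x
  rw [isIso_iff_bijective]
  constructor
  · intro x y h
    obtain ⟨x, rfl⟩ := isoMk_surjective x
    obtain ⟨y, rfl⟩ := isoMk_surjective y
    have := congrArg (decSrc X) h
    rw [hs, hs] at this
    rw [this]
  · intro y
    exact ⟨isoMk _ (decSrc X y), (decSrc_bijective hX).1 (hs _)⟩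

end Dec

/-! ### Hereditary pullbacks and multi-dimensional predicates -/

section Multi

lemma isPullback_app {n : ℕ} {D A B E : MSSet.{u} (n + 1)} {fst : D ⟶ A} {snd : D ⟶ B}
    {f : A ⟶ E} {g : B ⟶ E} (h : IsPullback fst snd f g) (k : SimplexCategoryᵒᵖ) :
    IsPullback ((simpMap fst).app k) ((simpMap snd).app k) ((simpMap f).app k)
      ((simpMap g).app k) :=
  IsPullback.app (show IsPullback (simpMap fst) (simpMap snd) (simpMap f) (simpMap g) from h) k

lemma isPullback_of_app {n : ℕ} {D A B E : MSSet.{u} (n + 1)} {fst : D ⟶ A} {snd : D ⟶ B}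
    {f : A ⟶ E} {g : B ⟶ E}
    (h : ∀ k, IsPullback ((simpMap fst).app k) ((simpMap snd).app k) ((simpMap f).app k)
      ((simpMap g).app k)) : IsPullback fst snd f g :=
  show IsPullback (simpMap fst) (simpMap snd) (simpMap f) (simpMap g) from
    IsPullback.of_forall_isPullback_app h

lemma isIso_app {n : ℕ} {X Y : MSSet.{u} (n + 1)} {f : X ⟶ Y} (h : IsIso f)
    (k : SimplexCategoryᵒᵖ) : IsIso ((simpMap f).app k) := by
  have : IsIso (simpMap f) := h
  infer_instance

lemma isIso_of_app {n : ℕ} {X Y : MSSet.{u} (n + 1)} {f : X ⟶ Y}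
    (h : ∀ k, IsIso ((simpMap f).app k)) : IsIso f :=
  NatIso.isIso_of_isIso_app (simpMap f)

/-- A map of pullbacks is invertible if its components are. -/
lemma isIso_of_isPullback {C : Type*} [Category* C] {D A B E D' A' B' E' : C} {fst : D ⟶ A}
    {snd : D ⟶ B} {f : A ⟶ E} {g : B ⟶ E} {fst' : D' ⟶ A'} {snd' : D' ⟶ B'} {f' : A' ⟶ E'}
    {g' : B' ⟶ E'} (h : IsPullback fst snd f g) (h' : IsPullback fst' snd' f' g') {δ : D ⟶ D'}
    {α : A ⟶ A'} {β : B ⟶ B'} {ε : E ⟶ E'} (w1 : δ ≫ fst' = fst ≫ α) (w2 : δ ≫ snd' = snd ≫ β)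
    (w3 : f ≫ ε = α ≫ f') (w4 : g ≫ ε = β ≫ g') (hα : IsIso α) (hβ : IsIso β) (hε : IsIso ε) :
    IsIso δ := by
  have h1 : IsPullback (fst ≫ α) (snd ≫ β) f' g' :=
    h.of_iso (Iso.refl _) (asIso α) (asIso β) (asIso ε) (Category.id_comp _).symm
      (Category.id_comp _).symm w3 w4
  have e : δ = (h1.isoIsPullback _ _ h').hom := by
    apply h'.hom_ext
    · rw [IsPullback.isoIsPullback_hom_fst, w1]
    · rw [IsPullback.isoIsPullback_hom_snd, w2]
  rw [e]
  infer_instance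

/-- A property of simplicial sets, imposed on all the simplicial sets which an `(n+1)`-fold
simplicial set has in the last direction. -/
def Lw (P : SSet.{u} → Prop) : ∀ n : ℕ, MSSet.{u} (n + 1) → Prop
  | 0, X => P X
  | n + 1, X => ∀ k, Lw P n ((simp X).obj k)

lemma Lw.mono {P Q : SSet.{u} → Prop} (h : ∀ X, P X → Q X) :
    ∀ (n : ℕ) {X : MSSet.{u} (n + 1)}, Lw P n X → Lw Q n X
  | 0, _, hX => h _ hX
  | n + 1, _, hX => fun k => Lw.mono h n (hX k)

/-- A map is an isofibration in the last direction. -/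
def LwIsofib : ∀ (n : ℕ) {X Y : MSSet.{u} (n + 1)}, (X ⟶ Y) → Prop
  | 0, _, _, f => IsIsofib f
  | n + 1, _, _, f => ∀ k, LwIsofib n ((simpMap f).app k)

lemma LwIsofib.comp : ∀ (n : ℕ) {X Y Z : MSSet.{u} (n + 1)} {f : X ⟶ Y} {g : Y ⟶ Z},
    LwIsofib n f → LwIsofib n g → LwIsofib n (f ≫ g)
  | 0, _, _, _, _, _, hf, hg => IsIsofib.comp hf hg
  | n + 1, _, _, _, _, _, hf, hg => fun k => LwIsofib.comp n (hf k) (hg k)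

lemma LwIsofib.of_lwConst : ∀ (n : ℕ) {X Y : MSSet.{u} (n + 1)} (f : X ⟶ Y),
    Lw IsConst n Y → LwIsofib n f
  | 0, _, _, f, hY => IsConst.isIsofib hY f
  | n + 1, _, _, f, hY => fun k => LwIsofib.of_lwConst n ((simpMap f).app k) (hY k)

lemma LwIsofib.baseChange : ∀ (n : ℕ) {D A B E : MSSet.{u} (n + 1)} {fst : D ⟶ A} {snd : D ⟶ B}
    {f : A ⟶ E} {g : B ⟶ E}, IsPullback fst snd f g → Lw.{u} IsSegal n A → Lw.{u} IsSegal n B →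
    Lw IsEqRel n E → LwIsofib n g → LwIsofib n fst
  | 0, _, _, _, _, _, _, _, _, h, hA, hB, hE, hg => IsIsofib.baseChange h hA hB hE hg
  | n + 1, _, _, _, _, _, _, _, _, h, hA, hB, hE, hg => fun k =>
    LwIsofib.baseChange n (isPullback_app h k) (hA k) (hB k) (hE k) (hg k)

lemma LwIsofib.pullback : ∀ (n : ℕ) {D A B E D' A' B' E' : MSSet.{u} (n + 1)} {fst : D ⟶ A}
    {snd : D ⟶ B} {f : A ⟶ E} {g : B ⟶ E} {fst' : D' ⟶ A'} {snd' : D' ⟶ B'} {f' : A' ⟶ E'}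
    {g' : B' ⟶ E'} (_ : IsPullback fst snd f g) (_ : IsPullback fst' snd' f' g')
    (_ : Lw.{u} IsSegal n A) (_ : Lw.{u} IsSegal n B) (_ : Lw IsConst n E)
    {δ : D ⟶ D'} {α : A ⟶ A'} {β : B ⟶ B'}
    (_ : δ ≫ fst' = fst ≫ α) (_ : δ ≫ snd' = snd ≫ β)
    (_ : LwIsofib n α) (_ : LwIsofib n β), LwIsofib n δ
  | 0, _, _, _, _, _, _, _, _, _, _, _, _, _, _, _, _, h, h', hA, hB, hE, _, _, _, w1, w2, hα, hβ =>
    isIsofib_pullback h h' hA hB hE w1 w2 hα hβ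
  | n + 1, _, _, _, _, _, _, _, _, _, _, _, _, _, _, _, _, h, h', hA, hB, hE, _, _, _, w1, w2,
      hα, hβ => fun k =>
    LwIsofib.pullback n (isPullback_app h k) (isPullback_app h' k) (hA k) (hB k) (hE k)
      (NatTrans.congr_app w1 k) (NatTrans.congr_app w2 k) (hα k) (hβ k)

lemma p_isPullback : ∀ (n : ℕ) {D A B E : MSSet.{u} (n + 1)} {fst : D ⟶ A} {snd : D ⟶ B}
    {f : A ⟶ E} {g : B ⟶ E}, IsPullback fst snd f g → Lw.{u} IsSegal n A → Lw.{u} IsSegal n B →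
    Lw IsEqRel n E → LwIsofib n g →
    IsPullback ((p n).map fst) ((p n).map snd) ((p n).map f) ((p n).map g)
  | 0, _, _, _, _, _, _, _, _, h, hA, hB, hE, hg => isoClasses_isPullback h hA hB hE hg
  | n + 1, _, _, _, _, _, _, _, _, h, hA, hB, hE, hg => isPullback_of_app fun k =>
    p_isPullback n (isPullback_app h k) (hA k) (hB k) (hE k) (hg k)

/-- A pullback square which is preserved by all the iterated truncations. -/
def HPB : ∀ (n : ℕ) {D A B E : MSSet.{u} n}, (D ⟶ A) → (D ⟶ B) → (A ⟶ E) → (B ⟶ E) → Prop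
  | 0, _, _, _, _, fst, snd, f, g => IsPullback fst snd f g
  | n + 1, _, _, _, _, fst, snd, f, g => IsPullback fst snd f g ∧
      HPB n ((p n).map fst) ((p n).map snd) ((p n).map f) ((p n).map g)

/-- A map which is an isofibration in the last direction, as well as all its truncations. -/
def Fib : ∀ (n : ℕ) {X Y : MSSet.{u} n}, (X ⟶ Y) → Prop
  | 0, _, _, _ => True
  | n + 1, _, _, f => LwIsofib n f ∧ Fib n ((p n).map f)

/-- The iterated truncation `p^{(1)} ⋯ p^{(n)}`. -/
def Ptot : ∀ n : ℕ, MSSet.{u} n ⥤ Type u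
  | 0 => 𝟭 _
  | n + 1 => p n ⋙ Ptot n

/-- Weakly globular `n`-fold categories without the induced Segal condition. That condition turns
out to be automatic. -/
def IsWgp : ∀ n : ℕ, MSSet.{u} n → Prop
  | 0, _ => True
  | 1, X => IsSegal (simp X)
  | n + 2, X => (∀ k, IsWgp (n + 1) ((simp X).obj k)) ∧ IsHd (n + 1) (lev (simp X) 0) ∧
      IsSegal (simp X) ∧ IsWgp (n + 1) ((p (n + 1)).obj X)

lemma IsHd.level : ∀ {n : ℕ} {X : MSSet.{u} (n + 1)}, IsHd (n + 1) X → ∀ k, IsHd n ((simp X).obj k)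
  | 0, _, _, _ => trivial
  | _ + 1, _, h, k => h.1 k.unop.len

lemma IsHd.isSegal : ∀ {n : ℕ} {X : MSSet.{u} (n + 1)}, IsHd (n + 1) X → IsSegal (simp X)
  | 0, _, h => h.1
  | _ + 1, _, h => h.2.1

lemma IsHd.p : ∀ {n : ℕ} {X : MSSet.{u} (n + 1)}, IsHd (n + 1) X → IsHd n ((p n).obj X)
  | 0, _, _ => trivial
  | _ + 1, _, h => h.2.2

lemma IsHd.lw : ∀ {n : ℕ} {X : MSSet.{u} (n + 1)}, IsHd (n + 1) X → Lw IsEqRel n X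
  | 0, _, h => h
  | _ + 1, _, h => fun k => IsHd.lw (h.level k)

lemma IsHd.isWgp : ∀ {n : ℕ} {X : MSSet.{u} n}, IsHd n X → IsWgp n X
  | 0, _, _ => trivial
  | 1, _, h => h.1
  | _ + 2, _, h => ⟨fun k => IsHd.isWgp (h.level k), h.level _, h.isSegal, IsHd.isWgp h.p⟩

lemma IsWgp.level : ∀ {n : ℕ} {X : MSSet.{u} (n + 1)}, IsWgp (n + 1) X →
    ∀ k, IsWgp n ((simp X).obj k)
  | 0, _, _, _ => trivial
  | _ + 1, _, h, k => h.1 k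

lemma IsWgp.zero : ∀ {n : ℕ} {X : MSSet.{u} (n + 1)}, IsWgp (n + 1) X → IsHd n (lev (simp X) 0)
  | 0, _, _ => trivial
  | _ + 1, _, h => h.2.1

lemma IsWgp.isSegal : ∀ {n : ℕ} {X : MSSet.{u} (n + 1)}, IsWgp (n + 1) X → IsSegal (simp X)
  | 0, _, h => h
  | _ + 1, _, h => h.2.2.1

lemma IsWgp.p : ∀ {n : ℕ} {X : MSSet.{u} (n + 1)}, IsWgp (n + 1) X → IsWgp n ((p n).obj X)
  | 0, _, _ => trivial
  | _ + 1, _, h => h.2.2.2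

lemma IsWgp.lw : ∀ {n : ℕ} {X : MSSet.{u} (n + 1)}, IsWgp (n + 1) X → Lw.{u} IsSegal n X
  | 0, _, h => h
  | _ + 1, _, h => fun k => IsWgp.lw (h.level k)

lemma HPB.isPullback : ∀ {n : ℕ} {D A B E : MSSet.{u} n} {fst : D ⟶ A} {snd : D ⟶ B}
    {f : A ⟶ E} {g : B ⟶ E}, HPB n fst snd f g → IsPullback fst snd f g
  | 0, _, _, _, _, _, _, _, _, h => h
  | _ + 1, _, _, _, _, _, _, _, _, h => h.1

lemma HPB.ptot : ∀ {n : ℕ} {D A B E : MSSet.{u} n} {fst : D ⟶ A} {snd : D ⟶ B}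
    {f : A ⟶ E} {g : B ⟶ E}, HPB n fst snd f g →
    IsPullback ((Ptot n).map fst) ((Ptot n).map snd) ((Ptot n).map f) ((Ptot n).map g)
  | 0, _, _, _, _, _, _, _, _, h => h
  | n + 1, _, _, _, _, _, _, _, _, h => HPB.ptot (n := n) h.2

/-- A pullback of `g` over a homotopically discrete object is hereditary if `g` is a
fibration. -/
lemma HPB.of_fib : ∀ {n : ℕ} {D A B E : MSSet.{u} n} {fst : D ⟶ A} {snd : D ⟶ B}
    {f : A ⟶ E} {g : B ⟶ E}, IsPullback fst snd f g → IsWgp n A → IsWgp n B → IsHd n E →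
    Fib n g → HPB n fst snd f g
  | 0, _, _, _, _, _, _, _, _, h, _, _, _, _ => h
  | n + 1, _, _, _, _, _, _, _, _, h, hA, hB, hE, hg =>
    ⟨h, HPB.of_fib (p_isPullback n h hA.lw hB.lw hE.lw hg.1) hA.p hB.p hE.p hg.2⟩

lemma HPB.level : ∀ {n : ℕ} {D A B E : MSSet.{u} (n + 1)} {fst : D ⟶ A} {snd : D ⟶ B}
    {f : A ⟶ E} {g : B ⟶ E}, HPB (n + 1) fst snd f g → ∀ k, HPB n ((simpMap fst).app k)
      ((simpMap snd).app k) ((simpMap f).app k) ((simpMap g).app k)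
  | 0, _, _, _, _, _, _, _, _, h, k => isPullback_app h.1 k
  | n + 1, _, _, _, _, _, _, _, _, h, k => ⟨isPullback_app h.1 k, HPB.level (n := n) h.2 k⟩

lemma HPB.of_level : ∀ {n : ℕ} {D A B E : MSSet.{u} (n + 1)} {fst : D ⟶ A} {snd : D ⟶ B}
    {f : A ⟶ E} {g : B ⟶ E}, (∀ k, HPB n ((simpMap fst).app k)
      ((simpMap snd).app k) ((simpMap f).app k) ((simpMap g).app k)) →
    IsPullback ((Ptot (n + 1)).map fst) ((Ptot (n + 1)).map snd) ((Ptot (n + 1)).map f)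
      ((Ptot (n + 1)).map g) →
    HPB (n + 1) fst snd f g
  | 0, _, _, _, _, _, _, _, _, h, h' => ⟨isPullback_of_app h, h'⟩
  | n + 1, _, _, _, _, _, _, _, _, h, h' =>
    ⟨isPullback_of_app fun k => (h k).1, HPB.of_level (n := n) (fun k => (h k).2) h'⟩

lemma map_w {C D : Type*} [Category* C] [Category* D] (T : C ⥤ D) {X Y Z Y' : C} {f : X ⟶ Y}
    {g : Y ⟶ Z} {f' : X ⟶ Y'} {g' : Y' ⟶ Z} (h : f ≫ g = f' ≫ g') :
    T.map f ≫ T.map g = T.map f' ≫ T.map g' := by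
  rw [← T.map_comp, h, T.map_comp]

lemma HPB.of_iso : ∀ {n : ℕ} {D A B E D' A' B' E' : MSSet.{u} n} {fst : D ⟶ A} {snd : D ⟶ B}
    {f : A ⟶ E} {g : B ⟶ E} {fst' : D' ⟶ A'} {snd' : D' ⟶ B'} {f' : A' ⟶ E'} {g' : B' ⟶ E'}
    (_ : HPB n fst snd f g) (e₁ : D ≅ D') (e₂ : A ≅ A') (e₃ : B ≅ B') (e₄ : E ≅ E')
    (_ : fst ≫ e₂.hom = e₁.hom ≫ fst') (_ : snd ≫ e₃.hom = e₁.hom ≫ snd')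
    (_ : f ≫ e₄.hom = e₂.hom ≫ f') (_ : g ≫ e₄.hom = e₃.hom ≫ g'), HPB n fst' snd' f' g'
  | 0, _, _, _, _, _, _, _, _, _, _, _, _, _, _, _, _, h, e₁, e₂, e₃, e₄, w1, w2, w3, w4 =>
    IsPullback.of_iso h e₁ e₂ e₃ e₄ w1 w2 w3 w4
  | n + 1, _, _, _, _, _, _, _, _, _, _, _, _, _, _, _, _, h, e₁, e₂, e₃, e₄, w1, w2, w3, w4 =>
    ⟨h.1.of_iso e₁ e₂ e₃ e₄ w1 w2 w3 w4, HPB.of_iso h.2 ((p n).mapIso e₁) ((p n).mapIso e₂)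
      ((p n).mapIso e₃) ((p n).mapIso e₄) (map_w (p n) w1) (map_w (p n) w2) (map_w (p n) w3)
      (map_w (p n) w4)⟩

lemma HPB.of_isIso : ∀ {n : ℕ} {D A B E : MSSet.{u} n} {fst : D ⟶ A} {snd : D ⟶ B}
    {f : A ⟶ E} {g : B ⟶ E} (_ : fst ≫ f = snd ≫ g) (_ : IsIso snd) (_ : IsIso f),
    HPB n fst snd f g
  | 0, _, _, _, _, _, _, _, _, w, _, _ => IsPullback.of_vert_isIso ⟨w⟩
  | n + 1, _, _, _, _, _, _, _, _, w, _, _ =>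
    ⟨IsPullback.of_vert_isIso ⟨w⟩, HPB.of_isIso (map_w (p n) w) inferInstance inferInstance⟩

/-- Pullbacks commute with pullbacks: the objects named with `P` are the pullbacks of those named
with `X` and `Y` over those named with `Z`. -/
lemma HPB.cube : ∀ {n : ℕ}
    {DP AP BP CP DX AX BX CX DY AY BY CY DZ AZ BZ CZ : MSSet.{u} n}
    {fstP : DP ⟶ AP} {sndP : DP ⟶ BP} {fP : AP ⟶ CP} {gP : BP ⟶ CP}
    {fstX : DX ⟶ AX} {sndX : DX ⟶ BX} {fX : AX ⟶ CX} {gX : BX ⟶ CX}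
    {fstY : DY ⟶ AY} {sndY : DY ⟶ BY} {fY : AY ⟶ CY} {gY : BY ⟶ CY}
    {fstZ : DZ ⟶ AZ} {sndZ : DZ ⟶ BZ} {fZ : AZ ⟶ CZ} {gZ : BZ ⟶ CZ}
    {dF : DP ⟶ DX} {dS : DP ⟶ DY} {df : DX ⟶ DZ} {dg : DY ⟶ DZ}
    {aF : AP ⟶ AX} {aS : AP ⟶ AY} {af : AX ⟶ AZ} {ag : AY ⟶ AZ}
    {bF : BP ⟶ BX} {bS : BP ⟶ BY} {bf : BX ⟶ BZ} {bg : BY ⟶ BZ}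
    {cF : CP ⟶ CX} {cS : CP ⟶ CY}
    (_ : HPB n fstX sndX fX gX) (_ : HPB n fstY sndY fY gY) (_ : HPB n fstZ sndZ fZ gZ)
    (_ : HPB n dF dS df dg) (_ : HPB n aF aS af ag) (_ : HPB n bF bS bf bg)
    (_ : fstP ≫ fP = sndP ≫ gP)
    (_ : dF ≫ fstX = fstP ≫ aF) (_ : dF ≫ sndX = sndP ≫ bF)
    (_ : dS ≫ fstY = fstP ≫ aS) (_ : dS ≫ sndY = sndP ≫ bS)
    (_ : df ≫ fstZ = fstX ≫ af) (_ : df ≫ sndZ = sndX ≫ bf)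
    (_ : dg ≫ fstZ = fstY ≫ ag) (_ : dg ≫ sndZ = sndY ≫ bg)
    (_ : fP ≫ cF = aF ≫ fX) (_ : gP ≫ cF = bF ≫ gX)
    (_ : fP ≫ cS = aS ≫ fY) (_ : gP ≫ cS = bS ≫ gY), HPB n fstP sndP fP gP := by
  intro n
  induction n with
  | zero =>
    intro DP AP BP CP DX AX BX CX DY AY BY CY DZ AZ BZ CZ fstP sndP fP gP fstX sndX fX gX fstY
      sndY fY gY fstZ sndZ fZ gZ dF dS df dg aF aS af ag bF bS bf bg cF cS hX hY hZ hD hA hB w w1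
      w2 w3 w4 w5 w6 w7 w8 w9 w10 w11 w12
    exact isPullback_cube hX hY hZ hD hA hB w w1 w2 w3 w4 w5 w6 w7 w8 w9 w10 w11 w12
  | succ n ih =>
    intro DP AP BP CP DX AX BX CX DY AY BY CY DZ AZ BZ CZ fstP sndP fP gP fstX sndX fX gX fstY
      sndY fY gY fstZ sndZ fZ gZ dF dS df dg aF aS af ag bF bS bf bg cF cS hX hY hZ hD hA hB w w1
      w2 w3 w4 w5 w6 w7 w8 w9 w10 w11 w12
    exact ⟨isPullback_cube hX.1 hY.1 hZ.1 hD.1 hA.1 hB.1 w w1 w2 w3 w4 w5 w6 w7 w8 w9 w10 w11 w12,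
      ih hX.2 hY.2 hZ.2 hD.2 hA.2 hB.2 (map_w (p n) w) (map_w (p n) w1) (map_w (p n) w2)
        (map_w (p n) w3) (map_w (p n) w4) (map_w (p n) w5) (map_w (p n) w6) (map_w (p n) w7)
        (map_w (p n) w8) (map_w (p n) w9) (map_w (p n) w10) (map_w (p n) w11) (map_w (p n) w12)⟩

lemma HPB.isHd : ∀ {n : ℕ} {D A B E : MSSet.{u} n} {fst : D ⟶ A} {snd : D ⟶ B}
    {f : A ⟶ E} {g : B ⟶ E}, HPB n fst snd f g → IsHd n A → IsHd n B → IsHd n E → IsHd n D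
  | 0, _, _, _, _, _, _, _, _, _, _, _, _ => trivial
  | 1, _, _, _, _, _, _, _, _, h, hA, hB, hE => IsEqRel.pullback h.1 hA hB hE
  | _ + 2, _, _, _, _, _, _, _, _, h, hA, hB, hE =>
    ⟨fun k => HPB.isHd (h.level (op (SimplexCategory.mk k))) (hA.level _) (hB.level _) (hE.level _),
      IsSegal.pullback h.1 hA.isSegal hB.isSegal hE.isSegal, HPB.isHd h.2 hA.p hB.p hE.p⟩

lemma HPB.isWgp : ∀ {n : ℕ} {D A B E : MSSet.{u} n} {fst : D ⟶ A} {snd : D ⟶ B}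
    {f : A ⟶ E} {g : B ⟶ E}, HPB n fst snd f g → IsWgp n A → IsWgp n B → IsHd n E → IsWgp n D
  | 0, _, _, _, _, _, _, _, _, _, _, _, _ => trivial
  | 1, _, _, _, _, _, _, _, _, h, hA, hB, hE => IsSegal.pullback h.1 hA hB hE.1
  | _ + 2, _, _, _, _, _, _, _, _, h, hA, hB, hE =>
    ⟨fun k => HPB.isWgp (h.level k) (hA.level _) (hB.level _) (hE.level _),
      (h.level _).isHd hA.zero hB.zero (hE.level _),
      IsSegal.pullback h.1 hA.isSegal hB.isSegal hE.isSegal, HPB.isWgp h.2 hA.p hB.p hE.p⟩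

lemma IsHd.of_iso {n : ℕ} {X Y : MSSet.{u} n} (e : X ≅ Y) (h : IsHd n X) : IsHd n Y :=
  HPB.isHd (fst := e.inv) (snd := e.inv) (f := 𝟙 X) (g := 𝟙 X)
    (HPB.of_isIso rfl inferInstance inferInstance) h h h

/-- The levels of an isomorphism. -/
def isoLevel {n : ℕ} {X Y : MSSet.{u} (n + 1)} (e : X ≅ Y) (k : SimplexCategoryᵒᵖ) :
    (simp X).obj k ≅ (simp Y).obj k :=
  Iso.app (F := simp X) (G := simp Y) e k

lemma IsWgp.of_iso : ∀ {n : ℕ} {X Y : MSSet.{u} n} (_ : X ≅ Y), IsWgp n X → IsWgp n Y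
  | 0, _, _, _, _ => trivial
  | 1, _, _, e, h => IsSegal.of_iso (X := simp _) e h
  | n + 2, _, _, e, h => ⟨fun k => IsWgp.of_iso (isoLevel e k) (h.level k),
      h.zero.of_iso (isoLevel e _), IsSegal.of_iso (X := simp _) e h.isSegal,
      IsWgp.of_iso ((WG.p (n + 1)).mapIso e) h.p⟩

/-- The Segal squares of a weakly globular object are hereditary pullbacks. -/
lemma IsWgp.segal : ∀ {n : ℕ} {X : MSSet.{u} (n + 1)}, IsWgp (n + 1) X → ∀ m,
    HPB n (initFace (simp X) m) (lastEdge (simp X) m) (lastVertex (simp X) m) (src (simp X))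
  | 0, _, h, m => (isSegal_iff _).1 h m
  | _ + 1, _, h, m => ⟨(isSegal_iff _).1 h.isSegal m, IsWgp.segal h.p m⟩

lemma isSegal_of_HPB {n : ℕ} {X : MSSet.{u} (n + 1)}
    (h : ∀ m, HPB n (initFace (simp X) m) (lastEdge (simp X) m) (lastVertex (simp X) m)
      (src (simp X))) : IsSegal (simp X) :=
  (isSegal_iff _).2 fun m => (h m).isPullback

lemma IsWgp.of_level : ∀ {n : ℕ} {X : MSSet.{u} (n + 1)}, (∀ k, IsWgp n ((simp X).obj k)) →
    IsHd n (lev (simp X) 0) → (∀ m, HPB n (initFace (simp X) m) (lastEdge (simp X) m)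
      (lastVertex (simp X) m) (src (simp X))) → IsWgp (n + 1) X
  | 0, _, _, _, h => isSegal_of_HPB h
  | n + 1, _, h1, h0, h => ⟨h1, h0, isSegal_of_HPB h,
      IsWgp.of_level (n := n) (fun k => (h1 k).p) h0.p fun m => (h m).2⟩

/-- Homotopical discreteness descends from `Y` to a simplicial object `X` of homotopically discrete
objects, because the last condition compares the total truncations of `X` and `Y` in every level. -/
lemma IsHd.of_level : ∀ {n : ℕ} {X Y : MSSet.{u} (n + 1)} (f : X ⟶ Y),
    (∀ k, IsHd n ((simp X).obj k)) →
    (∀ m, HPB n (initFace (simp X) m) (lastEdge (simp X) m)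
      (lastVertex (simp X) m) (src (simp X))) → IsHd (n + 1) Y →
    (∀ k, IsIso ((Ptot n).map ((simpMap f).app k))) → IsHd (n + 1) X
  | 0, _, _, f, _, _, hY, hf => by
    have : IsIso f := isIso_of_app hf
    exact hY.of_iso (asIso f).symm
  | n + 1, _, _, f, h1, h, hY, hf => ⟨fun _ => h1 _, isSegal_of_HPB h,
      IsHd.of_level (n := n) ((WG.p (n + 1)).map f) (fun k => (h1 k).p) (fun m => (h m).2) hY.p hf⟩

lemma Fib.comp : ∀ {n : ℕ} {X Y Z : MSSet.{u} n} {f : X ⟶ Y} {g : Y ⟶ Z}, Fib n f → Fib n g →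
    Fib n (f ≫ g)
  | 0, _, _, _, _, _, _, _ => trivial
  | n + 1, _, _, _, f, g, hf, hg => ⟨hf.1.comp _ hg.1, by
      rw [(p n).map_comp]
      exact hf.2.comp hg.2⟩

lemma Fib.baseChange : ∀ {n : ℕ} {D A B E : MSSet.{u} n} {fst : D ⟶ A} {snd : D ⟶ B}
    {f : A ⟶ E} {g : B ⟶ E}, IsPullback fst snd f g → IsWgp n A → IsWgp n B → IsHd n E →
    Fib n g → Fib n fst
  | 0, _, _, _, _, _, _, _, _, _, _, _, _, _ => trivial
  | n + 1, _, _, _, _, _, _, _, _, h, hA, hB, hE, hg =>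
    ⟨hg.1.baseChange n h hA.lw hB.lw hE.lw, hg.2.baseChange
      (p_isPullback n h hA.lw hB.lw hE.lw hg.1) hA.p hB.p hE.p⟩

lemma isIso_ptot_of_level : ∀ {n : ℕ} {X Y : MSSet.{u} (n + 1)} (f : X ⟶ Y),
    (∀ k, IsIso ((Ptot n).map ((simpMap f).app k))) → IsIso ((Ptot (n + 1)).map f)
  | 0, _, _, f, h => by
    have : IsIso f := isIso_of_app h
    infer_instance
  | n + 1, _, _, f, h => isIso_ptot_of_level (n := n) ((p (n + 1)).map f) h

end Multi

/-! ### Discrete objects -/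

section Discrete

/-- All the structure maps of a multi-simplicial set are invertible. -/
def IsLC : ∀ n : ℕ, MSSet.{u} n → Prop
  | 0, _ => True
  | n + 1, X => (∀ (k l : SimplexCategoryᵒᵖ) (θ : k ⟶ l), IsIso ((simp X).map θ)) ∧
      ∀ k, IsLC n ((simp X).obj k)

lemma IsLC.p : ∀ {n : ℕ} {X : MSSet.{u} (n + 1)}, IsLC (n + 1) X → IsLC n ((p n).obj X)
  | 0, _, _ => trivial
  | n + 1, X, h => ⟨fun k l θ => by
      have := h.1 k l θ
      exact inferInstanceAs (IsIso ((WG.p n).map ((simp X).map θ))), fun k => (h.2 k).p⟩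

lemma IsLC.q : ∀ {n : ℕ} {X : MSSet.{u} (n + 1)}, IsLC (n + 1) X → IsLC n ((q n).obj X)
  | 0, _, _ => trivial
  | n + 1, X, h => ⟨fun k l θ => by
      have := h.1 k l θ
      exact inferInstanceAs (IsIso ((WG.q n).map ((simp X).map θ))), fun k => (h.2 k).q⟩

lemma IsLC.d : ∀ {n : ℕ} {X : MSSet.{u} n}, IsLC n X → IsLC (n + 1) ((d n).obj X)
  | 0, X, _ => ⟨fun k l θ => inferInstanceAs (IsIso (𝟙 X)), fun _ => trivial⟩
  | n + 1, X, h => ⟨fun k l θ => by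
      have := h.1 k l θ
      exact inferInstanceAs (IsIso ((WG.d n).map ((simp X).map θ))), fun k => (h.2 k).d⟩

lemma isLC_discr : ∀ (n : ℕ) (S : Type u), IsLC n ((discr n).obj S)
  | 0, _ => trivial
  | n + 1, S => (isLC_discr n S).d

lemma IsLC.of_iso : ∀ {n : ℕ} {X Y : MSSet.{u} n} (_ : X ≅ Y), IsLC n X → IsLC n Y
  | 0, _, _, _, _ => trivial
  | n + 1, X, Y, e, h => ⟨fun k l θ => by
      have := h.1 k l θ
      have w : (isoLevel e k).hom ≫ (simp Y).map θ = (simp X).map θ ≫ (isoLevel e l).hom :=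
        ((simpMap e.hom).naturality θ).symm
      have : IsIso ((isoLevel e k).hom ≫ (simp Y).map θ) := by
        rw [w]
        infer_instance
      exact IsIso.of_isIso_comp_left (isoLevel e k).hom _, fun k => (h.2 k).of_iso (isoLevel e k)⟩

lemma IsDiscrete.isLC {n : ℕ} {X : MSSet.{u} n} (h : IsDiscrete X) : IsLC n X := by
  obtain ⟨S, ⟨e⟩⟩ := h
  exact (isLC_discr n S).of_iso e.symm

lemma isLC_of_isTerminal : ∀ {n : ℕ} {X : MSSet.{u} n} (_ : IsTerminal X), IsLC n X
  | 0, _, _ => trivial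
  | n + 1, X, h => by
    have ht (k : SimplexCategoryᵒᵖ) : IsTerminal ((simp X).obj k) :=
      IsTerminal.isTerminalObj ((evaluation SimplexCategoryᵒᵖ (MSSet.{u} n)).obj k) (simp X) h
    exact ⟨fun k l θ => isIso_of_isTerminal (ht k) (ht l) _, fun k => isLC_of_isTerminal (ht k)⟩

lemma IsLC.pullback : ∀ {n : ℕ} {D A B E : MSSet.{u} n} {fst : D ⟶ A} {snd : D ⟶ B}
    {f : A ⟶ E} {g : B ⟶ E}, IsPullback fst snd f g → IsLC n A → IsLC n B → IsLC n E → IsLC n D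
  | 0, _, _, _, _, _, _, _, _, _, _, _, _ => trivial
  | _ + 1, _, _, _, _, fst, snd, f, g, h, hA, hB, hE => ⟨fun k l θ =>
      isIso_of_isPullback (isPullback_app h k) (isPullback_app h l) ((simpMap fst).naturality θ)
        ((simpMap snd).naturality θ) ((simpMap f).naturality θ).symm
        ((simpMap g).naturality θ).symm (hA.1 k l θ) (hB.1 k l θ) (hE.1 k l θ),
      fun k => (hA.2 k).pullback (isPullback_app h k) (hB.2 k) (hE.2 k)⟩

lemma IsLC.prod {n : ℕ} {A B : MSSet.{u} n} (hA : IsLC n A) (hB : IsLC n B) : IsLC n (A ⨯ B) :=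
  hA.pullback (IsPullback.of_hasBinaryProduct' A B) hB (isLC_of_isTerminal terminalIsTerminal)

/-- A simplicial set with invertible structure maps is the constant one on its vertices. -/
def IsLC.isoConst {X : SSet.{u}} (h : IsLC 1 X) :
    X ≅ (Functor.const SimplexCategoryᵒᵖ).obj (lev X 0) :=
  NatIso.ofComponents
    (fun k => @asIso _ _ _ _ (X.map (SimplexCategory.const (SimplexCategory.mk 0) k.unop 0).op)
      (h.1 _ _ _))
    (fun {k l} θ => by
      have hs (k : SimplexCategoryᵒᵖ) : IsIso (X.map (SimplexCategory.const k.unop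
        (SimplexCategory.mk 0) 0).op) := h.1 _ _ _
      have hc (k : SimplexCategoryᵒᵖ) : X.map (SimplexCategory.const k.unop
          (SimplexCategory.mk 0) 0).op ≫
          X.map (SimplexCategory.const (SimplexCategory.mk 0) k.unop 0).op = 𝟙 _ := by
        refine (X.map_comp _ _).symm.trans (Eq.trans ?_ (X.map_id _))
        refine congrArg (fun t => X.map (Quiver.Hom.op t)) ?_
        ext i
        exact congrArg Fin.val (Subsingleton.elim (α := Fin 1) _ _)
      have hn : X.map (SimplexCategory.const k.unop (SimplexCategory.mk 0) 0).op ≫ X.map θ =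
          X.map (SimplexCategory.const l.unop (SimplexCategory.mk 0) 0).op := by
        refine (X.map_comp _ _).symm.trans ?_
        exact congrArg (fun t => X.map (Quiver.Hom.op t)) rfl
      have := hs k
      rw [← cancel_epi (X.map (SimplexCategory.const k.unop (SimplexCategory.mk 0) 0).op)]
      change _ ≫ X.map θ ≫ X.map (SimplexCategory.const (SimplexCategory.mk 0) l.unop 0).op =
        _ ≫ X.map (SimplexCategory.const (SimplexCategory.mk 0) k.unop 0).op ≫ 𝟙 _
      rw [reassoc_of% hn, reassoc_of% hc, hc])

lemma IsLC.isConst {X : SSet.{u}} (h : IsLC 1 X) : IsConst X :=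
  (isConst_const _).of_iso h.isoConst.symm

lemma IsLC.lw : ∀ {n : ℕ} {X : MSSet.{u} (n + 1)}, IsLC (n + 1) X → Lw IsConst n X
  | 0, _, h => h.isConst
  | _ + 1, _, h => fun k => (h.2 k).lw

lemma IsLC.isHd : ∀ {n : ℕ} {X : MSSet.{u} n}, IsLC n X → IsHd n X
  | 0, _, _ => trivial
  | 1, _, h => h.isConst.1
  | n + 2, X, h => ⟨fun k => (h.2 _).isHd, (isSegal_iff _).2 fun m => by
      have := h.1 _ _ (SimplexCategory.const (SimplexCategory.mk 0) (SimplexCategory.mk m)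
        (Fin.last m)).op
      have := h.1 _ _ (SimplexCategory.mkOfSucc (Fin.last m)).op
      exact IsPullback.of_vert_isIso ⟨segal_square_comm (simp X) m⟩, h.p.isHd⟩

lemma Fib.of_isLC : ∀ {n : ℕ} {X Y : MSSet.{u} n} (f : X ⟶ Y), IsLC n Y → Fib n f
  | 0, _, _, _, _ => trivial
  | n + 1, _, _, f, h => ⟨LwIsofib.of_lwConst n f h.lw, Fib.of_isLC ((WG.p n).map f) h.p⟩

lemma HPB.of_isLC {n : ℕ} {D A B E : MSSet.{u} n} {fst : D ⟶ A} {snd : D ⟶ B}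
    {f : A ⟶ E} {g : B ⟶ E} (h : IsPullback fst snd f g) (hA : IsWgp n A) (hB : IsWgp n B)
    (hE : IsLC n E) : HPB n fst snd f g :=
  HPB.of_fib h hA hB hE.isHd (Fib.of_isLC g hE)

lemma Fib.pullback : ∀ {n : ℕ} {D A B E D' A' B' E' : MSSet.{u} n} {fst : D ⟶ A}
    {snd : D ⟶ B} {f : A ⟶ E} {g : B ⟶ E} {fst' : D' ⟶ A'} {snd' : D' ⟶ B'} {f' : A' ⟶ E'}
    {g' : B' ⟶ E'} (_ : HPB n fst snd f g) (_ : HPB n fst' snd' f' g')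
    (_ : IsWgp n A) (_ : IsWgp n B) (_ : IsLC n E)
    {δ : D ⟶ D'} {α : A ⟶ A'} {β : B ⟶ B'}
    (_ : δ ≫ fst' = fst ≫ α) (_ : δ ≫ snd' = snd ≫ β)
    (_ : Fib n α) (_ : Fib n β), Fib n δ
  | 0, _, _, _, _, _, _, _, _, _, _, _, _, _, _, _, _, _, _, _, _, _, _, _, _, _, _, _, _ => trivial
  | n + 1, _, _, _, _, _, _, _, _, _, _, _, _, _, _, _, _, h, h', hA, hB, hE, _, _, _, w1, w2,
      hα, hβ =>
    ⟨LwIsofib.pullback n h.1 h'.1 hA.lw hB.lw hE.lw w1 w2 hα.1 hβ.1,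
      Fib.pullback h.2 h'.2 hA.p hB.p hE.p (map_w (WG.p n) w1) (map_w (WG.p n) w2) hα.2 hβ.2⟩

end Discrete

/-! ### Truncation, components and discretization -/

section Transport

lemma isIso_map_iff_of_app {C : Type*} [Category* C] {D : Type*} [Category* D] {F G : C ⥤ D}
    (α : F ⟶ G) {X Y : C} (f : X ⟶ Y) (hX : IsIso (α.app X)) (hY : IsIso (α.app Y)) :
    IsIso (F.map f) ↔ IsIso (G.map f) := by
  constructor
  · intro h
    have : IsIso (α.app X ≫ G.map f) := by
      rw [← α.naturality]
      infer_instance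
    exact IsIso.of_isIso_comp_left (α.app X) _
  · intro h
    have : IsIso (F.map f ≫ α.app Y) := by
      rw [α.naturality]
      infer_instance
    exact IsIso.of_isIso_comp_right _ (α.app Y)

lemma surjective_map_of_app {C : Type*} [Category* C] {F G : C ⥤ Type u}
    (α : F ⟶ G) {X Y : C} (f : X ⟶ Y) (hY : IsIso (α.app Y))
    (hf : Function.Surjective (F.map f)) : Function.Surjective (G.map f) := by
  intro y
  rw [isIso_iff_bijective] at hY
  obtain ⟨y, rfl⟩ := hY.2 y
  obtain ⟨x, rfl⟩ := hf y
  exact ⟨α.app X x, (NatTrans.naturality_apply α f x).symm⟩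

/-- The comparison from the truncation `p^{(n+1)}` to the connected components in the last
direction. -/
def ptoq : ∀ n : ℕ, p.{u} n ⟶ q n
  | 0 => isoToComp
  | n + 1 => levelwiseMap (ptoq n)

lemma isIso_ptoq : ∀ {n : ℕ} {X : MSSet.{u} (n + 1)}, Lw IsEqRel n X → IsIso ((ptoq n).app X)
  | 0, _, h => isIso_isoToComp h
  | n + 1, _, h => isIso_of_app fun k => isIso_ptoq (n := n) (h k)

/-- The components of `ptoq` at homotopically discrete objects. -/
def IsHd.ptoqIso {n : ℕ} {X : MSSet.{u} (n + 1)} (h : IsHd (n + 1) X) :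
    (WG.p n).obj X ≅ (q n).obj X :=
  @asIso _ _ _ _ ((ptoq n).app X) (isIso_ptoq h.lw)

lemma IsHd.q {n : ℕ} {X : MSSet.{u} (n + 1)} (h : IsHd (n + 1) X) : IsHd n ((WG.q n).obj X) :=
  h.p.of_iso h.ptoqIso

lemma HPB.q {n : ℕ} {D A B E : MSSet.{u} (n + 1)} {fst : D ⟶ A} {snd : D ⟶ B} {f : A ⟶ E}
    {g : B ⟶ E} (h : HPB (n + 1) fst snd f g) (hA : IsHd (n + 1) A) (hB : IsHd (n + 1) B)
    (hE : IsHd (n + 1) E) :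
    HPB n ((WG.q n).map fst) ((WG.q n).map snd) ((WG.q n).map f) ((WG.q n).map g) :=
  HPB.of_iso h.2 (h.isHd hA hB hE).ptoqIso hA.ptoqIso hB.ptoqIso hE.ptoqIso
    ((ptoq n).naturality _) ((ptoq n).naturality _) ((ptoq n).naturality _)
    ((ptoq n).naturality _)

lemma HPB.comps : ∀ {n : ℕ} {D A B E : MSSet.{u} n} {fst : D ⟶ A} {snd : D ⟶ B} {f : A ⟶ E}
    {g : B ⟶ E}, HPB n fst snd f g → IsHd n A → IsHd n B → IsHd n E →
    IsPullback ((WG.comps n).map fst) ((WG.comps n).map snd) ((WG.comps n).map f)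
      ((WG.comps n).map g)
  | 0, _, _, _, _, _, _, _, _, h, _, _, _ => h
  | n + 1, _, _, _, _, _, _, _, _, h, hA, hB, hE =>
    HPB.comps (n := n) (h.q hA hB hE) hA.q hB.q hE.q

lemma IsHd.qTwo : ∀ {n : ℕ} {X : MSSet.{u} (n + 1)}, IsHd (n + 1) X →
    IsHd 1 ((WG.qTwo n).obj X)
  | 0, _, h => h
  | n + 1, _, h => IsHd.qTwo (n := n) h.q

lemma HPB.qTwo : ∀ {n : ℕ} {D A B E : MSSet.{u} (n + 1)} {fst : D ⟶ A} {snd : D ⟶ B} {f : A ⟶ E}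
    {g : B ⟶ E}, HPB (n + 1) fst snd f g → IsHd (n + 1) A → IsHd (n + 1) B → IsHd (n + 1) E →
    HPB 1 ((WG.qTwo n).map fst) ((WG.qTwo n).map snd) ((WG.qTwo n).map f)
      ((WG.qTwo n).map g)
  | 0, _, _, _, _, _, _, _, _, h, _, _, _ => h
  | n + 1, _, _, _, _, _, _, _, _, h, hA, hB, hE =>
    HPB.qTwo (n := n) (h.q hA hB hE) hA.q hB.q hE.q

/-- The comparison from the iterated truncation to the connected components. -/
def ptotToComps : ∀ n : ℕ, Ptot.{u} n ⟶ comps n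
  | 0 => 𝟙 _
  | n + 1 => (Functor.whiskerRight (ptoq n) (Ptot n) ≫ Functor.whiskerLeft (q n) (ptotToComps n) :
      p n ⋙ Ptot n ⟶ q n ⋙ comps n)

lemma isIso_ptotToComps : ∀ {n : ℕ} {X : MSSet.{u} n}, IsHd n X → IsIso ((ptotToComps n).app X)
  | 0, X, _ => inferInstanceAs (IsIso (𝟙 X))
  | n + 1, X, h => by
    have := isIso_ptoq h.lw
    have := isIso_ptotToComps h.q
    exact inferInstanceAs (IsIso ((Ptot n).map ((ptoq n).app X) ≫
      (ptotToComps n).app ((q n).obj X)))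

lemma isIso_ptot_iff {n : ℕ} {X Y : MSSet.{u} n} (f : X ⟶ Y) (hX : IsHd n X) (hY : IsHd n Y) :
    IsIso ((Ptot n).map f) ↔ IsIso ((comps n).map f) :=
  isIso_map_iff_of_app (ptotToComps n) f (isIso_ptotToComps hX) (isIso_ptotToComps hY)

lemma isConst_isoMk_injective {X : SSet.{u}} (h : IsConst X) : Function.Injective (isoMk X) :=
  fun _ _ hxy => h.2 _ _ ((isoMk_eq_iff h.1.1).1 hxy)

/-- A set is the set of isomorphism classes of objects of the discrete category on it. -/
def toPConst : 𝟭 (Type u) ⟶ Functor.const SimplexCategoryᵒᵖ ⋙ isoClasses where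
  app S := TypeCat.ofHom fun x => isoMk ((Functor.const SimplexCategoryᵒᵖ).obj S) x

lemma isIso_toPConst (S : Type u) : IsIso (toPConst.app S) := by
  rw [isIso_iff_bijective]
  exact ⟨isConst_isoMk_injective (isConst_const S), isoMk_surjective⟩

/-- The unit `X ⟶ p d X`, an isomorphism. -/
def toPD : ∀ n : ℕ, 𝟭 (MSSet.{u} n) ⟶ d n ⋙ p n
  | 0 => toPConst
  | n + 1 => levelwiseMap (toPD n)

lemma isIso_toPD : ∀ {n : ℕ} (X : MSSet.{u} n), IsIso ((toPD n).app X)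
  | 0, X => isIso_toPConst X
  | n + 1, X => isIso_of_app fun k => isIso_toPD (n := n) ((simp X).obj k)

/-- The isomorphism `X ≅ p d X`. -/
def pdIso {n : ℕ} (X : MSSet.{u} n) : X ≅ (p n).obj ((d n).obj X) :=
  @asIso _ _ _ _ ((toPD n).app X) (isIso_toPD X)

lemma pdIso_naturality {n : ℕ} {X Y : MSSet.{u} n} (f : X ⟶ Y) :
    f ≫ (pdIso Y).hom = (pdIso X).hom ≫ (p n).map ((d n).map f) :=
  (toPD n).naturality f

lemma lw_d : ∀ {n : ℕ} (X : MSSet.{u} n), Lw IsConst n ((d n).obj X)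
  | 0, X => isConst_const X
  | n + 1, X => fun k => lw_d (n := n) ((simp X).obj k)

/-- The map `X ⟶ q d X`, an isomorphism. -/
def toQD (n : ℕ) : 𝟭 (MSSet.{u} n) ⟶ d n ⋙ q n :=
  (toPD n ≫ Functor.whiskerLeft (d n) (ptoq n) : 𝟭 (MSSet.{u} n) ⟶ d n ⋙ q n)

lemma isIso_toQD {n : ℕ} (X : MSSet.{u} n) : IsIso ((toQD n).app X) := by
  have := isIso_toPD X
  have := isIso_ptoq (Lw.mono (fun _ h => h.1) n (lw_d X))
  exact inferInstanceAs (IsIso ((toPD n).app X ≫ (ptoq n).app ((d n).obj X)))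

lemma isIso_map_qd {n : ℕ} {C : Type*} [Category* C] (T : MSSet.{u} n ⥤ C) {X Y : MSSet.{u} n}
    (f : X ⟶ Y) : IsIso (T.map f) ↔ IsIso (T.map ((q n).map ((d n).map f))) := by
  have := isIso_toQD X
  have := isIso_toQD Y
  exact isIso_map_iff_of_app (Functor.whiskerRight (toQD n) T) f
    (inferInstanceAs (IsIso (T.map ((toQD n).app X))))
    (inferInstanceAs (IsIso (T.map ((toQD n).app Y))))

lemma d_isPullback : ∀ {n : ℕ} {D A B E : MSSet.{u} n} {fst : D ⟶ A} {snd : D ⟶ B}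
    {f : A ⟶ E} {g : B ⟶ E}, IsPullback fst snd f g →
    IsPullback ((d n).map fst) ((d n).map snd) ((d n).map f) ((d n).map g)
  | 0, _, _, _, _, _, _, _, _, h => isPullback_of_app fun _ => h
  | n + 1, _, _, _, _, _, _, _, _, h => isPullback_of_app fun k =>
    d_isPullback (n := n) (isPullback_app h k)

lemma HPB.d {n : ℕ} {D A B E : MSSet.{u} n} {fst : D ⟶ A} {snd : D ⟶ B}
    {f : A ⟶ E} {g : B ⟶ E} (h : HPB n fst snd f g) :
    HPB (n + 1) ((d n).map fst) ((WG.d n).map snd) ((WG.d n).map f) ((WG.d n).map g) :=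
  ⟨d_isPullback h.isPullback, h.of_iso (pdIso D) (pdIso A) (pdIso B) (pdIso E)
    (pdIso_naturality _) (pdIso_naturality _) (pdIso_naturality _) (pdIso_naturality _)⟩

lemma IsHd.d : ∀ {n : ℕ} {X : MSSet.{u} n}, IsHd n X → IsHd (n + 1) ((d n).obj X)
  | 0, X, _ => (isConst_const X).1
  | n + 1, X, h => ⟨fun _ => IsHd.d (n := n) (h.level _), (isSegal_iff _).2 fun m =>
      d_isPullback ((isSegal_iff _).1 h.isSegal m), h.of_iso (pdIso X)⟩

lemma isIsofib_of_isIso {X Y : SSet.{u}} (f : X ⟶ Y) (h : IsIso f) : IsIsofib f := by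
  intro x y hxy
  have hinv (z : lev X 0) : onVert (inv f) (onVert f z) = z :=
    ConcreteCategory.congr_hom (NatTrans.congr_app (IsIso.hom_inv_id f) _) z
  refine ⟨onVert (inv f) y, ?_, ConcreteCategory.congr_hom
    (NatTrans.congr_app (IsIso.inv_hom_id f) _) y⟩
  have := isoRel_map (inv f) hxy
  rwa [hinv] at this

lemma lwIsofib_of_isIso : ∀ {n : ℕ} {X Y : MSSet.{u} (n + 1)} (f : X ⟶ Y), IsIso f →
    LwIsofib n f
  | 0, _, _, f, h => isIsofib_of_isIso f h
  | n + 1, _, _, f, h => fun k => lwIsofib_of_isIso (n := n) ((simpMap f).app k) (isIso_app h k)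

lemma Fib.of_isIso : ∀ {n : ℕ} {X Y : MSSet.{u} n} (f : X ⟶ Y), IsIso f → Fib n f
  | 0, _, _, _, _ => trivial
  | n + 1, _, _, f, h => ⟨lwIsofib_of_isIso f h, Fib.of_isIso ((p n).map f) inferInstance⟩

lemma Fib.of_iso {n : ℕ} {X Y X' Y' : MSSet.{u} n} {f : X ⟶ Y} {f' : X' ⟶ Y'} (e : X ≅ X')
    (e' : Y ≅ Y') (w : f ≫ e'.hom = e.hom ≫ f') (h : Fib n f) : Fib n f' := by
  have : f' = e.inv ≫ f ≫ e'.hom := by rw [w, Iso.inv_hom_id_assoc]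
  rw [this]
  exact (Fib.of_isIso _ inferInstance).comp (h.comp (Fib.of_isIso _ inferInstance))

lemma Fib.d {n : ℕ} {X Y : MSSet.{u} n} {f : X ⟶ Y} (h : Fib n f) : Fib (n + 1) ((d n).map f) :=
  ⟨LwIsofib.of_lwConst n _ (lw_d Y), h.of_iso (pdIso X) (pdIso Y) (pdIso_naturality f)⟩

lemma IsHd.dTwo : ∀ {n : ℕ} {X : MSSet.{u} 1}, IsHd 1 X → IsHd (n + 1) ((dTwo n).obj X)
  | 0, _, h => h
  | n + 1, _, h => (IsHd.dTwo (n := n) h).d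

lemma HPB.dTwo : ∀ {n : ℕ} {D A B E : MSSet.{u} 1} {fst : D ⟶ A} {snd : D ⟶ B}
    {f : A ⟶ E} {g : B ⟶ E} (_ : HPB 1 fst snd f g),
    HPB (n + 1) ((dTwo n).map fst) ((WG.dTwo n).map snd) ((WG.dTwo n).map f) ((WG.dTwo n).map g)
  | 0, _, _, _, _, _, _, _, _, h => h
  | n + 1, _, _, _, _, _, _, _, _, h => (HPB.dTwo (n := n) h).d

lemma Fib.dTwo : ∀ {n : ℕ} {X Y : MSSet.{u} 1} {f : X ⟶ Y}, Fib 1 f →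
    Fib (n + 1) ((dTwo n).map f)
  | 0, _, _, _, h => h
  | n + 1, _, _, _, h => (Fib.dTwo (n := n) h).d

lemma surjective_ptot_d {n : ℕ} {X Y : MSSet.{u} n} (f : X ⟶ Y)
    (h : Function.Surjective ((Ptot n).map f)) :
    Function.Surjective ((Ptot (n + 1)).map ((d n).map f)) := by
  have := isIso_toPD Y
  exact surjective_map_of_app (Functor.whiskerRight (toPD n) (Ptot n)) f
    (inferInstanceAs (IsIso ((Ptot n).map ((toPD n).app Y)))) h

lemma surjective_ptot_dTwo : ∀ {n : ℕ} {X Y : MSSet.{u} 1} (f : X ⟶ Y)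
    (_ : Function.Surjective ((Ptot 1).map f)),
    Function.Surjective ((Ptot (n + 1)).map ((dTwo n).map f))
  | 0, _, _, _, h => h
  | n + 1, _, _, f, h => surjective_ptot_d _ (surjective_ptot_dTwo (n := n) f h)

lemma isIso_comps_d {n : ℕ} {X Y : MSSet.{u} n} (f : X ⟶ Y) :
    IsIso ((comps n).map f) ↔ IsIso ((comps (n + 1)).map ((d n).map f)) :=
  isIso_map_qd (comps n) f

lemma isIso_comps_dTwo : ∀ {n : ℕ} {X Y : MSSet.{u} 1} (f : X ⟶ Y),
    IsIso ((comps 1).map f) ↔ IsIso ((comps (n + 1)).map ((dTwo n).map f))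
  | 0, _, _, _ => Iff.rfl
  | n + 1, _, _, f => (isIso_comps_dTwo (n := n) f).trans (isIso_comps_d _)

lemma isIso_comps_iff_qTwo : ∀ {n : ℕ} {X Y : MSSet.{u} (n + 1)} (f : X ⟶ Y),
    IsIso ((comps (n + 1)).map f) ↔ IsIso ((comps 1).map ((qTwo n).map f))
  | 0, _, _, _ => Iff.rfl
  | n + 1, _, _, f => isIso_comps_iff_qTwo (n := n) ((q (n + 1)).map f)

lemma isIso_comps_iff_qTwo_level : ∀ {n : ℕ} {X Y : MSSet.{u} (n + 1)} (f : X ⟶ Y)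
    (k : SimplexCategoryᵒᵖ), IsIso ((comps n).map ((simpMap f).app k)) ↔
      IsIso ((simpMap ((qTwo n).map f)).app k)
  | 0, _, _, _, _ => Iff.rfl
  | n + 1, _, _, f, k => isIso_comps_iff_qTwo_level (n := n) ((q (n + 1)).map f) k

end Transport

section Gamma

lemma π₀_gammaZero {X : SSet.{u}} (x : SSet.π₀Functor.obj X) :
    SSet.π₀Functor.map (gammaZero.app X) x =
      isoToComp.app _ (toPConst.app (SSet.π₀Functor.obj X) x) := by
  obtain ⟨x, rfl⟩ := SSet.π₀.mk_surjective x
  have h : SimplexCategory.const (SimplexCategory.mk 0) (SimplexCategory.mk 0) 0 = 𝟙 _ := by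
    ext j
    exact congrArg Fin.val (Subsingleton.elim (α := Fin 1) _ _)
  have e : X.map (SimplexCategory.const (SimplexCategory.mk 0) (SimplexCategory.mk 0) 0).op x =
      x := by
    rw [h]
    exact ConcreteCategory.congr_hom (X.map_id _) x
  exact congrArg (fun y : lev X 0 => isoToComp.app _ (toPConst.app (SSet.π₀Functor.obj X)
    (SSet.π₀.mk y))) e

/-- One of the triangle identities relating `q^{(n+1)}` and `d^{(n+1)}`. -/
lemma q_gammaStep : ∀ {n : ℕ} (X : MSSet.{u} (n + 1)),
    (q n).map ((gammaStep n).app X) = (toQD n).app ((q n).obj X)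
  | 0, X => ConcreteCategory.hom_ext (C := Type u) _ _ (π₀_gammaZero (X := X))
  | n + 1, X => NatTrans.ext (funext fun k => q_gammaStep (n := n) ((simp X).obj k))

lemma isIso_q_gammaStep {n : ℕ} (X : MSSet.{u} (n + 1)) :
    IsIso ((q n).map ((gammaStep n).app X)) := by
  rw [q_gammaStep]
  exact isIso_toQD _

/-- The discretization map induces a bijection on components. -/
lemma isIso_comps_discMap : ∀ {n : ℕ} (X : MSSet.{u} n), IsIso ((comps n).map (discMap X))
  | 0, X => inferInstanceAs (IsIso (𝟙 X))
  | n + 1, X => by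
    have h1 := isIso_q_gammaStep X
    have h2 := (isIso_comps_d _).1 (isIso_comps_discMap ((q n).obj X))
    have h3 : IsIso ((comps (n + 1)).map ((gammaStep n).app X)) :=
      inferInstanceAs (IsIso ((comps n).map ((q n).map ((gammaStep n).app X))))
    have h4 : IsIso ((comps (n + 1)).map ((gammaStep n).app X) ≫
      (comps (n + 1)).map ((d n).map (discMap ((q n).obj X)))) := IsIso.comp_isIso
    rw [← Functor.map_comp] at h4
    exact h4

lemma isIso_qTwo_gammaTwo : ∀ {n : ℕ} (X : MSSet.{u} (n + 1)),
    IsIso ((qTwo n).map ((gammaTwo n).app X))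
  | 0, X => inferInstanceAs (IsIso (𝟙 X))
  | n + 1, X => by
    have h1 := isIso_q_gammaStep X
    have h2 : IsIso ((qTwo (n + 1)).map ((d (n + 1)).map
        ((gammaTwo n).app ((q (n + 1)).obj X)))) :=
      (isIso_map_qd (qTwo n) _).1 (isIso_qTwo_gammaTwo ((q (n + 1)).obj X))
    have h3 : IsIso ((qTwo (n + 1)).map ((gammaStep (n + 1)).app X)) :=
      inferInstanceAs (IsIso ((qTwo n).map ((q (n + 1)).map ((gammaStep (n + 1)).app X))))
    have h4 : IsIso ((qTwo (n + 1)).map ((gammaStep (n + 1)).app X) ≫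
      (qTwo (n + 1)).map ((d (n + 1)).map ((gammaTwo n).app ((q (n + 1)).obj X)))) :=
      IsIso.comp_isIso
    rw [← Functor.map_comp] at h4
    exact h4

lemma isIso_comps_gammaTwo {n : ℕ} (X : MSSet.{u} (n + 1)) :
    IsIso ((comps (n + 1)).map ((gammaTwo n).app X)) := by
  have := isIso_qTwo_gammaTwo X
  rw [isIso_comps_iff_qTwo]
  infer_instance

lemma isIso_gammaZero {X : SSet.{u}} (h : IsLC 1 X) : IsIso (gammaZero.app X) := by
  have h1 (k : SimplexCategoryᵒᵖ) : IsIso ((gammaZero.app X).app k) := by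
    have h2 := (isIso_iff_bijective _).1
      (h.1 _ _ (SimplexCategory.const (SimplexCategory.mk 0) k.unop 0).op)
    have h3 := (isIso_iff_bijective _).1 (isIso_isoToComp h.isConst.1)
    refine (isIso_iff_bijective _).2 ?_
    exact (h3.comp ⟨isConst_isoMk_injective h.isConst, isoMk_surjective⟩).comp h2
  exact NatIso.isIso_of_isIso_app _

lemma isIso_gammaStep : ∀ {n : ℕ} {X : MSSet.{u} (n + 1)}, IsLC (n + 1) X →
    IsIso ((gammaStep n).app X)
  | 0, _, h => isIso_gammaZero h
  | n + 1, _, h => isIso_of_app fun k => isIso_gammaStep (n := n) (h.2 k)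

/-- The discretization map of a discrete object is invertible. -/
lemma isIso_discMap : ∀ {n : ℕ} {X : MSSet.{u} n}, IsLC n X → IsIso (discMap X)
  | 0, X, _ => inferInstanceAs (IsIso (𝟙 X))
  | n + 1, X, h => by
    have := isIso_gammaStep h
    have := isIso_discMap h.q
    exact inferInstanceAs (IsIso ((gammaStep n).app X ≫ (d n).map (discMap ((q n).obj X))))

end Gamma

/-! ### Equivalences -/

section Points

/-- A set is the set of components of the discrete object on it. -/
def toCD : ∀ n : ℕ, 𝟭 (Type u) ⟶ discr n ⋙ comps n
  | 0 => 𝟙 _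
  | n + 1 => (toCD n ≫ Functor.whiskerRight (Functor.whiskerLeft (discr n) (toQD n)) (comps n) :
      𝟭 (Type u) ⟶ (discr n ⋙ d n ⋙ q n) ⋙ comps n)

lemma isIso_toCD : ∀ (n : ℕ) (S : Type u), IsIso ((toCD n).app S)
  | 0, S => inferInstanceAs (IsIso (𝟙 S))
  | n + 1, S => by
    have := isIso_toCD n S
    have := isIso_toQD ((discr n).obj S)
    exact inferInstanceAs (IsIso ((toCD n).app S ≫
      (comps n).map ((toQD n).app ((discr n).obj S))))

lemma comps_discMap : ∀ {n : ℕ} (X : MSSet.{u} n),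
    (comps n).map (discMap X) = (toCD n).app ((comps n).obj X)
  | 0, X => rfl
  | n + 1, X => by
    have h : (comps (n + 1)).map (discMap X) = (comps n).map ((q n).map ((gammaStep n).app X)) ≫
        (comps n).map ((q n).map ((d n).map (discMap ((q n).obj X)))) :=
      (comps (n + 1)).map_comp ((gammaStep n).app X) ((d n).map (discMap ((q n).obj X)))
    have h2 : (toQD n).app ((q n).obj X) ≫ (q n).map ((d n).map (discMap ((q n).obj X))) =
        discMap ((q n).obj X) ≫ (toQD n).app _ := ((toQD n).naturality _).symm
    refine h.trans ?_
    rw [q_gammaStep, ← Functor.map_comp, h2, Functor.map_comp]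
    exact congrArg (fun t => t ≫ (comps n).map ((toQD n).app _)) (comps_discMap ((q n).obj X))

lemma comps_point (n : ℕ) {S : Type u} (a : S) (x : PUnit.{u + 1}) :
    (comps n).map (point n a) ((toCD n).app PUnit.{u + 1} x) = (toCD n).app S a :=
  (NatTrans.naturality_apply (toCD n) (TypeCat.ofHom fun _ : PUnit.{u + 1} => a) x).symm

end Points

section Homs

variable {n : ℕ}

/-- The inclusion of `X(a,b)` in `X_1`. -/
def homFst (X : MSSet.{u} (n + 1)) (a b : (comps n).obj (lev (simp X) 0)) :
    homObj X a b ⟶ lev (simp X) 1 := pullback.fst _ _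

/-- The map from `X(a,b)` to the point. -/
def homSnd (X : MSSet.{u} (n + 1)) (a b : (comps n).obj (lev (simp X) 0)) :
    homObj X a b ⟶ (discr n).obj PUnit.{u + 1} := pullback.snd _ _

lemma isPullback_hom (X : MSSet.{u} (n + 1)) (a b : (comps n).obj (lev (simp X) 0)) :
    IsPullback (homFst X a b) (homSnd X a b) (endpoints X) (prod.lift (point n a) (point n b)) :=
  IsPullback.of_hasPullback _ _

lemma homObj_hom_ext {X : MSSet.{u} (n + 1)} {a b : (comps n).obj (lev (simp X) 0)}
    {W : MSSet.{u} n} {φ ψ : W ⟶ homObj X a b} (h1 : φ ≫ homFst X a b = ψ ≫ homFst X a b)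
    (h2 : φ ≫ homSnd X a b = ψ ≫ homSnd X a b) : φ = ψ :=
  (isPullback_hom X a b).hom_ext h1 h2

/-- The action of `f : X ⟶ Y` on products `X_0^d × X_0^d`. -/
abbrev mapEnds {X Y : MSSet.{u} (n + 1)} (f : X ⟶ Y) :
    (discr n).obj ((comps n).obj (lev (simp X) 0)) ⨯
        (discr n).obj ((comps n).obj (lev (simp X) 0)) ⟶
      (discr n).obj ((comps n).obj (lev (simp Y) 0)) ⨯
        (discr n).obj ((comps n).obj (lev (simp Y) 0)) :=
  prod.map ((discr n).map ((comps n).map ((simpMap f).app (op (SimplexCategory.mk 0)))))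
      ((discr n).map ((comps n).map ((simpMap f).app (op (SimplexCategory.mk 0)))))

lemma point_mapEnds {X Y : MSSet.{u} (n + 1)} (f : X ⟶ Y)
    {a b : (comps n).obj (lev (simp X) 0)} {a' b' : (comps n).obj (lev (simp Y) 0)}
    (ha : mapObj f a = a') (hb : mapObj f b = b') :
    prod.lift (point n a) (point n b) ≫ mapEnds f =
      𝟙 _ ≫ prod.lift (point n a') (point n b') := by
  subst ha hb
  exact point_naturality _ a b

/-- The map `X(a,b) ⟶ Y(a',b')` induced by a map `f : X ⟶ Y` sending `a` to `a'` and `b` to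
`b'`. -/
def homMap' {X Y : MSSet.{u} (n + 1)} (f : X ⟶ Y)
    {a b : (comps n).obj (lev (simp X) 0)} {a' b' : (comps n).obj (lev (simp Y) 0)}
    (ha : mapObj f a = a') (hb : mapObj f b = b') : homObj X a b ⟶ homObj Y a' b' :=
  pullback.map _ _ _ _ ((simpMap f).app (op (SimplexCategory.mk 1))) (𝟙 _) (mapEnds f)
    (endpoints_naturality f) (point_mapEnds f ha hb)

lemma homMap'_fst {X Y : MSSet.{u} (n + 1)} (f : X ⟶ Y)
    {a b : (comps n).obj (lev (simp X) 0)} {a' b' : (comps n).obj (lev (simp Y) 0)}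
    (ha : mapObj f a = a') (hb : mapObj f b = b') :
    homMap' f ha hb ≫ homFst Y a' b' =
      homFst X a b ≫ (simpMap f).app (op (SimplexCategory.mk 1)) :=
  pullback.lift_fst _ _ _

lemma homMap'_snd {X Y : MSSet.{u} (n + 1)} (f : X ⟶ Y)
    {a b : (comps n).obj (lev (simp X) 0)} {a' b' : (comps n).obj (lev (simp Y) 0)}
    (ha : mapObj f a = a') (hb : mapObj f b = b') :
    homMap' f ha hb ≫ homSnd Y a' b' = homSnd X a b :=
  (pullback.lift_snd _ _ _).trans (Category.comp_id _)

lemma mapObj_comp {X Y Z : MSSet.{u} (n + 1)} (f : X ⟶ Y) (g : Y ⟶ Z)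
    (a : (comps n).obj (lev (simp X) 0)) : mapObj (f ≫ g) a = mapObj g (mapObj f a) :=
  ConcreteCategory.congr_hom ((comps n).map_comp ((simpMap f).app (op (SimplexCategory.mk 0)))
    ((simpMap g).app (op (SimplexCategory.mk 0)))) a

lemma homMap'_comp {X Y Z : MSSet.{u} (n + 1)} (f : X ⟶ Y) (g : Y ⟶ Z)
    {a b : (comps n).obj (lev (simp X) 0)} {a' b' : (comps n).obj (lev (simp Y) 0)}
    {a'' b'' : (comps n).obj (lev (simp Z) 0)}
    (ha : mapObj f a = a') (hb : mapObj f b = b') (ha' : mapObj g a' = a'')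
    (hb' : mapObj g b' = b'') (ha'' : mapObj (f ≫ g) a = a'') (hb'' : mapObj (f ≫ g) b = b'') :
    homMap' f ha hb ≫ homMap' g ha' hb' = homMap' (f ≫ g) ha'' hb'' := by
  apply homObj_hom_ext
  · rw [Category.assoc, homMap'_fst, homMap'_fst, reassoc_of% homMap'_fst]
    rfl
  · rw [Category.assoc, homMap'_snd, homMap'_snd, homMap'_snd]

lemma homMap'_congr {X Y : MSSet.{u} (n + 1)} {f g : X ⟶ Y} (h : f = g)
    {a b : (comps n).obj (lev (simp X) 0)} {a' b' : (comps n).obj (lev (simp Y) 0)}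
    (ha : mapObj f a = a') (hb : mapObj f b = b') (ha' : mapObj g a = a')
    (hb' : mapObj g b = b') : homMap' f ha hb = homMap' g ha' hb' := by
  subst h
  rfl

lemma homMap'_square {X Y Y' Z : MSSet.{u} (n + 1)} {f : X ⟶ Y} {g : Y ⟶ Z} {f' : X ⟶ Y'}
    {g' : Y' ⟶ Z} (w : f ≫ g = f' ≫ g')
    {a b : (comps n).obj (lev (simp X) 0)} {a₁ b₁ : (comps n).obj (lev (simp Y) 0)}
    {a₂ b₂ : (comps n).obj (lev (simp Y') 0)} {a₃ b₃ : (comps n).obj (lev (simp Z) 0)}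
    (ha : mapObj f a = a₁) (hb : mapObj f b = b₁) (ha' : mapObj g a₁ = a₃) (hb' : mapObj g b₁ = b₃)
    (ka : mapObj f' a = a₂) (kb : mapObj f' b = b₂) (ka' : mapObj g' a₂ = a₃)
    (kb' : mapObj g' b₂ = b₃) :
    homMap' f ha hb ≫ homMap' g ha' hb' = homMap' f' ka kb ≫ homMap' g' ka' kb' := by
  have e1 : mapObj (f ≫ g) a = a₃ := by rw [mapObj_comp, ha, ha']
  have e2 : mapObj (f ≫ g) b = b₃ := by rw [mapObj_comp, hb, hb']
  have e3 : mapObj (f' ≫ g') a = a₃ := by rw [mapObj_comp, ka, ka']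
  have e4 : mapObj (f' ≫ g') b = b₃ := by rw [mapObj_comp, kb, kb']
  rw [homMap'_comp f g ha hb ha' hb' e1 e2, homMap'_comp f' g' ka kb ka' kb' e3 e4]
  exact homMap'_congr w _ _ _ _

lemma isLC_ends (X : MSSet.{u} (n + 1)) :
    IsLC n ((discr n).obj ((comps n).obj (lev (simp X) 0)) ⨯
      (discr n).obj ((comps n).obj (lev (simp X) 0))) :=
  (isLC_discr n _).prod (isLC_discr n _)

lemma IsWgp.hom {X : MSSet.{u} (n + 1)} (h : IsWgp (n + 1) X)
    (a b : (comps n).obj (lev (simp X) 0)) :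
    HPB n (homFst X a b) (homSnd X a b) (endpoints X) (prod.lift (point n a) (point n b)) :=
  HPB.of_isLC (isPullback_hom X a b) (h.level _) (isLC_discr n _).isHd.isWgp (isLC_ends X)

lemma IsWgp.homObj {X : MSSet.{u} (n + 1)} (h : IsWgp (n + 1) X)
    (a b : (comps n).obj (lev (simp X) 0)) : IsWgp n (homObj X a b) :=
  (h.hom a b).isWgp (h.level _) (isLC_discr n _).isHd.isWgp (isLC_ends X).isHd

lemma IsHd.homObj {X : MSSet.{u} (n + 1)} (h : IsHd (n + 1) X)
    (a b : (comps n).obj (lev (simp X) 0)) : IsHd n (homObj X a b) :=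
  (h.isWgp.hom a b).isHd (h.level _) (isLC_discr n _).isHd (isLC_ends X).isHd

/-- The category with objects `X_0^d` and arrows `X_1^d` associated to a homotopically discrete
object `X`. -/
abbrev compsCat (X : MSSet.{u} (n + 1)) : SSet.{u} := simp X ⋙ comps n

lemma qTwo_eq : ∀ n : ℕ, qTwo.{u} n = levelwise (n := 0) (comps n)
  | 0 => rfl
  | n + 1 => by
    change q (n + 1) ⋙ qTwo n = _
    rw [qTwo_eq n]
    rfl

lemma IsHd.compsCat {X : MSSet.{u} (n + 1)} (h : IsHd (n + 1) X) : IsEqRel (WG.compsCat X) := by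
  have := h.qTwo
  rw [qTwo_eq] at this
  exact this

lemma comps_endpoints_fst (X : MSSet.{u} (n + 1)) (x : lev (compsCat X) 1) :
    (comps n).map prod.fst ((comps n).map (endpoints X) x) =
      (toCD n).app _ (src (WG.compsCat X) x) := by
  rw [← Functor.map_comp_apply, endpoints, prod.lift_fst, Functor.map_comp_apply, comps_discMap]
  rfl

lemma comps_endpoints_snd (X : MSSet.{u} (n + 1)) (x : lev (compsCat X) 1) :
    (comps n).map prod.snd ((comps n).map (endpoints X) x) =
      (toCD n).app _ (tgt (WG.compsCat X) x) := by
  rw [← Functor.map_comp_apply, endpoints, prod.lift_snd, Functor.map_comp_apply, comps_discMap]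
  rfl

lemma comps_prod_ext {A B : MSSet.{u} n} (hA : IsHd n A) (hB : IsHd n B)
    {x y : (comps n).obj (A ⨯ B)} (h1 : (comps n).map prod.fst x = (comps n).map prod.fst y)
    (h2 : (comps n).map prod.snd x = (comps n).map prod.snd y) : x = y := by
  have ht := isLC_of_isTerminal (n := n) terminalIsTerminal
  have h := (HPB.of_isLC (IsPullback.of_hasBinaryProduct' A B) hA.isWgp hB.isWgp ht).comps hA hB
    ht.isHd
  exact ((Types.isPullback_iff _ _ _ _).1 h).2.1 x y ⟨h1, h2⟩

/-- In the homotopically discrete case the components of `X(a, b)` are exactly the arrows `a ⟶ b` of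
the category of components. -/
lemma IsHd.comps_hom {X : MSSet.{u} (n + 1)} (h : IsHd (n + 1) X)
    (a b : (comps n).obj (lev (simp X) 0)) :
    Function.Injective ((comps n).map (homFst X a b)) ∧
    ∀ x : lev (WG.compsCat X) 1, (∃ y, (comps n).map (homFst X a b) y = x) ↔
      src (WG.compsCat X) x = a ∧ tgt (WG.compsCat X) x = b := by
  have hp := (Types.isPullback_iff _ _ _ _).1
    ((h.isWgp.hom a b).comps (h.level _) (isLC_discr n _).isHd (isLC_ends X).isHd)
  have hi := (isIso_iff_bijective _).1 (isIso_toCD n PUnit.{u + 1})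
  have hj := ((isIso_iff_bijective _).1 (isIso_toCD n ((comps n).obj (lev (simp X) 0)))).1
  have hs (y : (comps n).obj ((discr n).obj PUnit.{u + 1})) :
      y = (toCD n).app PUnit.{u + 1} PUnit.unit := by
    obtain ⟨y, rfl⟩ := hi.2 y
    rfl
  have e1 (y : (comps n).obj ((discr n).obj PUnit.{u + 1})) :
      (comps n).map prod.fst ((comps n).map (prod.lift (point n a) (point n b)) y) =
      (toCD n).app _ a := by
    rw [hs y, ← Functor.map_comp_apply, prod.lift_fst, comps_point]
  have e2 (y : (comps n).obj ((discr n).obj PUnit.{u + 1})) :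
      (comps n).map prod.snd ((comps n).map (prod.lift (point n a) (point n b)) y) =
      (toCD n).app _ b := by
    rw [hs y, ← Functor.map_comp_apply, prod.lift_snd, comps_point]
  refine ⟨fun y y' hy => hp.2.1 y y' ⟨hy, (hs _).trans (hs _).symm⟩, fun x => ⟨?_, ?_⟩⟩
  · rintro ⟨y, rfl⟩
    have hw := ConcreteCategory.congr_hom hp.1 y
    have hw' : (comps n).map (endpoints X) ((comps n).map (homFst X a b) y) =
      (comps n).map (prod.lift (point n a) (point n b)) ((comps n).map (homSnd X a b) y) := hw
    constructor
    · apply hj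
      rw [← comps_endpoints_fst, hw', e1]
    · apply hj
      rw [← comps_endpoints_snd, hw', e2]
  · rintro ⟨ha, hb⟩
    obtain ⟨y, hy, -⟩ := hp.2.2 x ((toCD n).app PUnit.{u + 1} PUnit.unit) (by
      apply comps_prod_ext (isLC_discr n _).isHd (isLC_discr n _).isHd
      · rw [comps_endpoints_fst, e1, ha]
      · rw [comps_endpoints_snd, e2, hb])
    exact ⟨y, hy⟩

end Homs

section Equivalences

lemma isIso_homMap' {n : ℕ} {X Y : MSSet.{u} (n + 1)} (f : X ⟶ Y) (hf : IsIso f)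
    {a b : (comps n).obj (lev (simp X) 0)} {a' b' : (comps n).obj (lev (simp Y) 0)}
    (ha : mapObj f a = a') (hb : mapObj f b = b') : IsIso (homMap' f ha hb) := by
  have h0 := isIso_app hf (op (SimplexCategory.mk 0))
  have h1 := isIso_app hf (op (SimplexCategory.mk 1))
  have h2 : IsIso (mapEnds f) := inferInstance
  exact pullback.map_isIso (endpoints X) (prod.lift (point n a) (point n b)) (endpoints Y)
    (prod.lift (point n a') (point n b')) ((simpMap f).app (op (SimplexCategory.mk 1))) (𝟙 _)
    (mapEnds f) (endpoints_naturality f) (point_mapEnds f ha hb)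

lemma isEquivalence_of_isIso : ∀ {n : ℕ} {X Y : MSSet.{u} n} (f : X ⟶ Y), IsIso f →
    IsEquivalence n f
  | 0, _, _, _, h => h
  | 1, _, _, f, h => @isCatEquiv_of_isIso _ _ f h
  | n + 2, _, _, f, h => ⟨fun _ _ => isEquivalence_of_isIso _ (isIso_homMap' f h rfl rfl),
      isEquivalence_of_isIso ((p (n + 1)).map f) inferInstance⟩

lemma IsEquivalence.hom {n : ℕ} {X Y : MSSet.{u} (n + 2)} {f : X ⟶ Y}
    (h : IsEquivalence (n + 2) f)
    {a b : (comps (n + 1)).obj (lev (simp X) 0)} {a' b' : (comps (n + 1)).obj (lev (simp Y) 0)}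
    (ha : mapObj f a = a') (hb : mapObj f b = b') : IsEquivalence (n + 1) (homMap' f ha hb) := by
  subst ha hb
  exact h.1 a b

lemma IsEquivalence.p : ∀ {n : ℕ} {X Y : MSSet.{u} (n + 1)} {f : X ⟶ Y},
    IsWgp (n + 1) X → IsWgp (n + 1) Y → IsEquivalence (n + 1) f →
    IsEquivalence n ((WG.p n).map f)
  | 0, _, _, _, hX, hY, h => IsCatEquiv.isIso_isoClasses hX hY h
  | _ + 1, _, _, _, _, _, h => h.2

lemma IsEquivalence.isIso_ptot : ∀ {n : ℕ} {X Y : MSSet.{u} n} {f : X ⟶ Y},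
    IsWgp n X → IsWgp n Y → IsEquivalence n f → IsIso ((Ptot n).map f)
  | 0, _, _, _, _, _, h => h
  | n + 1, _, _, _, hX, hY, h => IsEquivalence.isIso_ptot (n := n) hX.p hY.p (h.p hX hY)

lemma IsEquivalence.isIso_comps {n : ℕ} {X Y : MSSet.{u} n} {f : X ⟶ Y}
    (hX : IsHd n X) (hY : IsHd n Y) (h : IsEquivalence n f) : IsIso ((comps n).map f) :=
  (isIso_ptot_iff f hX hY).1 (h.isIso_ptot hX.isWgp hY.isWgp)

lemma IsEquivalence.comp : ∀ {n : ℕ} {X Y Z : MSSet.{u} n} {f : X ⟶ Y} {g : Y ⟶ Z},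
    IsWgp n X → IsWgp n Y → IsWgp n Z → IsEquivalence n f → IsEquivalence n g →
    IsEquivalence n (f ≫ g)
  | 0, _, _, _, f, g, _, _, _, hf, hg => @IsIso.comp_isIso _ _ _ _ _ f g hf hg
  | 1, _, _, _, _, _, _, _, hZ, hf, hg => IsCatEquiv.comp hZ hf hg
  | n + 2, _, _, _, f, g, hX, hY, hZ, hf, hg => ⟨fun a b => by
      have h := IsEquivalence.comp (hX.homObj _ _) (hY.homObj _ _) (hZ.homObj _ _)
        (hf.hom (a := a) (b := b) rfl rfl)
        (hg.hom (mapObj_comp f g a).symm (mapObj_comp f g b).symm)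
      rw [homMap'_comp (ha'' := rfl) (hb'' := rfl)] at h
      exact h, by
      rw [(WG.p (n + 1)).map_comp]
      exact IsEquivalence.comp hX.p hY.p hZ.p hf.2 hg.2⟩

lemma IsEquivalence.of_comp : ∀ {n : ℕ} {X Y Z : MSSet.{u} n} {f : X ⟶ Y} {g : Y ⟶ Z},
    IsWgp n X → IsWgp n Y → IsWgp n Z → IsEquivalence n g → IsEquivalence n (f ≫ g) →
    IsEquivalence n f
  | 0, _, _, _, f, g, _, _, _, hg, hfg => @IsIso.of_isIso_comp_right _ _ _ _ _ f g hg hfg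
  | 1, _, _, _, _, _, _, hY, hZ, hg, hfg => IsCatEquiv.of_comp hY hZ hg hfg
  | n + 2, _, _, _, f, g, hX, hY, hZ, hg, hfg => ⟨fun a b => by
      have h := hfg.hom (a := a) (b := b) rfl rfl
      rw [← homMap'_comp f g rfl rfl (mapObj_comp f g a).symm (mapObj_comp f g b).symm] at h
      exact IsEquivalence.of_comp (hX.homObj _ _) (hY.homObj _ _) (hZ.homObj _ _)
        (hg.hom (mapObj_comp f g a).symm (mapObj_comp f g b).symm) h, by
      have h := hfg.2
      rw [(WG.p (n + 1)).map_comp] at h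
      exact IsEquivalence.of_comp hX.p hY.p hZ.p hg.2 h⟩

/-- A map of homotopically discrete objects is an equivalence if it is bijective on components. -/
lemma isEquivalence_of_isHd : ∀ {n : ℕ} {X Y : MSSet.{u} n} (f : X ⟶ Y),
    IsHd n X → IsHd n Y → IsIso ((comps n).map f) → IsEquivalence n f
  | 0, _, _, _, _, _, h => h
  | 1, _, _, f, hX, hY, h => isCatEquiv_of_isEqRel hX hY ((isIso_ptot_iff f hX hY).2 h)
  | n + 2, X, Y, f, hX, hY, h => by
    refine ⟨fun a b => isEquivalence_of_isHd _ (hX.homObj a b) (hY.homObj _ _) ?_,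
      isEquivalence_of_isHd ((p (n + 1)).map f) hX.p hY.p
        ((isIso_ptot_iff _ hX.p hY.p).1 ((isIso_ptot_iff f hX hY).2 h))⟩
    have hc : IsCatEquiv (Functor.whiskerRight (simpMap f) (comps (n + 1)) :
        compsCat X ⟶ compsCat Y) := by
      refine isCatEquiv_of_isEqRel hX.compsCat hY.compsCat ?_
      have h1 := (isIso_comps_iff_qTwo f).1 h
      rw [qTwo_eq] at h1
      exact (isIso_ptot_iff (n := 1) _ hX.compsCat hY.compsCat).2 h1
    have hX' := hX.comps_hom a b
    have hY' := hY.comps_hom (mapObj f a) (mapObj f b)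
    have hw (x : (comps (n + 1)).obj (homObj X a b)) :
        (comps (n + 1)).map (homFst Y (mapObj f a) (mapObj f b))
          ((comps (n + 1)).map (homMap f a b) x) =
        (comps (n + 1)).map ((simpMap f).app (op (SimplexCategory.mk 1)))
          ((comps (n + 1)).map (homFst X a b) x) := by
      rw [← Functor.map_comp_apply, ← Functor.map_comp_apply]
      exact congrArg (fun t => (comps (n + 1)).map t x) (homMap'_fst f rfl rfl)
    rw [isIso_iff_bijective]
    constructor
    · intro x y _
      have hx := (hX'.2 _).1 ⟨x, rfl⟩
      have hy := (hX'.2 _).1 ⟨y, rfl⟩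
      exact hX'.1 (hX.compsCat.edge_ext (hx.1.trans hy.1.symm) (hx.2.trans hy.2.symm))
    · intro y
      have hy := (hY'.2 _).1 ⟨y, rfl⟩
      obtain ⟨e, he⟩ := (hc.1 a b).2 (SSet.Edge.mk _ hy.1 hy.2)
      obtain ⟨x, hx⟩ := (hX'.2 e.edge).2 ⟨e.src_eq, e.tgt_eq⟩
      refine ⟨x, hY'.1 ((hw x).trans ?_)⟩
      rw [hx]
      exact congrArg SSet.Edge.edge he

lemma isPullback_prod {C : Type*} [Category* C] [HasLimits C] {D A B E : C} {fst : D ⟶ A}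
    {snd : D ⟶ B} {f : A ⟶ E} {g : B ⟶ E} (h : IsPullback fst snd f g) :
    IsPullback (prod.map fst fst) (prod.map snd snd) (prod.map f f) (prod.map g g) := by
  refine IsPullback.mk' ?_ ?_ ?_
  · rw [prod.map_map, prod.map_map, h.w]
  · intro T φ φ' h1 h2
    apply Limits.prod.hom_ext
    · apply h.hom_ext
      · simpa using h1 =≫ prod.fst
      · simpa using h2 =≫ prod.fst
    · apply h.hom_ext
      · simpa using h1 =≫ prod.snd
      · simpa using h2 =≫ prod.snd
  · intro T a b w
    have w1 : (a ≫ prod.fst) ≫ f = (b ≫ prod.fst) ≫ g := by simpa using w =≫ prod.fst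
    have w2 : (a ≫ prod.snd) ≫ f = (b ≫ prod.snd) ≫ g := by simpa using w =≫ prod.snd
    refine ⟨prod.lift (h.lift _ _ w1) (h.lift _ _ w2), ?_, ?_⟩
    · rw [prod.lift_map, h.lift_fst, h.lift_fst]
      exact Limits.prod.hom_ext (prod.lift_fst _ _) (prod.lift_snd _ _)
    · rw [prod.lift_map, h.lift_snd, h.lift_snd]
      exact Limits.prod.hom_ext (prod.lift_fst _ _) (prod.lift_snd _ _)

lemma discr_isPullback : ∀ {n : ℕ} {D A B E : Type u} {fst : D ⟶ A} {snd : D ⟶ B} {f : A ⟶ E}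
    {g : B ⟶ E} (_ : IsPullback fst snd f g), IsPullback ((discr n).map fst) ((discr n).map snd)
      ((discr n).map f) ((discr n).map g)
  | 0, _, _, _, _, _, _, _, _, h => h
  | n + 1, _, _, _, _, _, _, _, _, h => d_isPullback (discr_isPullback (n := n) h)

/-- The objects `X(a,b)` of a hereditary pullback form hereditary pullbacks. -/
lemma HPB.homObj {n : ℕ} {D A B E : MSSet.{u} (n + 1)} {fst : D ⟶ A} {snd : D ⟶ B} {f : A ⟶ E}
    {g : B ⟶ E} (h : HPB (n + 1) fst snd f g) (hA : IsWgp (n + 1) A) (hB : IsWgp (n + 1) B)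
    (hE : IsHd (n + 1) E) {x y : (WG.comps n).obj (lev (simp D) 0)}
    {xA yA : (WG.comps n).obj (lev (simp A) 0)} {xB yB : (WG.comps n).obj (lev (simp B) 0)}
    {xE yE : (WG.comps n).obj (lev (simp E) 0)}
    (hx1 : mapObj fst x = xA) (hy1 : mapObj fst y = yA) (hx2 : mapObj snd x = xB)
    (hy2 : mapObj snd y = yB) (hx3 : mapObj f xA = xE) (hy3 : mapObj f yA = yE)
    (hx4 : mapObj g xB = xE) (hy4 : mapObj g yB = yE) :
    HPB n (homMap' fst hx1 hy1) (homMap' snd hx2 hy2) (homMap' f hx3 hy3) (homMap' g hx4 hy4) := by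
  have hD := h.isWgp hA hB hE
  have hZ := isPullback_prod (discr_isPullback (n := n) ((h.level (op (SimplexCategory.mk 0))).comps
    hA.zero hB.zero (hE.level _)))
  refine HPB.cube (h.level (op (SimplexCategory.mk 1)))
    (HPB.of_isIso (fst := 𝟙 ((discr n).obj PUnit)) (snd := 𝟙 _) (f := 𝟙 _) (g := 𝟙 _) rfl
      inferInstance inferInstance)
    (HPB.of_isLC hZ (isLC_ends A).isHd.isWgp (isLC_ends B).isHd.isWgp (isLC_ends E))
    (hD.hom x y) (hA.hom xA yA) (hB.hom xB yB) (cF := homFst E xE yE) (cS := homSnd E xE yE)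
    (homMap'_square h.isPullback.w _ _ _ _ _ _ _ _)
    (homMap'_fst _ _ _).symm (homMap'_fst _ _ _).symm ?_ ?_ (endpoints_naturality _)
    (endpoints_naturality _) (point_mapEnds _ hx1 hy1) (point_mapEnds _ hx2 hy2)
    (homMap'_fst _ _ _) (homMap'_fst _ _ _) ?_ ?_
  · rw [homMap'_snd, Category.comp_id]
  · rw [homMap'_snd, Category.comp_id]
  · rw [homMap'_snd, Category.comp_id]
  · rw [homMap'_snd, Category.comp_id]

/-- Hereditary pullbacks over homotopically discrete objects are invariant under equivalences. -/
lemma IsEquivalence.pullback : ∀ {n : ℕ} {D A B E D' A' B' E' : MSSet.{u} n} {fst : D ⟶ A}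
    {snd : D ⟶ B} {f : A ⟶ E} {g : B ⟶ E} {fst' : D' ⟶ A'} {snd' : D' ⟶ B'} {f' : A' ⟶ E'}
    {g' : B' ⟶ E'} (_ : HPB n fst snd f g) (_ : HPB n fst' snd' f' g')
    (_ : IsWgp n A) (_ : IsWgp n B) (_ : IsHd n E) (_ : IsWgp n A') (_ : IsWgp n B')
    (_ : IsHd n E') {δ : D ⟶ D'} {α : A ⟶ A'} {β : B ⟶ B'} {ε : E ⟶ E'}
    (_ : δ ≫ fst' = fst ≫ α) (_ : δ ≫ snd' = snd ≫ β) (_ : f ≫ ε = α ≫ f')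
    (_ : g ≫ ε = β ≫ g') (_ : IsEquivalence n α) (_ : IsEquivalence n β)
    (_ : IsEquivalence n ε), IsEquivalence n δ := by
  intro n
  induction n with
  | zero =>
    intro D A B E D' A' B' E' fst snd f g fst' snd' f' g' h h' _ _ _ _ _ _ δ α β ε w1 w2 w3 w4 hα
      hβ hε
    exact isIso_of_isPullback h.isPullback h'.isPullback w1 w2 w3 w4 hα hβ hε
  | succ n ih =>
    intro D A B E D' A' B' E' fst snd f g fst' snd' f' g' h h' hA hB hE hA' hB' hE' δ α β ε w1 w2
      w3 w4 hα hβ hε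
    cases n with
    | zero => exact isCatEquiv_pullback h.1 h'.1 h.2 h'.2 hA' hB' hE hE' w1 w2 w3 w4 hα hβ hε
    | succ n =>
      refine ⟨fun x y => ?_, ih h.2 h'.2 hA.p hB.p hE.p hA'.p hB'.p hE'.p (map_w (WG.p _) w1)
        (map_w (WG.p _) w2) (map_w (WG.p _) w3) (map_w (WG.p _) w4) hα.2 hβ.2 hε.2⟩
      have sq {X Y Y' Z : MSSet.{u} (n + 2)} {f : X ⟶ Y} {g : Y ⟶ Z} {f' : X ⟶ Y'} {g' : Y' ⟶ Z}
          (w : f ≫ g = f' ≫ g') (z : (comps (n + 1)).obj (lev (simp X) 0)) :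
          mapObj g (mapObj f z) = mapObj g' (mapObj f' z) := by
        rw [← mapObj_comp, ← mapObj_comp, w]
      have k1 := sq w1
      have k2 := sq w2
      have k3 := sq h.isPullback.w.symm
      have k4 (z) := (sq w3 (mapObj fst z)).symm
      have k5 (z) : mapObj g' (mapObj β (mapObj snd z)) = mapObj ε (mapObj f (mapObj fst z)) :=
        (sq w4 (mapObj snd z)).symm.trans (congrArg (mapObj ε) (k3 z))
      have hP := h.homObj hA hB hE (x := x) (y := y) rfl rfl rfl rfl rfl rfl (k3 x) (k3 y)
      have hP' := h'.homObj hA' hB' hE' (k1 x) (k1 y) (k2 x) (k2 y) (k4 x) (k4 y) (k5 x) (k5 y)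
      exact ih hP hP' (hA.homObj _ _) (hB.homObj _ _) (hE.homObj _ _) (hA'.homObj _ _)
        (hB'.homObj _ _) (hE'.homObj _ _)
        (homMap'_square w1 rfl rfl (k1 x) (k1 y) rfl rfl rfl rfl)
        (homMap'_square w2 rfl rfl (k2 x) (k2 y) rfl rfl rfl rfl)
        (homMap'_square w3 rfl rfl rfl rfl rfl rfl (k4 x) (k4 y))
        (homMap'_square w4 (k3 x) (k3 y) rfl rfl rfl rfl (k5 x) (k5 y))
        (hα.hom rfl rfl) (hβ.hom rfl rfl) (hε.hom rfl rfl)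

/-- A map which is levelwise an equivalence is an equivalence. -/
lemma isEquivalence_of_level : ∀ {n : ℕ} {X Y : MSSet.{u} (n + 1)} {f : X ⟶ Y}
    (_ : IsWgp (n + 1) X) (_ : IsWgp (n + 1) Y)
    (_ : ∀ k, IsEquivalence n ((simpMap f).app k)), IsEquivalence (n + 1) f
  | 0, _, _, f, _, _, h => @isCatEquiv_of_isIso _ _ f (isIso_of_app h)
  | n + 1, X, Y, f, hX, hY, h => by
    refine ⟨fun a b => ?_, isEquivalence_of_level (n := n) hX.p hY.p fun k =>
      (h k).p (hX.level k) (hY.level k)⟩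
    have h0 : IsIso ((comps (n + 1)).map ((simpMap f).app (op (SimplexCategory.mk 0)))) :=
      (h _).isIso_comps hX.zero hY.zero
    have h1 : IsIso ((discr (n + 1)).map
      ((comps (n + 1)).map ((simpMap f).app (op (SimplexCategory.mk 0))))) := inferInstance
    exact IsEquivalence.pullback (hX.hom a b) (hY.hom _ _) (hX.level _) (isLC_discr _ _).isHd.isWgp
      (isLC_ends X).isHd (hY.level _) (isLC_discr _ _).isHd.isWgp (isLC_ends Y).isHd
      (homMap'_fst f rfl rfl) ((homMap'_snd f rfl rfl).trans (Category.comp_id _).symm)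
      (endpoints_naturality f) (point_mapEnds f rfl rfl) (h _)
      (isEquivalence_of_isIso _ inferInstance) (isEquivalence_of_isIso (mapEnds f) inferInstance)

end Equivalences

section InducedSegal

/-- The discretization map of a homotopically discrete object is an equivalence. -/
lemma isEquivalence_discMap {n : ℕ} {X : MSSet.{u} n} (h : IsHd n X) :
    IsEquivalence n (discMap X) :=
  isEquivalence_of_isHd _ h (isLC_discr n _).isHd (isIso_comps_discMap X)

/-- The induced Segal condition is automatic: the induced Segal maps compare iterated pullbacks
over `X_0` with iterated pullbacks over `X_0^d`. -/
lemma IsWgp.isInducedSegal {n : ℕ} {X : MSSet.{u} (n + 1)} (h : IsWgp (n + 1) X) :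
    IsInducedSegal X := by
  have h0 := isLC_discr n ((comps n).obj (lev (simp X) 0))
  have key (m : ℕ) : IsWgp n (chain (src (simp X) ≫ discMap (lev (simp X) 0))
      (tgt (simp X) ≫ discMap (lev (simp X) 0)) m) ∧
      IsEquivalence n (segalMap (simp X) (discMap (lev (simp X) 0)) m) := by
    induction m with
    | zero =>
      have := isIso_segalMap_zero (simp X) (discMap (lev (simp X) 0))
      exact ⟨(h.level _).of_iso (asIso (segalMap (simp X) (discMap (lev (simp X) 0)) 0)),
        isEquivalence_of_isIso _ this⟩
    | succ m ih =>
      have hc := HPB.of_isLC (isPullback_chain (src (simp X) ≫ discMap (lev (simp X) 0))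
        (tgt (simp X) ≫ discMap (lev (simp X) 0)) m) ih.1 (h.level _) h0
      refine ⟨hc.isWgp ih.1 (h.level _) h0.isHd, ?_⟩
      refine IsEquivalence.pullback (h.segal (m + 1)) hc (h.level _) (h.level _) h.zero ih.1
        (h.level _) h0.isHd (segalMap_init _ _ _) (β := 𝟙 _) ?_ ?_ (Category.id_comp _).symm
        ih.2 (isEquivalence_of_isIso _ inferInstance) (isEquivalence_discMap h.zero)
      · exact (segalMap_pi _ _ _ _).trans (Category.comp_id _).symm
      · rw [← nu_last_tgt, reassoc_of% segalMap_pi, Category.assoc]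
  exact fun m => (key (m + 1)).2

/-- The induced Segal condition can be dropped from the definition of weakly globular `n`-fold
categories. -/
lemma isWg_iff : ∀ {n : ℕ} {X : MSSet.{u} n}, IsWg n X ↔ IsWgp n X
  | 0, _ => Iff.rfl
  | 1, _ => Iff.rfl
  | n + 2, X => by
    constructor
    · intro h
      exact ⟨fun k => isWg_iff.1 (h.1 k.unop.len), h.2.1, h.2.2.1, isWg_iff.1 h.2.2.2.2⟩
    · intro h
      exact ⟨fun k => isWg_iff.2 (h.level _), h.zero, h.isSegal, h.isInducedSegal,
        isWg_iff.2 h.p⟩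

end InducedSegal

/-! ### Restriction along a map of objects -/

section Powers

lemma initFace_codisc_coord {C : Type v} [Category.{u} C] [HasLimits C] (B : C) (m : ℕ)
    (i : Fin (m + 1)) :
    initFace (codisc.obj B) m ≫ coord B (op (SimplexCategory.mk m)) i =
      coord B (op (SimplexCategory.mk (m + 1))) i.castSucc := by
  have e : (SimplexCategory.δ (Fin.last (m + 1))).toOrderHom i = i.castSucc := by
    change (Fin.last (m + 1)).succAbove i = _
    simp
  rw [← e]
  exact codisc_map_coord _ _ _

/-- Powers of an object are obtained by multiplying with one more factor. -/
lemma isPullback_codisc {C : Type v} [Category.{u} C] [HasLimits C] (B : C) (m : ℕ) :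
    IsPullback (initFace (codisc.obj B) m)
      (coord B (op (SimplexCategory.mk (m + 1))) (Fin.last (m + 1)))
      (terminal.from _) (terminal.from _) := by
  refine IsPullback.mk' (terminal.hom_ext _ _) ?_ ?_
  · intro T φ φ' h1 h2
    refine codisc_hom_ext fun i => ?_
    induction i using Fin.lastCases with
    | last => exact h2
    | cast i =>
      have := h1 =≫ coord B (op (SimplexCategory.mk m)) i
      rw [Category.assoc, Category.assoc, initFace_codisc_coord] at this
      exact this
  · intro T a b _
    let c : Fin (m + 1 + 1) → (T ⟶ B) := Fin.lastCases b
        (fun i => a ≫ coord B (op (SimplexCategory.mk m)) i)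
    have c1 : c (Fin.last (m + 1)) = b := Fin.lastCases_last
    have c2 (i : Fin (m + 1)) : c i.castSucc = a ≫ coord B (op (SimplexCategory.mk m)) i :=
      Fin.lastCases_castSucc i
    refine ⟨codiscLift (op (SimplexCategory.mk (m + 1))) c, ?_, ?_⟩
    · refine codisc_hom_ext fun i => ?_
      rw [Category.assoc, initFace_codisc_coord, codiscLift_coord, c2]
    · rw [codiscLift_coord, c1]

variable {n : ℕ}

lemma isLC_terminal : IsLC n (⊤_ (MSSet.{u} n)) := isLC_of_isTerminal terminalIsTerminal

lemma IsHd.codisc {B : MSSet.{u} n} (h : IsHd n B) (k : SimplexCategoryᵒᵖ) :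
    IsHd n ((WG.codisc.obj B).obj k) := by
  have key (m : ℕ) : IsHd n (lev (WG.codisc.obj B) m) := by
    induction m with
    | zero =>
      have := isIso_coord_zero B
      exact h.of_iso (asIso (coord B (op (SimplexCategory.mk 0)) (0 : Fin 1))).symm
    | succ m ih =>
      exact (HPB.of_isLC (isPullback_codisc B m) ih.isWgp h.isWgp isLC_terminal).isHd ih h
        isLC_terminal.isHd
  exact key k.unop.len

lemma HPB.codiscSucc {B : MSSet.{u} n} (h : IsHd n B) (m : ℕ) :
    HPB n (initFace (WG.codisc.obj B) m)
      (coord B (op (SimplexCategory.mk (m + 1))) (Fin.last (m + 1)))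
      (terminal.from _) (terminal.from _) :=
  HPB.of_isLC (isPullback_codisc B m) (h.codisc _).isWgp h.isWgp isLC_terminal

lemma Fib.codisc {B B' : MSSet.{u} n} {f : B' ⟶ B} (h' : IsHd n B') (h : IsHd n B) (hf : Fib n f)
    (k : SimplexCategoryᵒᵖ) : Fib n ((WG.codisc.map f).app k) := by
  have key (m : ℕ) : Fib n ((WG.codisc.map f).app (op (SimplexCategory.mk m))) := by
    induction m with
    | zero =>
      have := isIso_coord_zero B
      have := isIso_coord_zero B'
      exact hf.of_iso (asIso (coord B' (op (SimplexCategory.mk 0)) (0 : Fin 1))).symm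
        (asIso (coord B (op (SimplexCategory.mk 0)) (0 : Fin 1))).symm (by
          rw [Iso.symm_hom, Iso.symm_hom, asIso_inv, asIso_inv, IsIso.eq_inv_comp,
            ← Category.assoc, IsIso.comp_inv_eq]
          exact (codisc_map_app_coord f (op (SimplexCategory.mk 0)) (0 : Fin 1)).symm)
    | succ m ih =>
      exact Fib.pullback (HPB.codiscSucc h' m) (HPB.codiscSucc h m) (h'.codisc _).isWgp h'.isWgp
        isLC_terminal ((WG.codisc.map f).naturality _).symm (codisc_map_app_coord _ _ _) ih hf
  exact key k.unop.len

lemma HPB.codisc {D A B E : MSSet.{u} n} {fst : D ⟶ A} {snd : D ⟶ B} {f : A ⟶ E} {g : B ⟶ E}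
    (h : HPB n fst snd f g) (hA : IsHd n A) (hB : IsHd n B) (hE : IsHd n E)
    (k : SimplexCategoryᵒᵖ) :
    HPB n ((WG.codisc.map fst).app k) ((WG.codisc.map snd).app k) ((WG.codisc.map f).app k)
      ((WG.codisc.map g).app k) := by
  have key (m : ℕ) : HPB n ((WG.codisc.map fst).app (op (SimplexCategory.mk m)))
      ((WG.codisc.map snd).app (op (SimplexCategory.mk m)))
      ((WG.codisc.map f).app (op (SimplexCategory.mk m)))
      ((WG.codisc.map g).app (op (SimplexCategory.mk m))) := by
    have c0 (B : MSSet.{u} n) := isIso_coord_zero B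
    induction m with
    | zero =>
      refine h.of_iso (asIso (coord D (op (SimplexCategory.mk 0)) (0 : Fin 1))).symm
        (asIso (coord A (op (SimplexCategory.mk 0)) (0 : Fin 1))).symm
        (asIso (coord B (op (SimplexCategory.mk 0)) (0 : Fin 1))).symm
        (asIso (coord E (op (SimplexCategory.mk 0)) (0 : Fin 1))).symm ?_ ?_ ?_ ?_ <;>
      · rw [Iso.symm_hom, Iso.symm_hom, asIso_inv, asIso_inv, IsIso.eq_inv_comp,
          ← Category.assoc, IsIso.comp_inv_eq]
        exact (codisc_map_app_coord _ (op (SimplexCategory.mk 0)) (0 : Fin 1)).symm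
    | succ m ih =>
      exact HPB.cube ih h (HPB.of_isIso (fst := 𝟙 (⊤_ (MSSet.{u} n))) (snd := 𝟙 _) (f := 𝟙 _)
        (g := 𝟙 _) rfl inferInstance inferInstance) (HPB.codiscSucc (h.isHd hA hB hE) m)
        (HPB.codiscSucc hA m) (HPB.codiscSucc hB m)
        (NatTrans.congr_app (map_w WG.codisc h.isPullback.w) _)
        ((WG.codisc.map fst).naturality _) ((WG.codisc.map snd).naturality _)
        (codisc_map_app_coord _ _ _).symm (codisc_map_app_coord _ _ _).symm
        (terminal.hom_ext _ _) (terminal.hom_ext _ _) (terminal.hom_ext _ _)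
        (terminal.hom_ext _ _) (cF := initFace (WG.codisc.obj E) m)
        (cS := coord E (op (SimplexCategory.mk (m + 1))) (Fin.last (m + 1)))
        ((WG.codisc.map f).naturality _).symm ((WG.codisc.map g).naturality _).symm
        (codisc_map_app_coord _ _ _) (codisc_map_app_coord _ _ _)
  exact key k.unop.len

lemma HPB.segal_codisc {B : MSSet.{u} n} (h : IsHd n B) (m : ℕ) :
    HPB n (initFace (WG.codisc.obj B) m) (lastEdge (WG.codisc.obj B) m)
      (lastVertex (WG.codisc.obj B) m) (src (WG.codisc.obj B)) := by
  have e : src (WG.codisc.obj B) = initFace (WG.codisc.obj B) 0 := rfl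
  refine HPB.of_fib ((isSegal_iff _).1 (isSegal_codisc B) m) (h.codisc _).isWgp
    (h.codisc _).isWgp (h.codisc _) ?_
  rw [e]
  exact Fib.baseChange (isPullback_codisc B 0) (h.codisc _).isWgp h.isWgp isLC_terminal.isHd
    (Fib.of_isLC _ isLC_terminal)

/-- A functor maps powers to powers. -/
def codiscComparison {C D : Type*} [Category* C] [Category* D] [HasLimits C] [HasLimits D]
    (T : C ⥤ D) (B : C) (k : SimplexCategoryᵒᵖ) :
    T.obj ((codisc.obj B).obj k) ⟶ (codisc.obj (T.obj B)).obj k :=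
  codiscLift k fun i => T.map (coord B k i)

lemma codiscComparison_coord {C D : Type*} [Category* C] [Category* D] [HasLimits C] [HasLimits D]
    (T : C ⥤ D) (B : C) (k : SimplexCategoryᵒᵖ) (i : Fin (k.unop.len + 1)) :
    codiscComparison T B k ≫ coord (T.obj B) k i = T.map (coord B k i) :=
  codiscLift_coord _ _ _

lemma codiscComparison_naturality {C D : Type*} [Category* C] [Category* D] [HasLimits C]
    [HasLimits D] (T : C ⥤ D) {B B' : C} (f : B ⟶ B') (k : SimplexCategoryᵒᵖ) :
    T.map ((codisc.map f).app k) ≫ codiscComparison T B' k =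
      codiscComparison T B k ≫ (codisc.map (T.map f)).app k := by
  refine codisc_hom_ext fun i => ?_
  rw [Category.assoc, Category.assoc, codiscComparison_coord, codisc_map_app_coord,
    ← Functor.map_comp, codisc_map_app_coord, Functor.map_comp, ← Category.assoc,
    codiscComparison_coord]

lemma isTerminal_p : ∀ {n : ℕ} {X : MSSet.{u} (n + 1)} (_ : IsTerminal X),
    Nonempty (IsTerminal ((p n).obj X))
  | 0, X, h => by
    have ht : IsTerminal (lev (simp X) 0) :=
      IsTerminal.isTerminalObj ((evaluation SimplexCategoryᵒᵖ (MSSet.{u} 0)).obj _) (simp X) h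
    have hu := Types.isTerminalEquivUnique (lev (simp X) 0) ht
    exact ⟨(Types.isTerminalEquivUnique (isoClasses.obj X)).symm
      ⟨⟨isoMk X hu.default⟩, fun x => by
        obtain ⟨x, rfl⟩ := isoMk_surjective x
        exact congrArg (isoMk X) (hu.uniq x)⟩⟩
  | n + 1, X, h => by
    have ht (k : SimplexCategoryᵒᵖ) : IsTerminal ((simp X).obj k) :=
      IsTerminal.isTerminalObj ((evaluation SimplexCategoryᵒᵖ (MSSet.{u} (n + 1))).obj k) (simp X) h
    have hp (k : SimplexCategoryᵒᵖ) : IsTerminal ((simp ((p (n + 1)).obj X)).obj k) :=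
      (isTerminal_p (ht k)).some
    exact ⟨IsTerminal.ofUniqueHom (Y := simp ((p (n + 1)).obj X))
      (fun Y => ({ app := fun k => (hp k).from ((simp Y).obj k),
                   naturality := fun _ _ _ => (hp _).hom_ext _ _ } :
        simp Y ⟶ simp ((p (n + 1)).obj X)))
      fun Y m => NatTrans.ext (funext fun k => (hp k).hom_ext _ _)⟩

/-- Truncation preserves powers of homotopically discrete objects. -/
lemma isIso_codiscComparison {B : MSSet.{u} (n + 1)} (h : IsHd (n + 1) B)
    (k : SimplexCategoryᵒᵖ) : IsIso (codiscComparison (p n) B k) := by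
  have key (m : ℕ) : IsIso (codiscComparison (p n) B (op (SimplexCategory.mk m))) := by
    induction m with
    | zero =>
      have := isIso_coord_zero B
      have := isIso_coord_zero ((p n).obj B)
      have h2 : IsIso (codiscComparison (p n) B (op (SimplexCategory.mk 0)) ≫
          coord ((p n).obj B) (op (SimplexCategory.mk 0)) (0 : Fin 1)) := by
        rw [codiscComparison_coord]
        infer_instance
      exact IsIso.of_isIso_comp_right _
        (coord ((p n).obj B) (op (SimplexCategory.mk 0)) (0 : Fin 1))
    | succ m ih =>
      have ht := (isTerminal_p (n := n) terminalIsTerminal).some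
      refine isIso_of_isPullback (HPB.codiscSucc h m).2.isPullback
        (isPullback_codisc ((p n).obj B) m) (β := 𝟙 _) (ε := terminal.from _) ?_ ?_
        (terminal.hom_ext _ _) (terminal.hom_ext _ _) ih inferInstance
        (isIso_of_isTerminal ht terminalIsTerminal _)
      · refine codisc_hom_ext fun i => ?_
        rw [Category.assoc, Category.assoc, initFace_codisc_coord, codiscComparison_coord,
          codiscComparison_coord, ← Functor.map_comp, initFace_codisc_coord]
      · exact (codiscComparison_coord _ _ _ _).trans (Category.comp_id _).symm
  exact key k.unop.len

end Powers

section Cart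

variable {n : ℕ}

/-- The levels of a restriction of `X` along a fibration `X'_0 ⟶ X_0` of homotopically discrete
objects are hereditary pullbacks. -/
lemma IsCart.level {X' X : MSSet.{u} (n + 1)} {π : X' ⟶ X} (hπ : IsCart (simpMap π))
    (hX : IsWgp (n + 1) X) (h0 : IsHd n (lev (simp X') 0))
    (hf : Fib n ((simpMap π).app (op (SimplexCategory.mk 0)))) (k : SimplexCategoryᵒᵖ) :
    HPB n ((simpMap π).app k) ((verts (simp X')).app k) ((verts (simp X)).app k)
      ((codisc.map ((simpMap π).app (op (SimplexCategory.mk 0)))).app k) :=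
  HPB.of_fib (IsPullback.app hπ k) (hX.level k) (h0.codisc k).isWgp (hX.zero.codisc k)
    (hf.codisc h0 hX.zero k)

lemma IsCart.isWgp {X' X : MSSet.{u} (n + 1)} {π : X' ⟶ X} (hπ : IsCart (simpMap π))
    (hX : IsWgp (n + 1) X) (h0 : IsHd n (lev (simp X') 0))
    (hf : Fib n ((simpMap π).app (op (SimplexCategory.mk 0)))) : IsWgp (n + 1) X' := by
  have hl := IsCart.level hπ hX h0 hf
  refine IsWgp.of_level (fun k => (hl k).isWgp (hX.level k) (h0.codisc k).isWgp
    (hX.zero.codisc k)) h0 fun m => ?_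
  exact HPB.cube (hX.segal m) (HPB.segal_codisc h0 m) (HPB.segal_codisc hX.zero m) (hl _) (hl _)
    (hl _) (segal_square_comm _ _)
    ((simpMap π).naturality _).symm ((simpMap π).naturality _).symm
    ((verts (simp X')).naturality _).symm ((verts (simp X')).naturality _).symm
    ((verts (simp X)).naturality _).symm ((verts (simp X)).naturality _).symm
    ((codisc.map ((simpMap π).app (op (SimplexCategory.mk 0)))).naturality _).symm
    ((codisc.map ((simpMap π).app (op (SimplexCategory.mk 0)))).naturality _).symm
    ((simpMap π).naturality _) ((simpMap π).naturality _)
    ((verts (simp X')).naturality _) ((verts (simp X')).naturality _)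

lemma IsCart.p {X' X : MSSet.{u} (n + 2)} {π : X' ⟶ X} (hπ : IsCart (simpMap π))
    (hX : IsWgp (n + 2) X) (h0 : IsHd (n + 1) (lev (simp X') 0))
    (hf : Fib (n + 1) ((simpMap π).app (op (SimplexCategory.mk 0)))) :
    IsCart (simpMap ((WG.p (n + 1)).map π)) := by
  have hl := IsCart.level hπ hX h0 hf
  have hv (Y : MSSet.{u} (n + 2)) (k : SimplexCategoryᵒᵖ) :
      (WG.p n).map ((verts (simp Y)).app k) ≫ codiscComparison (WG.p n) (lev (simp Y) 0) k =
        (verts (simp ((WG.p (n + 1)).obj Y))).app k := by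
    refine codisc_hom_ext fun i => ?_
    rw [Category.assoc, codiscComparison_coord, ← Functor.map_comp]
    exact (congrArg (WG.p n).map (verts_app_coord (simp Y) k i)).trans
      (verts_app_coord (simp ((WG.p (n + 1)).obj Y)) k i).symm
  refine IsPullback.of_forall_isPullback_app fun k => ?_
  have i1 := isIso_codiscComparison h0 k
  have i2 := isIso_codiscComparison hX.zero k
  refine (hl k).2.isPullback.of_iso (Iso.refl _) (Iso.refl _)
    (@asIso _ _ _ _ (codiscComparison (WG.p n) (lev (simp X') 0) k) i1)
    (@asIso _ _ _ _ (codiscComparison (WG.p n) (lev (simp X) 0) k) i2) ?_ ?_ ?_ ?_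
  · exact (Category.comp_id _).trans (Category.id_comp _).symm
  · exact (hv X' k).trans (Category.id_comp _).symm
  · exact (hv X k).trans (Category.id_comp _).symm
  · exact codiscComparison_naturality (WG.p n) ((simpMap π).app (op (SimplexCategory.mk 0))) k

lemma IsCart.fib : ∀ {n : ℕ} {X' X : MSSet.{u} (n + 1)} {π : X' ⟶ X} (_ : IsCart (simpMap π))
    (_ : IsWgp (n + 1) X) (_ : IsHd n (lev (simp X') 0))
    (_ : Fib n ((simpMap π).app (op (SimplexCategory.mk 0))))
    (_ : Function.Surjective ((Ptot n).map ((simpMap π).app (op (SimplexCategory.mk 0))))),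
    Fib (n + 1) π
  | 0, _, _, _, hπ, hX, _, _, hs => ⟨IsCart.isIsofib hπ hX hs, trivial⟩
  | n + 1, _, _, _, hπ, hX, h0, hf, hs => ⟨fun k => (Fib.baseChange (IsPullback.app hπ k)
      (hX.level k) (h0.codisc k).isWgp (hX.zero.codisc k) (hf.codisc h0 hX.zero k)).1,
      IsCart.fib (n := n) (hπ.p hX h0 hf) hX.p h0.p hf.2 hs⟩

lemma IsCart.isHd : ∀ {n : ℕ} {X' X : MSSet.{u} (n + 1)} {π : X' ⟶ X} (_ : IsCart (simpMap π))
    (_ : IsHd (n + 1) X) (_ : IsHd n (lev (simp X') 0))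
    (_ : Fib n ((simpMap π).app (op (SimplexCategory.mk 0)))), IsHd (n + 1) X'
  | 0, _, _, _, hπ, hX, _, _ => IsCart.isEqRel hπ hX
  | n + 1, _, _, _, hπ, hX, h0, hf =>
    ⟨fun k => (IsCart.level hπ hX.isWgp h0 hf (op (SimplexCategory.mk k))).isHd (hX.level _)
        (h0.codisc _) ((hX.level _).codisc _), (IsCart.isWgp hπ hX.isWgp h0 hf).isSegal,
      IsCart.isHd (n := n) (hπ.p hX.isWgp h0 hf) hX.p h0.p hf.2⟩

/-- The discretization map on both factors of `B × B`. -/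
def endsMap (B : MSSet.{u} n) : (codisc.obj B).obj (op (SimplexCategory.mk 1)) ⟶
    (discr n).obj ((comps n).obj B) ⨯ (discr n).obj ((comps n).obj B) :=
  prod.lift (coord B (op (SimplexCategory.mk 1)) (0 : Fin 2) ≫ discMap B)
    (coord B (op (SimplexCategory.mk 1)) (1 : Fin 2) ≫ discMap B)

lemma verts_endsMap (X : MSSet.{u} (n + 1)) :
    (verts (simp X)).app (op (SimplexCategory.mk 1)) ≫ endsMap (lev (simp X) 0) =
      endpoints X := by
  have e1 : SimplexCategory.const (SimplexCategory.mk 0) (SimplexCategory.mk 1) (0 : Fin 2) =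
      SimplexCategory.δ (1 : Fin 2) := by
    ext j
    fin_cases j
    rfl
  have e2 : SimplexCategory.const (SimplexCategory.mk 0) (SimplexCategory.mk 1) (1 : Fin 2) =
      SimplexCategory.δ (0 : Fin 2) := by
    ext j
    fin_cases j
    rfl
  have h1 := verts_app_coord (simp X) (op (SimplexCategory.mk 1)) (0 : Fin 2)
  have h2 := verts_app_coord (simp X) (op (SimplexCategory.mk 1)) (1 : Fin 2)
  change _ = (simp X).map (SimplexCategory.const (SimplexCategory.mk 0) (SimplexCategory.mk 1)
    (0 : Fin 2)).op at h1
  change _ = (simp X).map (SimplexCategory.const (SimplexCategory.mk 0) (SimplexCategory.mk 1)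
    (1 : Fin 2)).op at h2
  rw [e1] at h1
  rw [e2] at h2
  rw [endsMap, endpoints, prod.comp_lift, ← Category.assoc, ← Category.assoc, h1, h2]
  rfl

lemma isEquivalence_endsMap {B : MSSet.{u} n} (h : IsHd n B) : IsEquivalence n (endsMap B) := by
  have hd := isLC_discr n ((comps n).obj B)
  refine isEquivalence_of_isHd _ (h.codisc _) (hd.prod hd).isHd ?_
  have h1 := (HPB.codiscSucc h 0).comps (h.codisc _) h isLC_terminal.isHd
  have h2 := (HPB.of_isLC (IsPullback.of_hasBinaryProduct' ((discr n).obj ((comps n).obj B))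
    ((discr n).obj ((comps n).obj B))) hd.isHd.isWgp hd.isHd.isWgp isLC_terminal).comps hd.isHd
    hd.isHd isLC_terminal.isHd
  have i1 := isIso_comps_discMap B
  have i2 := isIso_coord_zero B
  refine isIso_of_isPullback h1 h2
    (α := (comps n).map (coord B (op (SimplexCategory.mk 0)) (0 : Fin 1) ≫ discMap B))
    (β := (comps n).map (discMap B)) (ε := 𝟙 _) ?_ ?_ ?_ ?_ ?_ i1 inferInstance
  · rw [← Functor.map_comp, ← Functor.map_comp, endsMap, prod.lift_fst, ← Category.assoc,
      initFace_codisc_coord]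
    rfl
  · rw [← Functor.map_comp, ← Functor.map_comp, endsMap, prod.lift_snd]
    rfl
  · rw [Category.comp_id, ← Functor.map_comp]
    exact congrArg _ (terminal.hom_ext _ _)
  · rw [Category.comp_id, ← Functor.map_comp]
    exact congrArg _ (terminal.hom_ext _ _)
  · rw [Functor.map_comp]
    infer_instance

/-- The projection of a restriction along a surjective fibration is an equivalence. -/
lemma IsCart.isEquivalence : ∀ {n : ℕ} {X' X : MSSet.{u} (n + 1)} {π : X' ⟶ X}
    (_ : IsCart (simpMap π)) (_ : IsWgp (n + 1) X) (_ : IsHd n (lev (simp X') 0))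
    (_ : Fib n ((simpMap π).app (op (SimplexCategory.mk 0))))
    (_ : Function.Surjective ((Ptot n).map ((simpMap π).app (op (SimplexCategory.mk 0))))),
    IsEquivalence (n + 1) π
  | 0, _, _, _, hπ, _, _, _, hs => IsCart.isCatEquiv hπ hs
  | n + 1, X', X, π, hπ, hX, h0, hf, hs => by
    refine ⟨fun a b => ?_, IsCart.isEquivalence (n := n) (hπ.p hX h0 hf) hX.p h0.p hf.2 hs⟩
    have hX' := IsCart.isWgp hπ hX h0 hf
    have hl := IsCart.level hπ hX h0 hf (op (SimplexCategory.mk 1))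
    -- the arrows of `X` with lifts of the components of their ends to `X'`
    have hS := IsPullback.of_hasPullback (endpoints X) (mapEnds π)
    have hS' := HPB.of_isLC hS (hX.level _) (isLC_ends X').isHd.isWgp (isLC_ends X)
    have hSw := hS'.isWgp (hX.level _) (isLC_ends X').isHd.isWgp (isLC_ends X).isHd
    let σ : lev (simp X') 1 ⟶ pullback (endpoints X) (mapEnds π) :=
      pullback.lift ((simpMap π).app (op (SimplexCategory.mk 1))) (endpoints X')
        (endpoints_naturality π).symm
    have hσ1 : σ ≫ pullback.fst _ _ = (simpMap π).app (op (SimplexCategory.mk 1)) :=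
      pullback.lift_fst _ _ _
    have hσ2 : σ ≫ pullback.snd _ _ = endpoints X' := pullback.lift_snd _ _ _
    have hσ : IsEquivalence (n + 1) σ := by
      refine IsEquivalence.pullback hl hS' (hX.level _) (h0.codisc _).isWgp (hX.zero.codisc _)
        (hX.level _) (isLC_ends X').isHd.isWgp (isLC_ends X).isHd (α := 𝟙 _)
        (hσ1.trans (Category.comp_id _).symm) (hσ2.trans (verts_endsMap X').symm)
        ((verts_endsMap X).trans (Category.id_comp _).symm) ?_
        (isEquivalence_of_isIso _ inferInstance) (isEquivalence_endsMap h0)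
        (isEquivalence_endsMap hX.zero)
      have hg := (gamma (n + 1)).naturality ((simpMap π).app (op (SimplexCategory.mk 0)))
      change (simpMap π).app (op (SimplexCategory.mk 0)) ≫ discMap _ = discMap _ ≫
        (discr (n + 1)).map ((comps (n + 1)).map ((simpMap π).app (op (SimplexCategory.mk 0))))
        at hg
      have hc (i : Fin 2) := codisc_map_app_coord ((simpMap π).app (op (SimplexCategory.mk 0)))
        (op (SimplexCategory.mk 1)) i
      rw [endsMap, endsMap, prod.lift_map, prod.comp_lift, Category.assoc, Category.assoc, ← hg,
        ← Category.assoc, ← Category.assoc, hc 0, hc 1, Category.assoc, Category.assoc]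
    let τ : homObj X (mapObj π a) (mapObj π b) ⟶ pullback (endpoints X) (mapEnds π) :=
      pullback.lift (homFst X _ _)
        (homSnd X _ _ ≫ prod.lift (point (n + 1) a) (point (n + 1) b)) (by
        rw [Category.assoc, point_mapEnds π rfl rfl, Category.id_comp]
        exact (isPullback_hom X _ _).w)
    have hτ1 : τ ≫ pullback.fst _ _ = homFst X _ _ := pullback.lift_fst _ _ _
    have hτ2 : τ ≫ pullback.snd _ _ =
        homSnd X _ _ ≫ prod.lift (point (n + 1) a) (point (n + 1) b) :=
      pullback.lift_snd _ _ _
    have hτ : IsPullback τ (homSnd X (mapObj π a) (mapObj π b)) (pullback.snd _ _)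
        (prod.lift (point (n + 1) a) (point (n + 1) b)) := by
      refine (IsPullback.of_bot (h₁₁ := homSnd X _ _) (v₁₁ := τ) (v₁₂ := prod.lift (point (n + 1) a)
        (point (n + 1) b)) (h₂₁ := pullback.snd _ _) ?_ hτ2.symm hS.flip).flip
      rw [hτ1, point_mapEnds π rfl rfl, Category.id_comp]
      exact (isPullback_hom X _ _).flip
    have hpt := (isLC_discr (n + 1) PUnit.{u + 1}).isHd.isWgp
    refine IsEquivalence.pullback (hX'.hom a b) (HPB.of_isLC hτ hSw hpt (isLC_ends X'))
      (hX'.level _) hpt (isLC_ends X').isHd hSw hpt (isLC_ends X').isHd (β := 𝟙 _) (ε := 𝟙 _)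
      ?_ ((homMap'_snd π rfl rfl).trans (Category.comp_id _).symm)
      ((Category.comp_id _).trans hσ2.symm) ((Category.comp_id _).trans (Category.id_comp _).symm)
      hσ (isEquivalence_of_isIso _ inferInstance) (isEquivalence_of_isIso _ inferInstance)
    apply pullback.hom_ext
    · rw [Category.assoc, Category.assoc, hτ1, hσ1]
      exact homMap'_fst π rfl rfl
    · rw [Category.assoc, Category.assoc, hτ2, hσ2, ← Category.assoc]
      exact (congrArg (fun t => t ≫ _) (homMap'_snd π rfl rfl)).trans (isPullback_hom X' a b).w.symm

/-- Restrictions of the corners of a hereditary pullback along maps forming a hereditary pullback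
of objects of objects form a hereditary pullback. -/
lemma IsCart.HPB {D A B E D' A' B' E' : MSSet.{u} (n + 1)} {fst : D ⟶ A} {snd : D ⟶ B}
    {f : A ⟶ E} {g : B ⟶ E} {fst' : D' ⟶ A'} {snd' : D' ⟶ B'} {f' : A' ⟶ E'} {g' : B' ⟶ E'}
    {πD : D' ⟶ D} {πA : A' ⟶ A} {πB : B' ⟶ B} {πE : E' ⟶ E}
    (h : HPB (n + 1) fst snd f g) (w : fst' ≫ f' = snd' ≫ g')
    (h0 : WG.HPB n ((simpMap fst').app (op (SimplexCategory.mk 0)))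
      ((simpMap snd').app (op (SimplexCategory.mk 0)))
      ((simpMap f').app (op (SimplexCategory.mk 0)))
      ((simpMap g').app (op (SimplexCategory.mk 0))))
    (w1 : πD ≫ fst = fst' ≫ πA) (w2 : πD ≫ snd = snd' ≫ πB) (w3 : f' ≫ πE = πA ≫ f)
    (w4 : g' ≫ πE = πB ≫ g)
    (cD : IsCart (simpMap πD)) (cA : IsCart (simpMap πA)) (cB : IsCart (simpMap πB))
    (hD : IsWgp (n + 1) D) (hA : IsWgp (n + 1) A) (hB : IsWgp (n + 1) B) (hE : IsWgp (n + 1) E)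
    (hD0 : IsHd n (lev (simp D') 0)) (hA0 : IsHd n (lev (simp A') 0))
    (hB0 : IsHd n (lev (simp B') 0)) (hE0 : IsHd n (lev (simp E') 0))
    (fD : Fib n ((simpMap πD).app (op (SimplexCategory.mk 0))))
    (fA : Fib n ((simpMap πA).app (op (SimplexCategory.mk 0))))
    (fB : Fib n ((simpMap πB).app (op (SimplexCategory.mk 0))))
    (iD : IsIso ((Ptot (n + 1)).map πD)) (iA : IsIso ((Ptot (n + 1)).map πA))
    (iB : IsIso ((Ptot (n + 1)).map πB)) (iE : IsIso ((Ptot (n + 1)).map πE)) :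
    WG.HPB (n + 1) fst' snd' f' g' := by
  refine HPB.of_level (fun k => ?_) ?_
  · have z {X Y Z Z' : MSSet.{u} (n + 1)} {f : X ⟶ Y} {g : Y ⟶ Z} {f' : X ⟶ Z'} {g' : Z' ⟶ Z}
        (w : f ≫ g = f' ≫ g') (l : SimplexCategoryᵒᵖ) : (simpMap f).app l ≫ (simpMap g).app l =
          (simpMap f').app l ≫ (simpMap g').app l := NatTrans.congr_app w l
    have z' {X Y Z Z' : MSSet.{u} (n + 1)} {f : X ⟶ Y} {g : Y ⟶ Z} {f' : X ⟶ Z'} {g' : Z' ⟶ Z}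
        (w : f ≫ g = f' ≫ g') : (codisc.map ((simpMap f).app (op (SimplexCategory.mk 0)))).app k ≫
          (codisc.map ((simpMap g).app (op (SimplexCategory.mk 0)))).app k =
          (codisc.map ((simpMap f').app (op (SimplexCategory.mk 0)))).app k ≫
          (codisc.map ((simpMap g').app (op (SimplexCategory.mk 0)))).app k :=
      NatTrans.congr_app (map_w codisc (z w (op (SimplexCategory.mk 0)))) k
    have v {X Y : MSSet.{u} (n + 1)} (f : X ⟶ Y) : (verts (simp X)).app k ≫
        (codisc.map ((simpMap f).app (op (SimplexCategory.mk 0)))).app k =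
        (simpMap f).app k ≫ (verts (simp Y)).app k :=
      NatTrans.congr_app (vertices.naturality (simpMap f)).symm k
    exact HPB.cube (h.level k) (h0.codisc hA0 hB0 hE0 k)
      ((h.level _).codisc hA.zero hB.zero hE.zero k)
      (IsCart.level cD hD hD0 fD k) (IsCart.level cA hA hA0 fA k) (IsCart.level cB hB hB0 fB k)
      (z w k) (z w1 k) (z w2 k) (v fst') (v snd') (v fst) (v snd) (z' w1) (z' w2) (z w3 k)
      (z w4 k) (v f').symm (v g').symm
  · exact h.ptot.of_iso (@asIso _ _ _ _ _ iD).symm (@asIso _ _ _ _ _ iA).symm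
      (@asIso _ _ _ _ _ iB).symm (@asIso _ _ _ _ _ iE).symm (by
        rw [Iso.symm_hom, Iso.symm_hom, asIso_inv, asIso_inv, IsIso.eq_inv_comp, ← Category.assoc,
          IsIso.comp_inv_eq]
        exact map_w _ w1) (by
        rw [Iso.symm_hom, Iso.symm_hom, asIso_inv, asIso_inv, IsIso.eq_inv_comp, ← Category.assoc,
          IsIso.comp_inv_eq]
        exact map_w _ w2) (by
        rw [Iso.symm_hom, Iso.symm_hom, asIso_inv, asIso_inv, IsIso.eq_inv_comp, ← Category.assoc,
          IsIso.comp_inv_eq]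
        exact (map_w _ w3).symm) (by
        rw [Iso.symm_hom, Iso.symm_hom, asIso_inv, asIso_inv, IsIso.eq_inv_comp, ← Category.assoc,
          IsIso.comp_inv_eq]
        exact (map_w _ w4).symm)

end Cart

/-! ### Resolutions of homotopically discrete objects -/

section Resolution

variable {n : ℕ}

/-- An endofunctor with a natural map to the identity which, on homotopically discrete objects,
is a fibration that is surjective on components, and which is compatible with hereditary
pullbacks of homotopically discrete objects. -/
structure IsResolving (V : Augmented (MSSet.{u} n)) : Prop where
  isHd : ∀ {X}, IsHd n X → IsHd n (V.functor.obj X)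
  fib : ∀ {X}, IsHd n X → Fib n (V.map.app X)
  surjective : ∀ {X}, IsHd n X → Function.Surjective ((Ptot n).map (V.map.app X))
  hpb : ∀ {D A B E} {fst : D ⟶ A} {snd : D ⟶ B} {f : A ⟶ E} {g : B ⟶ E}, HPB n fst snd f g →
    IsHd n A → IsHd n B → IsHd n E →
    HPB n (V.functor.map fst) (V.functor.map snd) (V.functor.map f) (V.functor.map g)

/-- Restriction along the maps `V X_0 ⟶ X_0`, for `(n+1)`-fold simplicial sets. -/
abbrev objRestrict (V : Augmented (MSSet.{u} n)) : Augmented (MSSet.{u} (n + 1)) := restrict V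

/-- The objects of a restriction. -/
def objRestrictZero (V : Augmented (MSSet.{u} n)) (X : MSSet.{u} (n + 1)) :
    lev (simp ((objRestrict V).functor.obj X)) 0 ≅ V.functor.obj (lev (simp X) 0) :=
  asIso (restrictZero V (simp X))

lemma objRestrictZero_map (V : Augmented (MSSet.{u} n)) (X : MSSet.{u} (n + 1)) :
    (objRestrictZero V X).hom ≫ V.map.app (lev (simp X) 0) =
      (simpMap ((objRestrict V).map.app X)).app (op (SimplexCategory.mk 0)) :=
  restrictZero_map V (simp X)

lemma objRestrictZero_naturality (V : Augmented (MSSet.{u} n)) {X Y : MSSet.{u} (n + 1)}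
    (f : X ⟶ Y) :
    (simpMap ((objRestrict V).functor.map f)).app (op (SimplexCategory.mk 0)) ≫
      (objRestrictZero V Y).hom = (objRestrictZero V X).hom ≫
        V.functor.map ((simpMap f).app (op (SimplexCategory.mk 0))) :=
  restrictZero_naturality V (simpMap f)

namespace IsResolving

variable {V : Augmented (MSSet.{u} n)} {X : MSSet.{u} (n + 1)}

lemma isHd_zero (hV : IsResolving V) (h : IsHd n (lev (simp X) 0)) :
    IsHd n (lev (simp ((objRestrict V).functor.obj X)) 0) :=
  (hV.isHd h).of_iso (objRestrictZero V X).symm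

lemma fib_zero (hV : IsResolving V) (h : IsHd n (lev (simp X) 0)) :
    Fib n ((simpMap ((objRestrict V).map.app X)).app (op (SimplexCategory.mk 0))) := by
  rw [← objRestrictZero_map]
  exact (Fib.of_isIso _ inferInstance).comp (hV.fib h)

lemma surjective_zero (hV : IsResolving V) (h : IsHd n (lev (simp X) 0)) :
    Function.Surjective ((Ptot n).map
      ((simpMap ((objRestrict V).map.app X)).app (op (SimplexCategory.mk 0)))) := by
  rw [← objRestrictZero_map, Functor.map_comp]
  have h1 : IsIso ((Ptot n).map (objRestrictZero V X).hom) := inferInstance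
  exact (hV.surjective h).comp ((isIso_iff_bijective _).1 h1).2

lemma isWgp_restrict (hV : IsResolving V) (hX : IsWgp (n + 1) X) :
    IsWgp (n + 1) ((objRestrict V).functor.obj X) :=
  IsCart.isWgp (restrict_isCart V (simp X)) hX (hV.isHd_zero hX.zero) (hV.fib_zero hX.zero)

lemma isHd_restrict (hV : IsResolving V) (hX : IsHd (n + 1) X) :
    IsHd (n + 1) ((objRestrict V).functor.obj X) :=
  IsCart.isHd (restrict_isCart V (simp X)) hX (hV.isHd_zero (hX.level _))
    (hV.fib_zero (hX.level _))

lemma fib_restrict (hV : IsResolving V) (hX : IsWgp (n + 1) X) :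
    Fib (n + 1) ((objRestrict V).map.app X) :=
  IsCart.fib (restrict_isCart V (simp X)) hX (hV.isHd_zero hX.zero) (hV.fib_zero hX.zero)
    (hV.surjective_zero hX.zero)

lemma isEquivalence_restrict (hV : IsResolving V) (hX : IsWgp (n + 1) X) :
    IsEquivalence (n + 1) ((objRestrict V).map.app X) :=
  IsCart.isEquivalence (restrict_isCart V (simp X)) hX (hV.isHd_zero hX.zero)
    (hV.fib_zero hX.zero) (hV.surjective_zero hX.zero)

lemma isIso_ptot_restrict (hV : IsResolving V) (hX : IsWgp (n + 1) X) :
    IsIso ((Ptot (n + 1)).map ((objRestrict V).map.app X)) :=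
  (hV.isEquivalence_restrict hX).isIso_ptot (hV.isWgp_restrict hX) hX

lemma hpb_restrict (hV : IsResolving V) {D A B E : MSSet.{u} (n + 1)} {fst : D ⟶ A} {snd : D ⟶ B}
    {f : A ⟶ E} {g : B ⟶ E} (h : HPB (n + 1) fst snd f g) (hA : IsWgp (n + 1) A)
    (hB : IsWgp (n + 1) B) (hE : IsHd (n + 1) E) :
    HPB (n + 1) ((objRestrict V).functor.map fst) ((objRestrict V).functor.map snd)
      ((objRestrict V).functor.map f) ((objRestrict V).functor.map g) := by
  have hD := h.isWgp hA hB hE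
  have h0 := hV.hpb (h.level (op (SimplexCategory.mk 0))) hA.zero hB.zero (hE.level _)
  have z {X Y : MSSet.{u} (n + 1)} (f : X ⟶ Y) :
      V.functor.map ((simpMap f).app (op (SimplexCategory.mk 0))) ≫ (objRestrictZero V Y).inv =
        (objRestrictZero V X).inv ≫
          (simpMap ((objRestrict V).functor.map f)).app (op (SimplexCategory.mk 0)) := by
    rw [Iso.comp_inv_eq, Category.assoc, objRestrictZero_naturality, Iso.inv_hom_id_assoc]
  exact IsCart.HPB h (map_w _ h.isPullback.w)
    (h0.of_iso (objRestrictZero V D).symm (objRestrictZero V A).symm (objRestrictZero V B).symm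
      (objRestrictZero V E).symm (z fst) (z snd) (z f) (z g))
    ((objRestrict V).map.naturality fst).symm ((objRestrict V).map.naturality snd).symm
    ((objRestrict V).map.naturality f) ((objRestrict V).map.naturality g)
    (restrict_isCart V (simp D)) (restrict_isCart V (simp A)) (restrict_isCart V (simp B))
    hD hA hB hE.isWgp (hV.isHd_zero hD.zero) (hV.isHd_zero hA.zero) (hV.isHd_zero hB.zero)
    (hV.isHd_zero (hE.level _)) (hV.fib_zero hD.zero) (hV.fib_zero hA.zero) (hV.fib_zero hB.zero)
    (hV.isIso_ptot_restrict hD) (hV.isIso_ptot_restrict hA) (hV.isIso_ptot_restrict hB)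
    (hV.isIso_ptot_restrict hE.isWgp)

lemma restrict (hV : IsResolving V) : IsResolving (objRestrict V) where
  isHd h := hV.isHd_restrict h
  fib h := hV.fib_restrict h.isWgp
  surjective h := ((isIso_iff_bijective _).1 (hV.isIso_ptot_restrict h.isWgp)).2
  hpb h hA hB hE := hV.hpb_restrict h hA.isWgp hB.isWgp hE

end IsResolving

/-- Taking the source of the arrows, as a natural transformation from the isomorphism classes of
objects of the décalage to the objects. -/
def decToZero : dec.functor ⋙ isoClasses.{u} ⟶ evZero where
  app X := TypeCat.ofHom (decSrc X)
  naturality X _ f := ConcreteCategory.hom_ext (C := Type u) _ _ (decSrc_naturality X f)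

lemma isIso_decToZero {X : SSet.{u}} (h : IsEqRel X) : IsIso (decToZero.app X) :=
  (isIso_iff_bijective _).2 (decSrc_bijective h)

lemma isResolving_dec : IsResolving (n := 1) dec.{u} where
  isHd h := isEqRel_Dec h
  fib h := ⟨isIsofib_decFst h, trivial⟩
  surjective {X} _ y := by
    obtain ⟨y, rfl⟩ := isoMk_surjective y
    obtain ⟨x, rfl⟩ := decFst_surjective X _ y
    exact ⟨isoMk (Dec X) x, rfl⟩
  hpb {D A B E fst snd f g} h hA hB hE := by
    refine ⟨isPullback_of_app (n := 0) fun k => isPullback_app (n := 0) h.1 (shift.op.obj k), ?_⟩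
    have w {X Y : SSet.{u}} (hX : IsEqRel X) (hY : IsEqRel Y) (f : X ⟶ Y) :
        f.app (op (SimplexCategory.mk 0)) ≫
          (@asIso _ _ _ _ (decToZero.app Y) (isIso_decToZero hY)).symm.hom =
        (@asIso _ _ _ _ (decToZero.app X) (isIso_decToZero hX)).symm.hom ≫
          isoClasses.map (dec.functor.map f) := by
      rw [Iso.symm_hom, Iso.symm_hom, Iso.comp_inv_eq, Category.assoc, Iso.eq_inv_comp]
      exact (decToZero.naturality f).symm
    have hD : IsEqRel D := h.isHd (n := 1) hA hB hE
    exact IsPullback.of_iso (isPullback_app (n := 0) h.1 (op (SimplexCategory.mk 0)))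
      _ _ _ _ (w hD hA fst) (w hD hB snd) (w hA hE f) (w hB hE g)

/-- The pullback of `W X ⟶ E` along `Dec E ⟶ E`, where `E` is the category obtained from `W X` by
taking connected components in all but the first direction, regarded as an `(n+1)`-fold simplicial
set which is constant in these directions. -/
def decPullback (W : Augmented (MSSet.{u} (n + 1))) : Augmented (MSSet.{u} (n + 1)) :=
  let α : W.functor ⟶ W.functor ⋙ qTwo n ⋙ dTwo n :=
    Functor.whiskerLeft W.functor (gammaTwo n)
  let β : W.functor ⋙ qTwo n ⋙ dec.functor ⋙ dTwo n ⟶ W.functor ⋙ qTwo n ⋙ dTwo n :=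
    Functor.whiskerLeft (W.functor ⋙ qTwo n) (Functor.whiskerRight dec.map (dTwo n))
  ⟨pullbackFunctor α β, pullbackFunctorFst α β ≫ W.map⟩

/-- The first projection of `decPullback`. -/
def decPullbackFst (W : Augmented (MSSet.{u} (n + 1))) :
    (decPullback W).functor ⟶ W.functor :=
  pullbackFunctorFst _ _

/-- The second projection of `decPullback`. -/
def decPullbackSnd (W : Augmented (MSSet.{u} (n + 1))) :
    (decPullback W).functor ⟶ W.functor ⋙ qTwo n ⋙ dec.functor ⋙ dTwo n where
  app _ := pullback.snd _ _
  naturality _ _ _ := pullback.lift_snd _ _ _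

lemma isPullback_decPullback (W : Augmented (MSSet.{u} (n + 1))) (X : MSSet.{u} (n + 1)) :
    IsPullback ((decPullbackFst W).app X) ((decPullbackSnd W).app X)
      ((gammaTwo n).app (W.functor.obj X))
      ((dTwo n).map (decFst ((qTwo n).obj (W.functor.obj X)))) :=
  IsPullback.of_hasPullback _ _

namespace IsResolving

variable {W : Augmented (MSSet.{u} (n + 1))} {X : MSSet.{u} (n + 1)}

lemma hpb_decPullback_self (hW : IsResolving W) (hX : IsHd (n + 1) X) :
    HPB (n + 1) ((decPullbackFst W).app X) ((decPullbackSnd W).app X)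
      ((gammaTwo n).app (W.functor.obj X))
      ((dTwo n).map (decFst ((qTwo n).obj (W.functor.obj X)))) :=
  HPB.of_fib (isPullback_decPullback W X) (hW.isHd hX).isWgp
    (isResolving_dec.isHd (hW.isHd hX).qTwo).dTwo.isWgp (hW.isHd hX).qTwo.dTwo
    (isResolving_dec.fib (hW.isHd hX).qTwo).dTwo

lemma decPullback (hW : IsResolving W) : IsResolving (decPullback W) where
  isHd h := (hW.hpb_decPullback_self h).isHd (hW.isHd h)
    (isResolving_dec.isHd (hW.isHd h).qTwo).dTwo (hW.isHd h).qTwo.dTwo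
  fib {X} h := Fib.comp (Fib.baseChange (isPullback_decPullback W X) (hW.isHd h).isWgp
    (isResolving_dec.isHd (hW.isHd h).qTwo).dTwo.isWgp (hW.isHd h).qTwo.dTwo
    (isResolving_dec.fib (hW.isHd h).qTwo).dTwo) (hW.fib h)
  surjective {X} h := by
    have hs := surjective_ptot_dTwo (n := n) _ (isResolving_dec.surjective (hW.isHd h).qTwo)
    have hp := (hW.hpb_decPullback_self h).ptot
    have h1 : Function.Surjective ((Ptot (n + 1)).map ((decPullbackFst W).app X)) := by
      intro a
      obtain ⟨b, hb⟩ := hs ((Ptot (n + 1)).map ((gammaTwo n).app (W.functor.obj X)) a)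
      obtain ⟨x, hx, -⟩ := Types.exists_of_isPullback hp a b hb.symm
      exact ⟨x, hx⟩
    have e : (Ptot (n + 1)).map ((WG.decPullback W).map.app X) =
        (Ptot (n + 1)).map ((decPullbackFst W).app X) ≫ (Ptot (n + 1)).map (W.map.app X) :=
      (Ptot (n + 1)).map_comp _ _
    rw [e]
    exact (hW.surjective h).comp h1
  hpb {D A B E fst snd f g} h hA hB hE := by
    have hD := h.isHd hA hB hE
    have hF := hW.hpb h hA hB hE
    have hQ := hF.qTwo (hW.isHd hA) (hW.isHd hB) (hW.isHd hE)
    have hR := isResolving_dec.hpb hQ (hW.isHd hA).qTwo (hW.isHd hB).qTwo (hW.isHd hE).qTwo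
    have w {X Y : MSSet.{u} (n + 1)} (f : X ⟶ Y) :=
      (gammaTwo n).naturality (W.functor.map f)
    have w' {X Y : MSSet.{u} (n + 1)} (f : X ⟶ Y) :=
      map_w (WG.dTwo n) (dec.map.naturality ((WG.qTwo n).map (W.functor.map f)))
    exact HPB.cube hF hR.dTwo hQ.dTwo (hW.hpb_decPullback_self hD) (hW.hpb_decPullback_self hA)
      (hW.hpb_decPullback_self hB) (map_w _ h.isPullback.w)
      ((decPullbackFst W).naturality fst).symm ((decPullbackFst W).naturality snd).symm
      ((decPullbackSnd W).naturality fst).symm ((decPullbackSnd W).naturality snd).symm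
      (w fst).symm (w snd).symm (w' fst).symm (w' snd).symm
      ((decPullbackFst W).naturality f) ((decPullbackFst W).naturality g)
      ((decPullbackSnd W).naturality f) ((decPullbackSnd W).naturality g)

end IsResolving

lemma isResolving_id : IsResolving (n := 0) (V.{u} 0) where
  isHd _ := trivial
  fib _ := trivial
  surjective _ := Function.surjective_id
  hpb h _ _ _ := h

/-- The functors `V_n` resolve homotopically discrete objects. -/
lemma isResolving_V : ∀ n : ℕ, IsResolving (V.{u} n)
  | 0 => isResolving_id
  | 1 => isResolving_dec
  | n + 2 => (isResolving_V (n + 1)).restrict.decPullback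

end Resolution

/-! ### Sections of the resolutions -/

section Points

variable {n : ℕ}

/-- The set `X_{0⋯0}`. -/
def points : ∀ n : ℕ, MSSet.{u} n ⥤ Type u
  | 0 => 𝟭 _
  | n + 1 => (evZero ⋙ points n : SimplicialObject (MSSet.{u} n) ⥤ Type u)

/-- The degenerate simplices on the objects, as a map from a constant simplicial object. -/
def constZero {C : Type*} [Category* C] :
    evZero ⋙ Functor.const SimplexCategoryᵒᵖ ⟶ 𝟭 (SimplicialObject C) where
  app X :=
    { app := fun k => X.map (SimplexCategory.const k.unop (SimplexCategory.mk 0) 0).op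
      naturality := fun k l θ => by
        refine (Category.id_comp _).trans ?_
        exact X.map_comp (SimplexCategory.const k.unop (SimplexCategory.mk 0) 0).op θ }
  naturality X Y f := NatTrans.ext (funext fun k => (f.naturality _).symm)

lemma isIso_constZero_app_zero {C : Type*} [Category* C] (X : SimplicialObject C) :
    IsIso ((constZero.app X).app (op (SimplexCategory.mk 0))) := by
  have h : SimplexCategory.const (SimplexCategory.mk 0) (SimplexCategory.mk 0) 0 = 𝟙 _ := by
    ext j
    exact congrArg Fin.val (Subsingleton.elim (α := Fin 1) _ _)
  change IsIso (X.map (SimplexCategory.const (SimplexCategory.mk 0) (SimplexCategory.mk 0) 0).op)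
  rw [h]
  exact inferInstanceAs (IsIso (X.map (𝟙 _)))

lemma isIso_constZero {X : MSSet.{u} (n + 1)} (h : IsLC (n + 1) X) :
    IsIso (constZero.app (simp X)) := by
  have (k : SimplexCategoryᵒᵖ) : IsIso ((constZero.app (simp X)).app k) := h.1 _ _ _
  exact NatIso.isIso_of_isIso_app _

/-- The objects of a discrete object. -/
def discrZero : ∀ n : ℕ, discr.{u} (n + 1) ⋙ evZero ≅ discr n
  | 0 => Iso.refl _
  | n + 1 => (Functor.isoWhiskerRight (discrZero n) (d n) :
      (discr (n + 1) ⋙ evZero) ⋙ d n ≅ discr n ⋙ d n)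

lemma comp_w {C : Type*} [Category* C] {P P' Q Q' R R' : C} {a : P ⟶ P'} {b : Q ⟶ Q'} {c : R ⟶ R'}
    {x : P ⟶ Q} {x' : P' ⟶ Q'} {y : Q ⟶ R} {y' : Q' ⟶ R'} (w1 : a ≫ x' = x ≫ b)
    (w2 : b ≫ y' = y ≫ c) : a ≫ x' ≫ y' = (x ≫ y) ≫ c := by
  rw [← Category.assoc, w1, Category.assoc, w2, Category.assoc]

lemma isIso_map_comp {C D : Type*} [Category* C] [Category* D] (T : C ⥤ D) {X Y Z : C} {f : X ⟶ Y}
    {g : Y ⟶ Z} (hf : IsIso (T.map f)) (hg : IsIso (T.map g)) : IsIso (T.map (f ≫ g)) := by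
  rw [T.map_comp]
  infer_instance

lemma inv_comp_naturality {C : Type*} [Category* C] {P P' Q Q' R R' : C} {a : Q ⟶ P} {a' : Q' ⟶ P'}
    {b : Q ⟶ R} {b' : Q' ⟶ R'} {p : P ⟶ P'} {q : Q ⟶ Q'} {r : R ⟶ R'} (ha : IsIso a)
    (ha' : IsIso a') (w1 : q ≫ a' = a ≫ p) (w2 : q ≫ b' = b ≫ r) :
    p ≫ inv a' ≫ b' = (inv a ≫ b) ≫ r := by
  have h : p ≫ inv a' = inv a ≫ q := by
    rw [IsIso.comp_inv_eq, Category.assoc, w1, IsIso.inv_hom_id_assoc]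
  rw [← Category.assoc, h, Category.assoc, Category.assoc, w2]

/-- A section of `V` on points induces a map from the points to the objects of the restriction
along `V`. -/
def sectionZero {V : Augmented (MSSet.{u} n)} (s : points n ⋙ discr n ⟶ V.functor)
    (X : MSSet.{u} (n + 1)) :
    lev (simp ((discr (n + 1)).obj ((points (n + 1)).obj X))) 0 ⟶
      lev (simp ((objRestrict V).functor.obj X)) 0 :=
  (discrZero n).hom.app ((points (n + 1)).obj X) ≫ s.app (lev (simp X) 0) ≫
    (objRestrictZero V X).inv

lemma sectionZero_naturality {V : Augmented (MSSet.{u} n)} (s : points n ⋙ discr n ⟶ V.functor)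
    {X Y : MSSet.{u} (n + 1)} (f : X ⟶ Y) :
    (simpMap ((discr (n + 1)).map ((points (n + 1)).map f))).app (op (SimplexCategory.mk 0)) ≫
      sectionZero s Y = sectionZero s X ≫
        (simpMap ((objRestrict V).functor.map f)).app (op (SimplexCategory.mk 0)) := by
  have h : V.functor.map ((simpMap f).app (op (SimplexCategory.mk 0))) ≫
      (objRestrictZero V Y).inv = (objRestrictZero V X).inv ≫
        (simpMap ((objRestrict V).functor.map f)).app (op (SimplexCategory.mk 0)) := by
    rw [Iso.eq_inv_comp, ← Category.assoc, ← objRestrictZero_naturality, Category.assoc,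
      Iso.hom_inv_id, Category.comp_id]
  exact comp_w ((discrZero n).hom.naturality ((points (n + 1)).map f))
    (comp_w (s.naturality ((simpMap f).app (op (SimplexCategory.mk 0)))) h)

/-- A section of `V` on points gives a section of the restriction along `V`. -/
def objRestrictSection {V : Augmented (MSSet.{u} n)} (s : points n ⋙ discr n ⟶ V.functor) :
    points (n + 1) ⋙ discr (n + 1) ⟶ (objRestrict V).functor where
  app X := @inv _ _ _ _ (constZero.app (simp ((discr (n + 1)).obj ((points (n + 1)).obj X))))
      (isIso_constZero (isLC_discr _ _)) ≫ (Functor.const SimplexCategoryᵒᵖ).map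
        (sectionZero s X) ≫ constZero.app (simp ((objRestrict V).functor.obj X))
  naturality X Y f := by
    refine inv_comp_naturality (C := SimplicialObject (MSSet.{u} n))
      (isIso_constZero (isLC_discr (n + 1) ((points (n + 1)).obj X)))
      (isIso_constZero (isLC_discr (n + 1) ((points (n + 1)).obj Y)))
      (constZero.naturality (simpMap ((discr (n + 1)).map ((points (n + 1)).map f)))) ?_
    exact comp_w (map_w (Functor.const SimplexCategoryᵒᵖ) (sectionZero_naturality s f))
      (constZero.naturality (simpMap ((objRestrict V).functor.map f)))

lemma isIso_comps_objRestrictSection {V : Augmented (MSSet.{u} n)}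
    (s : points n ⋙ discr n ⟶ V.functor) (X : MSSet.{u} (n + 1))
    (h : IsIso ((comps n).map (s.app (lev (simp X) 0)))) :
    IsIso ((comps n).map
      ((simpMap ((objRestrictSection s).app X)).app (op (SimplexCategory.mk 0)))) := by
  have h1 : IsIso ((comps n).map (sectionZero s X)) :=
    isIso_map_comp (comps n) (inferInstanceAs (IsIso ((comps n).map
      ((discrZero n).hom.app ((points (n + 1)).obj X))))) (isIso_map_comp (comps n) h inferInstance)
  have h2 := isIso_constZero (isLC_discr (n + 1) ((points (n + 1)).obj X))
  have h3 : IsIso ((inv (constZero.app (simp ((discr (n + 1)).obj ((points (n + 1)).obj X))))).app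
    (op (SimplexCategory.mk 0))) := inferInstance
  have h4 := isIso_constZero_app_zero (simp ((objRestrict V).functor.obj X))
  have e : (comps n).map ((simpMap ((objRestrictSection s).app X)).app
      (op (SimplexCategory.mk 0))) = (comps n).map ((inv (constZero.app
        (simp ((discr (n + 1)).obj ((points (n + 1)).obj X))))).app (op (SimplexCategory.mk 0))) ≫
      (comps n).map (sectionZero s X) ≫ (comps n).map ((constZero.app
        (simp ((objRestrict V).functor.obj X))).app (op (SimplexCategory.mk 0))) := by
    rw [← Functor.map_comp, ← Functor.map_comp]
    rfl
  rw [e]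
  infer_instance

lemma isIso_decFst {X : SSet.{u}} (h : IsLC 1 X) : IsIso (decFst X) := by
  have (k : SimplexCategoryᵒᵖ) : IsIso ((decFst X).app k) := h.1 _ _ _
  exact NatIso.isIso_of_isIso_app _

lemma IsLC.qTwo : ∀ {n : ℕ} {X : MSSet.{u} (n + 1)}, IsLC (n + 1) X → IsLC 1 ((WG.qTwo n).obj X)
  | 0, _, h => h
  | n + 1, _, h => IsLC.qTwo (n := n) h.q

/-- A map from a discrete object to `W X` induces a map to the décalage of the category of
components of `W X`. -/
def decLift {D Y : MSSet.{u} (n + 1)} (hD : IsLC (n + 1) D) (t : D ⟶ Y) :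
    D ⟶ (dTwo n).obj (Dec ((qTwo n).obj Y)) :=
  (gammaTwo n).app D ≫ (dTwo n).map
    (@inv _ _ _ _ (decFst ((qTwo n).obj D)) (isIso_decFst hD.qTwo) ≫
      dec.functor.map ((qTwo n).map t))

lemma decLift_decFst {D Y : MSSet.{u} (n + 1)} (hD : IsLC (n + 1) D) (t : D ⟶ Y) :
    t ≫ (gammaTwo n).app Y = decLift hD t ≫ (dTwo n).map (decFst ((qTwo n).obj Y)) := by
  have hi := isIso_decFst hD.qTwo
  have e : (inv (decFst ((qTwo n).obj D)) ≫ dec.functor.map ((qTwo n).map t)) ≫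
      decFst ((qTwo n).obj Y) = (qTwo n).map t :=
    (Category.assoc _ _ _).trans
      ((IsIso.inv_comp_eq _).2 (dec.map.naturality ((qTwo n).map t)))
  exact ((gammaTwo n).naturality t).trans ((congrArg (fun s => (gammaTwo n).app D ≫ s)
    ((congrArg (dTwo n).map e).symm.trans ((dTwo n).map_comp _ _))).trans
      (Category.assoc _ _ _).symm)

lemma decLift_naturality {D Y D' Y' : MSSet.{u} (n + 1)} (hD : IsLC (n + 1) D)
    (hD' : IsLC (n + 1) D') {t : D ⟶ Y} {t' : D' ⟶ Y'} {a : D ⟶ D'} {b : Y ⟶ Y'}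
    (w : a ≫ t' = t ≫ b) :
    a ≫ decLift hD' t' =
      decLift hD t ≫ (dTwo n).map (dec.functor.map ((qTwo n).map b)) := by
  have h := inv_comp_naturality (isIso_decFst hD.qTwo) (isIso_decFst hD'.qTwo)
    (dec.map.naturality ((qTwo n).map a)) (map_w dec.functor (map_w (qTwo n) w))
  exact comp_w ((gammaTwo n).naturality a) (map_w (dTwo n) h)

lemma isIso_comps_decLift {D Y : MSSet.{u} (n + 1)} (hD : IsLC (n + 1) D) (hY : IsHd (n + 1) Y)
    (t : D ⟶ Y) (h : IsIso ((comps n).map ((simpMap t).app (op (SimplexCategory.mk 0))))) :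
    IsIso ((comps (n + 1)).map (decLift hD t)) := by
  have h1 := isIso_decFst hD.qTwo
  have h2 := isIso_comps_gammaTwo D
  have hK : IsEqRel ((qTwo n).obj D) := hD.isHd.qTwo
  have hE : IsEqRel ((qTwo n).obj Y) := hY.qTwo
  have h3 : IsIso (isoClasses.map (dec.functor.map ((qTwo n).map t))) :=
    (isIso_map_iff_of_app decToZero _ (isIso_decToZero hK) (isIso_decToZero hE)).2
      ((isIso_comps_iff_qTwo_level t _).1 h)
  have h4 : IsIso ((comps 1).map (dec.functor.map ((qTwo n).map t))) :=
    (isIso_ptot_iff (n := 1) (dec.functor.map ((qTwo n).map t)) (isEqRel_Dec hK)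
      (isEqRel_Dec hE)).1 h3
  have h5 : IsIso ((comps 1).map (@inv _ _ _ _ (decFst ((qTwo n).obj D)) h1)) :=
    @Functor.map_isIso _ _ _ _ _ _ (comps 1) _ (@IsIso.inv_isIso _ _ _ _ _ h1)
  exact isIso_map_comp (comps (n + 1)) h2
    ((isIso_comps_dTwo (n := n) _).1 (isIso_map_comp (comps 1) h5 h4))

/-- A section of `W` on points gives a section of `decPullback W`. -/
def decPullbackSection {W : Augmented (MSSet.{u} (n + 1))}
    (t : points (n + 1) ⋙ discr (n + 1) ⟶ W.functor) :
    points (n + 1) ⋙ discr (n + 1) ⟶ (decPullback W).functor where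
  app X := (isPullback_decPullback W X).lift (t.app X) (decLift (isLC_discr _ _) (t.app X))
    (decLift_decFst _ _)
  naturality X Y f := by
    apply (isPullback_decPullback W Y).hom_ext
    · have h := (decPullbackFst W).naturality f
      rw [Category.assoc, Category.assoc, IsPullback.lift_fst, h, IsPullback.lift_fst_assoc]
      exact t.naturality f
    · have h := (decPullbackSnd W).naturality f
      rw [Category.assoc, Category.assoc, IsPullback.lift_snd, h, IsPullback.lift_snd_assoc]
      exact decLift_naturality _ _ (t.naturality f)

lemma isIso_comps_decPullbackSection {W : Augmented (MSSet.{u} (n + 1))} (hW : IsResolving W)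
    (t : points (n + 1) ⋙ discr (n + 1) ⟶ W.functor) {X : MSSet.{u} (n + 1)}
    (hX : IsHd (n + 1) X)
    (h : IsIso ((comps n).map ((simpMap (t.app X)).app (op (SimplexCategory.mk 0))))) :
    IsIso ((comps (n + 1)).map ((decPullbackSection t).app X)) := by
  have hp := (hW.hpb_decPullback_self hX).comps (hW.isHd hX)
    (isResolving_dec.isHd (hW.isHd hX).qTwo).dTwo (hW.isHd hX).qTwo.dTwo
  -- the second projection is bijective on components, being a base change of `gammaTwo`
  have h1 := isIso_comps_gammaTwo (W.functor.obj X)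
  have h2 := hp.flip.isIso_fst_of_isIso
  have h3 := isIso_comps_decLift (isLC_discr (n + 1) ((points (n + 1)).obj X)) (hW.isHd hX)
    (t.app X) h
  have e : (decPullbackSection t).app X ≫ (decPullbackSnd W).app X =
      decLift (isLC_discr _ _) (t.app X) := IsPullback.lift_snd _ _ _ _
  rw [← e, Functor.map_comp] at h3
  exact IsIso.of_isIso_comp_right _ ((comps (n + 1)).map ((decPullbackSnd W).app X))

/-- A natural section, on the discrete object of points, of `V_n X`. -/
def pointsToV : ∀ n : ℕ, points n ⋙ discr n ⟶ (V.{u} n).functor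
  | 0 => 𝟙 _
  | 1 =>
    { app := fun X => decSection X
      naturality := fun X _ f => (decSection_naturality X f).symm }
  | n + 2 => decPullbackSection (objRestrictSection (pointsToV (n + 1)))

/-- The points of a homotopically discrete object `X` are the components of `V_n X`. -/
lemma isIso_comps_pointsToV : ∀ {n : ℕ} {X : MSSet.{u} n} (_ : IsHd n X),
    IsIso ((comps n).map ((pointsToV n).app X))
  | 0, X, _ => inferInstanceAs (IsIso (𝟙 X))
  | 1, X, h => (isIso_ptot_iff (n := 1) (decSection X) (isConst_const _).1 (isEqRel_Dec h)).1
      (isIso_isoClasses_decSection h)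
  | n + 2, X, h => isIso_comps_decPullbackSection (isResolving_V (n + 1)).restrict _ h
      (isIso_comps_objRestrictSection _ X (isIso_comps_pointsToV (n := n + 1) (h.level _)))

end Points

/-! ### The functors `G_n` -/

section Replacement

variable {n : ℕ}

/-- An endofunctor with a natural map to the identity which, on weakly globular objects, is an
equivalence, and which preserves weakly globular and homotopically discrete objects and hereditary
pullbacks. -/
structure IsReplacement (R : Augmented (MSSet.{u} n)) : Prop where
  isWgp : ∀ {X}, IsWgp n X → IsWgp n (R.functor.obj X)
  isEquivalence : ∀ {X}, IsWgp n X → IsEquivalence n (R.map.app X)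
  isHd : ∀ {X}, IsHd n X → IsHd n (R.functor.obj X)
  hpb : ∀ {D A B E} {fst : D ⟶ A} {snd : D ⟶ B} {f : A ⟶ E} {g : B ⟶ E}, HPB n fst snd f g →
    IsWgp n A → IsWgp n B → IsHd n E →
    HPB n (R.functor.map fst) (R.functor.map snd) (R.functor.map f) (R.functor.map g)

/-- The composite of two augmented endofunctors. -/
def Augmented.comp {C : Type*} [Category* C] (A B : Augmented C) : Augmented C where
  functor := A.functor ⋙ B.functor
  map := (Functor.whiskerLeft A.functor B.map ≫ A.map : A.functor ⋙ B.functor ⟶ 𝟭 C)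

/-- The levelwise application of an augmented endofunctor. -/
def Augmented.levelwise (R : Augmented (MSSet.{u} n)) : Augmented (MSSet.{u} (n + 1)) where
  functor := WG.levelwise R.functor
  map := levelwiseMap R.map

lemma IsReplacement.comp {A B : Augmented (MSSet.{u} n)} (hA : IsReplacement A)
    (hB : IsReplacement B) : IsReplacement (A.comp B) where
  isWgp h := hB.isWgp (hA.isWgp h)
  isEquivalence h := IsEquivalence.comp (hB.isWgp (hA.isWgp h)) (hA.isWgp h) h
    (hB.isEquivalence (hA.isWgp h)) (hA.isEquivalence h)
  isHd h := hB.isHd (hA.isHd h)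
  hpb h h1 h2 h3 := hB.hpb (hA.hpb h h1 h2 h3) (hA.isWgp h1) (hA.isWgp h2) (hA.isHd h3)

lemma IsResolving.isReplacement_restrict {V : Augmented (MSSet.{u} n)} (hV : IsResolving V) :
    IsReplacement (objRestrict V) where
  isWgp h := hV.isWgp_restrict h
  isEquivalence h := hV.isEquivalence_restrict h
  isHd h := hV.isHd_restrict h
  hpb h hA hB hE := hV.hpb_restrict h hA hB hE

namespace IsReplacement

variable {R : Augmented (MSSet.{u} n)}

lemma isIso_ptot (hR : IsReplacement R) {X : MSSet.{u} n} (h : IsWgp n X) :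
    IsIso ((Ptot n).map (R.map.app X)) :=
  (hR.isEquivalence h).isIso_ptot (hR.isWgp h) h

lemma segal_levelwise (hR : IsReplacement R) {X : MSSet.{u} (n + 1)} (h : IsWgp (n + 1) X)
    (m : ℕ) : HPB n (initFace (simp (R.levelwise.functor.obj X)) m)
      (lastEdge (simp (R.levelwise.functor.obj X)) m)
      (lastVertex (simp (R.levelwise.functor.obj X)) m)
      (src (simp (R.levelwise.functor.obj X))) :=
  hR.hpb (h.segal m) (h.level _) (h.level _) h.zero

lemma isWgp_levelwise (hR : IsReplacement R) {X : MSSet.{u} (n + 1)} (h : IsWgp (n + 1) X) :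
    IsWgp (n + 1) (R.levelwise.functor.obj X) :=
  IsWgp.of_level (fun k => hR.isWgp (h.level k)) (hR.isHd h.zero) (hR.segal_levelwise h)

lemma levelwise (hR : IsReplacement R) : IsReplacement R.levelwise where
  isWgp h := hR.isWgp_levelwise h
  isEquivalence h := isEquivalence_of_level (hR.isWgp_levelwise h) h fun k =>
    hR.isEquivalence (h.level k)
  isHd {X} h := IsHd.of_level (R.levelwise.map.app X) (fun k => hR.isHd (h.level k))
    (hR.segal_levelwise h.isWgp) h fun k => hR.isIso_ptot (h.isWgp.level k)
  hpb {D A B E fst snd f g} h hA hB hE := by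
    refine HPB.of_level (fun k => hR.hpb (h.level k) (hA.level k) (hB.level k) (hE.level k)) ?_
    -- after truncation, the square is isomorphic to the given one
    have i {X : MSSet.{u} (n + 1)} (hX : IsWgp (n + 1) X) :
        IsIso ((Ptot (n + 1)).map (R.levelwise.map.app X)) :=
      isIso_ptot_of_level _ fun k => hR.isIso_ptot (hX.level k)
    have w {X Y : MSSet.{u} (n + 1)} (hX : IsWgp (n + 1) X) (hY : IsWgp (n + 1) Y) (f : X ⟶ Y) :
        (Ptot (n + 1)).map f ≫ (@asIso _ _ _ _ _ (i hY)).symm.hom =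
          (@asIso _ _ _ _ _ (i hX)).symm.hom ≫
            (Ptot (n + 1)).map (R.levelwise.functor.map f) := by
      rw [Iso.symm_hom, Iso.symm_hom, Iso.comp_inv_eq, Category.assoc, Iso.eq_inv_comp]
      exact (map_w (Ptot (n + 1)) (R.levelwise.map.naturality f)).symm
    have hD := h.isWgp hA hB hE
    exact h.ptot.of_iso _ _ _ _ (w hD hA fst) (w hD hB snd) (w hA hE.isWgp f) (w hB hE.isWgp g)

lemma isIso_comps_map (hR : IsReplacement R) {X Y : MSSet.{u} n} (hX : IsHd n X) (hY : IsHd n Y)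
    (f : X ⟶ Y) (h : IsIso ((comps n).map f)) : IsIso ((comps n).map (R.functor.map f)) :=
  (isIso_map_iff_of_app (Functor.whiskerRight R.map (comps n)) f
    ((hR.isEquivalence hX.isWgp).isIso_comps (hR.isHd hX) hX)
    ((hR.isEquivalence hY.isWgp).isIso_comps (hR.isHd hY) hY)).2 h

end IsReplacement

/-- The natural map `G_n X ⟶ X`. -/
def augG : ∀ n : ℕ, G.{u} n ⟶ 𝟭 (MSSet.{u} n)
  | 0 => 𝟙 _
  | 1 => 𝟙 _
  | n + 2 => ((objRestrict (V (n + 1))).comp (Augmented.levelwise ⟨G (n + 1), augG (n + 1)⟩)).map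

/-- The functor `G_n` with its natural map to the identity. -/
def GAug (n : ℕ) : Augmented (MSSet.{u} n) := ⟨G n, augG n⟩

lemma isReplacement_id (n : ℕ) : IsReplacement (⟨𝟭 _, 𝟙 _⟩ : Augmented (MSSet.{u} n)) where
  isWgp h := h
  isEquivalence {X} _ := isEquivalence_of_isIso (𝟙 X) inferInstance
  isHd h := h
  hpb h _ _ _ := h

lemma isReplacement_G : ∀ n : ℕ, IsReplacement (GAug.{u} n)
  | 0 => isReplacement_id 0
  | 1 => isReplacement_id 1
  | n + 2 => (isResolving_V (n + 1)).isReplacement_restrict.comp (isReplacement_G (n + 1)).levelwise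

end Replacement

section DiscreteObjects

variable {n : ℕ}

lemma isIso_objRestrict_of_isLC {V : Augmented (MSSet.{u} n)}
    (hV : ∀ X, IsLC n X → IsIso (V.map.app X)) {X : MSSet.{u} (n + 1)} (h : IsLC (n + 1) X) :
    IsIso ((objRestrict V).map.app X) := by
  have := hV _ (h.2 (op (SimplexCategory.mk 0)))
  have : IsIso (codisc.map (augZero V (simp X))) :=
    inferInstanceAs (IsIso (codisc.map (V.map.app (lev (simp X) 0))))
  exact (isPullback_restrict V (simp X)).isIso_fst_of_isIso

lemma isIso_decPullback_of_isLC {W : Augmented (MSSet.{u} (n + 1))} {X : MSSet.{u} (n + 1)}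
    (h : IsLC (n + 1) X) (hW : IsIso (W.map.app X)) : IsIso ((decPullback W).map.app X) := by
  have h1 : IsLC (n + 1) (W.functor.obj X) := h.of_iso (asIso (W.map.app X)).symm
  have h2 := isIso_decFst h1.qTwo
  have h3 : IsIso ((dTwo n).map (decFst ((qTwo n).obj (W.functor.obj X)))) :=
    @Functor.map_isIso _ _ _ _ _ _ (dTwo n) _ h2
  have h4 := (isPullback_decPullback W X).isIso_fst_of_isIso
  exact @IsIso.comp_isIso _ _ _ _ _ _ (W.map.app X) h4 hW

lemma isIso_V_of_isLC : ∀ {n : ℕ} (X : MSSet.{u} n), IsLC n X → IsIso ((V n).map.app X)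
  | 0, X, _ => inferInstanceAs (IsIso (𝟙 X))
  | 1, _, h => isIso_decFst h
  | n + 2, _, h => isIso_decPullback_of_isLC h
      (isIso_objRestrict_of_isLC (isIso_V_of_isLC (n := n + 1)) h)

lemma isIso_augG_of_isLC : ∀ {n : ℕ} (X : MSSet.{u} n), IsLC n X → IsIso ((augG n).app X)
  | 0, X, _ => inferInstanceAs (IsIso (𝟙 X))
  | 1, X, _ => inferInstanceAs (IsIso (𝟙 X))
  | n + 2, X, h => by
    have h1 := isIso_objRestrict_of_isLC (isIso_V_of_isLC (n := n + 1)) h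
    have h2 : IsLC (n + 2) ((objRestrict (V (n + 1))).functor.obj X) :=
      h.of_iso (asIso ((objRestrict (V (n + 1))).map.app X)).symm
    have h3 : IsIso ((levelwiseMap (augG (n + 1))).app ((objRestrict (V (n + 1))).functor.obj X)) :=
      isIso_of_app fun k => isIso_augG_of_isLC (n := n + 1) _ (h2.2 k)
    exact @IsIso.comp_isIso _ _ _ _ _ _ ((objRestrict (V (n + 1))).map.app X) h3 h1

end DiscreteObjects

section SectionsOfG

variable {n : ℕ}

/-- A map from a discrete object which is bijective on components, transported to a section of the
discretization map. -/
def discSplitEpi {D Z : MSSet.{u} n} (s : D ⟶ Z) (hD : IsLC n D) (hs : IsIso ((comps n).map s)) :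
    SplitEpi (discMap Z) :=
  have h : IsIso (discMap D ≫ (discr n).map ((comps n).map s)) :=
    @IsIso.comp_isIso _ _ _ _ _ _ _ (isIso_discMap hD) inferInstance
  { section_ := inv (discMap D ≫ (discr n).map ((comps n).map s)) ≫ s
    id := by
      rw [Category.assoc, IsIso.inv_comp_eq, Category.comp_id]
      exact (gamma n).naturality s }

lemma discSplitEpi_naturality {D Z D' Z' : MSSet.{u} n} {s : D ⟶ Z} {s' : D' ⟶ Z'}
    (hD : IsLC n D) (hs : IsIso ((comps n).map s)) (hD' : IsLC n D')
    (hs' : IsIso ((comps n).map s')) {a : D ⟶ D'} {b : Z ⟶ Z'} (w : a ≫ s' = s ≫ b) :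
    (discSplitEpi s hD hs).section_ ≫ b =
      (discr n).map ((comps n).map b) ≫ (discSplitEpi s' hD' hs').section_ :=
  (inv_comp_naturality (@IsIso.comp_isIso _ _ _ _ _ _ _ (isIso_discMap hD) inferInstance)
    (@IsIso.comp_isIso _ _ _ _ _ _ _ (isIso_discMap hD') inferInstance)
    (comp_w ((gamma n).naturality a) (map_w (discr n) (map_w (comps n) w))) w).symm

/-- The natural map from a discrete object to the objects of `G_{n+2} X`. -/
def toGZero (X : MSSet.{u} (n + 2)) :
    (G (n + 1)).obj ((discr (n + 1)).obj ((points (n + 1)).obj (lev (simp X) 0))) ⟶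
      lev (simp ((G (n + 2)).obj X)) 0 :=
  (G (n + 1)).map ((pointsToV (n + 1)).app (lev (simp X) 0) ≫ (objRestrictZero (V (n + 1)) X).inv)

lemma toGZero_naturality {X Y : MSSet.{u} (n + 2)} (f : X ⟶ Y) :
    (G (n + 1)).map ((discr (n + 1)).map ((points (n + 1)).map
      ((simpMap f).app (op (SimplexCategory.mk 0))))) ≫ toGZero Y =
      toGZero X ≫ (simpMap ((G (n + 2)).map f)).app (op (SimplexCategory.mk 0)) := by
  have h : (V (n + 1)).functor.map ((simpMap f).app (op (SimplexCategory.mk 0))) ≫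
      (objRestrictZero (V (n + 1)) Y).inv = (objRestrictZero (V (n + 1)) X).inv ≫
        (simpMap ((objRestrict (V (n + 1))).functor.map f)).app (op (SimplexCategory.mk 0)) := by
    rw [Iso.eq_inv_comp, ← Category.assoc, ← objRestrictZero_naturality, Category.assoc,
      Iso.hom_inv_id, Category.comp_id]
  exact map_w (G (n + 1)) (comp_w ((pointsToV (n + 1)).naturality _) h)

lemma isLC_G_discr (S : Type u) : IsLC n ((G n).obj ((discr n).obj S)) :=
  (isLC_discr n S).of_iso (@asIso _ _ _ _ _ (isIso_augG_of_isLC _ (isLC_discr n S))).symm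

lemma isIso_comps_toGZero {X : MSSet.{u} (n + 2)} (hX : IsWgp (n + 2) X) :
    IsIso ((comps (n + 1)).map (toGZero X)) := by
  have h1 := isIso_comps_pointsToV hX.zero
  exact (isReplacement_G (n + 1)).isIso_comps_map (isLC_discr _ _).isHd
    ((isResolving_V (n + 1)).isHd_zero hX.zero) _ (isIso_map_comp _ h1 inferInstance)

/-- The sections to the discretization maps for `G_n X`. -/
def sectionsG : ∀ (n : ℕ) (X : MSSet.{u} n), IsWgp n X → Sections n ((G n).obj X)
  | 0, _, _ => PUnit.unit
  | 1, _, _ => PUnit.unit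
  | n + 2, X, h => (discSplitEpi (toGZero X) (isLC_G_discr _) (isIso_comps_toGZero h),
      fun k => sectionsG (n + 1) ((simp ((F (n + 1)).obj X)).obj k)
        (((isResolving_V (n + 1)).isWgp_restrict h).level k))

lemma compatible_G : ∀ (n : ℕ) {X Y : MSSet.{u} n} (f : X ⟶ Y) (hX : IsWgp n X)
    (hY : IsWgp n Y), Compatible n ((G n).map f) (sectionsG n X hX) (sectionsG n Y hY)
  | 0, _, _, _, _, _ => trivial
  | 1, _, _, _, _, _ => trivial
  | n + 2, _, _, f, hX, hY => ⟨discSplitEpi_naturality (isLC_G_discr _) (isIso_comps_toGZero hX)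
      (isLC_G_discr _) (isIso_comps_toGZero hY) (toGZero_naturality f),
      fun k => compatible_G (n + 1) ((simpMap ((F (n + 1)).map f)).app k) _ _⟩

lemma isNatural_sectionsG : ∀ (n : ℕ) (X : MSSet.{u} n) (hX : IsWgp n X),
    IsNatural n (sectionsG n X hX)
  | 0, _, _ => trivial
  | 1, _, _ => trivial
  | n + 2, X, _ => ⟨fun _ => isNatural_sectionsG (n + 1) _ _, fun _ _ θ =>
      compatible_G (n + 1) ((simp ((F (n + 1)).obj X)).map θ) _ _⟩

/-- The functor `G_n` from weakly globular `n`-fold categories to weakly globular Tamsamani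
`n`-categories with natural sections. -/
def GFTa (n : ℕ) : CatWg.{u} n ⥤ FTaWg.{u} n where
  obj X :=
    { obj := (G n).obj X.obj
      isTa := IsWg.isTa n _ (isWg_iff.2 ((isReplacement_G n).isWgp (isWg_iff.1 X.property)))
      sections := sectionsG n X.obj (isWg_iff.1 X.property)
      natural := isNatural_sectionsG n X.obj _ }
  map f := ⟨(G n).map f.hom, compatible_G n f.hom _ _⟩
  map_id X := FTaWg.Hom.ext ((G n).map_id X.obj)
  map_comp f g := FTaWg.Hom.ext ((G n).map_comp f.hom g.hom)

/-- The natural map `G_n X ⟶ X` in weakly globular Tamsamani `n`-categories. -/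
def augGTa (n : ℕ) : GFTa.{u} n ⋙ FTaWg.forget n ⟶ CatWg.toTa n where
  app X := ObjectProperty.homMk ((augG n).app X.obj)
  naturality _ _ f := ObjectProperty.hom_ext _ ((augG n).naturality f.hom)

lemma isEquivalence_G_map {X Y : MSSet.{u} n} (hX : IsWgp n X) (hY : IsWgp n Y) {f : X ⟶ Y}
    (h : IsEquivalence n f) : IsEquivalence n ((G n).map f) := by
  have hG := isReplacement_G.{u} n
  have h1 := IsEquivalence.comp (hG.isWgp hX) hX hY (hG.isEquivalence hX) h
  have e : (augG n).app X ≫ f = (G n).map f ≫ (augG n).app Y := ((augG n).naturality f).symm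
  exact IsEquivalence.of_comp (hG.isWgp hX) (hG.isWgp hY) hY (hG.isEquivalence hY)
    ((congrArg (fun t => IsEquivalence n t) e).mp h1)

end SectionsOfG

section PullbacksOverDiscrete

/-- A map into a pullback is compatible with sections if its composites with the projections
are. -/
lemma compatible_of_isPullback : ∀ (n : ℕ) {T D A B E : MSSet.{u} n} {fst : D ⟶ A} {snd : D ⟶ B}
    {f : A ⟶ E} {g : B ⟶ E} (_ : IsPullback fst snd f g) {w : T ⟶ D} {σT : Sections n T}
    {σD : Sections n D} {σA : Sections n A} {σB : Sections n B} (_ : Compatible n fst σD σA)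
    (_ : Compatible n snd σD σB) (_ : Compatible n (w ≫ fst) σT σA)
    (_ : Compatible n (w ≫ snd) σT σB), Compatible n w σT σD
  | 0, _, _, _, _, _, _, _, _, _, _, _, _, _, _, _, _, _, _, _ => trivial
  | 1, _, _, _, _, _, _, _, _, _, _, _, _, _, _, _, _, _, _, _ => trivial
  | n + 2, T, D, A, B, E, fst, snd, f, g, h, w, σT, σD, σA, σB, c1, c2, c3, c4 => by
    refine ⟨?_, fun k => compatible_of_isPullback (n + 1) (isPullback_app h k) (c1.2 k) (c2.2 k)
      (c3.2 k) (c4.2 k)⟩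
    have key {Z : MSSet.{u} (n + 2)} {φ : D ⟶ Z} {σ : Sections (n + 2) Z}
        (c : Compatible (n + 2) φ σD σ) (c' : Compatible (n + 2) (w ≫ φ) σT σ) :
        (σT.1.section_ ≫ (simpMap w).app (op (SimplexCategory.mk 0))) ≫
          (simpMap φ).app (op (SimplexCategory.mk 0)) =
        ((discr (n + 1)).map ((comps (n + 1)).map ((simpMap w).app (op (SimplexCategory.mk 0)))) ≫
          σD.1.section_) ≫ (simpMap φ).app (op (SimplexCategory.mk 0)) := by
      rw [Category.assoc, Category.assoc, c.1, ← Category.assoc ((discr (n + 1)).map _),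
        ← Functor.map_comp, ← Functor.map_comp]
      exact c'.1
    exact (isPullback_app h _).hom_ext (key c1 c3) (key c2 c4)

lemma preservesLimit_cospan_of_isPullback {C D : Type*} [Category* C] [Category* D] (T : C ⥤ D)
    {P X Y Z : C} {fst : P ⟶ X} {snd : P ⟶ Y} {f : X ⟶ Z} {g : Y ⟶ Z}
    (h : IsPullback fst snd f g)
    (h' : IsPullback (T.map fst) (T.map snd) (T.map f) (T.map g)) :
    PreservesLimit (cospan f g) T :=
  preservesLimit_of_preserves_limit_cone h.isLimit
    ((isLimitMapConePullbackConeEquiv T h.w).symm h'.isLimit)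

variable {n : ℕ}

/-- The pullback of weakly globular objects over a discrete one. -/
def CatWg.pullback {X Y Z : CatWg.{u} n} (f : X ⟶ Z) (g : Y ⟶ Z) (hZ : IsLC n Z.obj) :
    CatWg.{u} n :=
  ⟨Limits.pullback f.hom g.hom, isWg_iff.2 ((HPB.of_isLC (IsPullback.of_hasPullback f.hom g.hom)
    (isWg_iff.1 X.property) (isWg_iff.1 Y.property) hZ).isWgp (isWg_iff.1 X.property)
    (isWg_iff.1 Y.property) hZ.isHd)⟩

/-- The first projection. -/
def CatWg.pullbackFst {X Y Z : CatWg.{u} n} (f : X ⟶ Z) (g : Y ⟶ Z) (hZ : IsLC n Z.obj) :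
    CatWg.pullback f g hZ ⟶ X :=
  ObjectProperty.homMk (pullback.fst f.hom g.hom)

/-- The second projection. -/
def CatWg.pullbackSnd {X Y Z : CatWg.{u} n} (f : X ⟶ Z) (g : Y ⟶ Z) (hZ : IsLC n Z.obj) :
    CatWg.pullback f g hZ ⟶ Y :=
  ObjectProperty.homMk (pullback.snd f.hom g.hom)

lemma CatWg.isPullback {X Y Z : CatWg.{u} n} (f : X ⟶ Z) (g : Y ⟶ Z) (hZ : IsLC n Z.obj) :
    IsPullback (CatWg.pullbackFst f g hZ) (CatWg.pullbackSnd f g hZ) f g :=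
  IsPullback.of_map (CatWg.incl n) (ObjectProperty.hom_ext _ pullback.condition)
    (IsPullback.of_hasPullback f.hom g.hom)

lemma isPullback_G {X Y Z : CatWg.{u} n} (f : X ⟶ Z) (g : Y ⟶ Z) (hZ : IsLC n Z.obj) :
    IsPullback ((G n).map (CatWg.pullbackFst f g hZ).hom) ((G n).map (CatWg.pullbackSnd f g hZ).hom)
      ((G n).map f.hom) ((G n).map g.hom) :=
  ((isReplacement_G n).hpb (HPB.of_isLC (IsPullback.of_hasPullback f.hom g.hom)
    (isWg_iff.1 X.property) (isWg_iff.1 Y.property) hZ) (isWg_iff.1 X.property)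
    (isWg_iff.1 Y.property) hZ.isHd).isPullback

lemma isPullback_GFTa {X Y Z : CatWg.{u} n} (f : X ⟶ Z) (g : Y ⟶ Z) (hZ : IsLC n Z.obj) :
    IsPullback ((GFTa n).map (CatWg.pullbackFst f g hZ)) ((GFTa n).map (CatWg.pullbackSnd f g hZ))
      ((GFTa n).map f) ((GFTa n).map g) := by
  have h := isPullback_G f g hZ
  refine IsPullback.mk' (FTaWg.Hom.ext h.w) ?_ ?_
  · intro T φ φ' h1 h2
    exact FTaWg.Hom.ext (h.hom_ext (congrArg FTaWg.Hom.hom h1) (congrArg FTaWg.Hom.hom h2))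
  · intro T a b w
    have e1 := h.lift_fst a.hom b.hom (congrArg FTaWg.Hom.hom w)
    have e2 := h.lift_snd a.hom b.hom (congrArg FTaWg.Hom.hom w)
    refine ⟨⟨h.lift a.hom b.hom (congrArg FTaWg.Hom.hom w), ?_⟩, FTaWg.Hom.ext e1,
      FTaWg.Hom.ext e2⟩
    refine compatible_of_isPullback n h ((GFTa n).map (CatWg.pullbackFst f g hZ)).compatible
      ((GFTa n).map (CatWg.pullbackSnd f g hZ)).compatible ?_ ?_
    · rw [e1]
      exact a.compatible
    · rw [e2]
      exact b.compatible

end PullbacksOverDiscrete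

end WG

end

theorem mainTheorem5 (n : ℕ) :
    ∃ Gn : WG.CatWg.{u} (n + 2) ⥤ WG.FTaWg.{u} (n + 2),
      Gn ⋙ WG.FTaWg.forget (n + 2) ⋙ WG.TaWg.incl (n + 2) =
        WG.CatWg.incl (n + 2) ⋙ WG.G (n + 2) ∧
      (∀ (X : WG.CatWg.{u} (n + 2)) (k : ℕ),
        WG.IsWg (n + 1) (WG.lev (WG.simp (Gn.obj X).obj) k)) ∧
      (∃ α : Gn ⋙ WG.FTaWg.forget (n + 2) ⟶ WG.CatWg.toTa (n + 2),
        (∀ X : WG.CatWg.{u} (n + 2), WG.IsEquivalence (n + 2) (α.app X).hom) ∧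
        ∀ X : WG.CatWg.{u} (n + 2), WG.IsDiscrete X.obj → IsIso (α.app X)) ∧
      (∀ (X Y : WG.CatWg.{u} (n + 2)) (f : X ⟶ Y),
        WG.IsEquivalence (n + 2) f.hom → WG.IsEquivalence (n + 2) (Gn.map f).hom) ∧
      (∀ (X Y Z : WG.CatWg.{u} (n + 2)) (f : X ⟶ Z) (g : Y ⟶ Z), WG.IsDiscrete Z.obj →
        PreservesLimit (cospan f g) Gn ∧
        PreservesLimit (cospan f g) (Gn ⋙ WG.FTaWg.forget (n + 2) ⋙ WG.TaWg.incl (n + 2))) := by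
  have hG := WG.isReplacement_G.{u} (n + 2)
  have hw (X : WG.CatWg.{u} (n + 2)) : WG.IsWgp (n + 2) X.obj := WG.isWg_iff.1 X.property
  refine ⟨WG.GFTa (n + 2), rfl, fun X k => WG.isWg_iff.2 ((hG.isWgp (hw X)).level _),
    ⟨WG.augGTa (n + 2), fun X => hG.isEquivalence (hw X), fun X hX => ?_⟩,
    fun X Y f h => WG.isEquivalence_G_map (hw X) (hw Y) h,
    fun X Y Z f g hZ => ⟨?_, ?_⟩⟩
  · have : IsIso ((WG.TaWg.incl (n + 2)).map ((WG.augGTa (n + 2)).app X)) :=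
      WG.isIso_augG_of_isLC X.obj hX.isLC
    exact isIso_of_reflects_iso _ (WG.TaWg.incl (n + 2))
  · exact WG.preservesLimit_cospan_of_isPullback _ (WG.CatWg.isPullback f g hZ.isLC)
      (WG.isPullback_GFTa f g hZ.isLC)
  · exact WG.preservesLimit_cospan_of_isPullback _ (WG.CatWg.isPullback f g hZ.isLC)
      (WG.isPullback_G f g hZ.isLC)
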